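/- Let $M, N_1, N_2 \ge 1$ be integers, $\sigma > 0$, $C_1, C_2 > 0$, and let all logarithms and mutual informations be in bits (base $2$). Let $\mathbf x \sim \mathcal{CN}(0, I_M)$, and for $k \in \{1,2\}$ let $\mathbf n_k \sim \mathcal{CN}(0, \sigma^2 I_{N_k})$, let $\mathbf H_k$ be an $N_k \times M$ random matrix with i.i.d. $\mathcal{CN}(0,1)$ entries, and put $\mathbf y_k = \mathbf H_k \mathbf x + \mathbf n_k$. Put $T_k = \min(N_k, M)$, let $\lambda_k$ be an unordered eigenvalue of $\mathbf H_k \mathbf H_k^H$ (one chosen uniformly at random among the $T_k$ almost surely positive ones), and let $$a_k = \frac{T_k}{M}\, \mathbb E\Big[\frac{\lambda_k}{\lambda_k + \sigma^2}\Big], \qquad D_k = \frac{a_k}{2^{C_k/M} - 1}, \qquad \mathbf F_k = (\mathbf H_k \mathbf H_k^H + \sigma^2 I_{N_k})^{-1} \mathbf H_k .$$ Relay $k$ forms the MMSE estimate $\bar{\mathbf x}_k = \mathbf F_k^H \mathbf y_k$ and outputs $\mathbf z_k = \bar{\mathbf x}_k + \mathbf q_k$ with $\mathbf q_k \sim \mathcal{CN}(0,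 D_k I_M)$, where $\mathbf x, \mathbf H_1, \mathbf H_2, \mathbf n_1, \mathbf n_2, \mathbf q_1, \mathbf q_2$ are mutually independent. Then the following hold. 1. The bottleneck constraints are met: for every $\mathcal T \subseteq \{1,2\}$, with complement $\overline{\mathcal T}$, $$I(\mathbf y_{\mathcal T}, \mathbf H_{\mathcal T}; \mathbf z_{\mathcal T} \mid \mathbf z_{\overline{\mathcal T}}) \le \sum_{k \in \mathcal T} C_k \quad\text{and}\quad I(\bar{\mathbf x}_{\mathcal T}; \mathbf z_{\mathcal T} \mid \mathbf z_{\overline{\mathcal T}}) \le \sum_{k \in \mathcal T} C_k .$$ 2. Let $$\mathbf G_k = \mathbb E[\mathbf F_k^H \mathbf H_k \mathbf H_k^H \mathbf F_k] - (\mathbb E[\mathbf F_k^H \mathbf H_k])^2 + \sigma^2\, \mathbb E[\mathbf F_k^H \mathbf F_k] + D_k I_M .$$ Then $D_k > 0$ and $\mathbf G_k = (a_k - a_k^2 + D_k)\, I_M$ with $a_k - a_k^2 + D_k > 0$. 3. Let $\mathbf K_{k,k} = \mathbf F_k^H \mathbf H_k \mathbf H_k^H \mathbf F_k + \sigma^2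 \mathbf F_k^H \mathbf F_k + D_k I_M$ and $\mathbf K_{i,j} = \mathbf F_i^H \mathbf H_i \mathbf H_j^H \mathbf F_j$ for $i \ne j$. Then $\lambda_k/(\lambda_k+\sigma^2)$, averaged over the $T_k$ eigenvalues, and $\log\det \begin{bmatrix} \mathbf K_{1,1} & \mathbf K_{1,2} \\ \mathbf K_{2,1} & \mathbf K_{2,2} \end{bmatrix}$ are integrable, and the scheme achieves the bottleneck rate $$I(\mathbf x; \mathbf z_1, \mathbf z_2) \;\ge\; R^{\mathrm{lb}2} := \mathbb E_{\mathbf H_1, \mathbf H_2}\left[\log\det \begin{bmatrix} \mathbf K_{1,1} & \mathbf K_{1,2} \\ \mathbf K_{2,1} & \mathbf K_{2,2} \end{bmatrix}\right] - \sum_{k=1}^{2} \log\det \mathbf G_k .$$ -/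

import Mathlib

open MeasureTheory ProbabilityTheory Matrix
open scoped ENNReal

noncomputable section

namespace Diamond

/-! ### Measurable structure on matrices -/

/-- Matrices carry the product sigma-algebra of their entries. -/
instance matrixMeasurableSpace (m n : ℕ) : MeasurableSpace (Matrix (Fin m) (Fin n) ℂ) :=
  inferInstanceAs (MeasurableSpace (Fin m → Fin n → ℂ))

instance matrixStandardBorelSpace (m n : ℕ) :
    StandardBorelSpace (Matrix (Fin m) (Fin n) ℂ) :=
  inferInstanceAs (StandardBorelSpace (Fin m → Fin n → ℂ))

/-! ### Mutual information, in bits -/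

section Information

variable {Ω α β γ : Type*} [MeasurableSpace Ω] [MeasurableSpace α] [MeasurableSpace β]
  [MeasurableSpace γ]

/-- The mutual information `I(A; B)` in bits: the Kullback-Leibler divergence (which Mathlib
measures in nats) of the joint law from the product of the marginal laws, divided by `log 2`. -/
def mutualInfo (A : Ω → α) (B : Ω → β) (μ : Measure Ω) : ℝ≥0∞ :=
  InformationTheory.klDiv (μ.map fun ω => (A ω, B ω)) ((μ.map A).prod (μ.map B))
    / ENNReal.ofReal (Real.log 2)

/-- The conditional mutual information `I(A; B | G)` in bits: the Kullback-Leibler divergence of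
the joint law of `(G, (A, B))` from the law under which `G` has the same distribution and, given
`G`, the variables `A` and `B` are independent with their conditional laws given `G`. -/
def condMutualInfo [StandardBorelSpace α] [Nonempty α] [StandardBorelSpace β] [Nonempty β]
    (A : Ω → α) (B : Ω → β) (G : Ω → γ) (μ : Measure Ω) [IsFiniteMeasure μ] : ℝ≥0∞ :=
  InformationTheory.klDiv (μ.map fun ω => (G ω, (A ω, B ω)))
      (μ.map G ⊗ₘ (condDistrib A G μ ×ₖ condDistrib B G μ))
    / ENNReal.ofReal (Real.log 2)

end Information

/-! ### Circularly symmetric complex Gaussian laws -/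

/-- `CN(0, v)`: real and imaginary parts are independent real Gaussians with mean `0` and
variance `v / 2` each (used for `0 ≤ v` only). -/
def complexGaussian (v : ℝ) : Measure ℂ :=
  ((gaussianReal 0 (v / 2).toNNReal).prod (gaussianReal 0 (v / 2).toNNReal)).map
    fun p => (⟨p.1, p.2⟩ : ℂ)

/-- `CN(0, v I_n)` on `ℂⁿ`. -/
def complexGaussianVec (n : ℕ) (v : ℝ) : Measure (Fin n → ℂ) :=
  Measure.pi fun _ => complexGaussian v

/-- The law of an `N × M` Rayleigh fading matrix: i.i.d. `CN(0, 1)` entries. -/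
def rayleighLaw (N M : ℕ) : Measure (Matrix (Fin N) (Fin M) ℂ) :=
  Measure.pi fun _ : Fin N => Measure.pi fun _ : Fin M => complexGaussian 1

/-! ### The MMSE-based scheme -/

section Scheme

variable {M : ℕ}

/-- `F = (H Hᴴ + σ² I)⁻¹ H`, the matrix whose conjugate transpose is the MMSE estimator. -/
def mmseF (σ : ℝ) {N : ℕ} (H : Matrix (Fin N) (Fin M) ℂ) : Matrix (Fin N) (Fin M) ℂ :=
  (H * Hᴴ + ((σ ^ 2 : ℝ) : ℂ) • (1 : Matrix (Fin N) (Fin N) ℂ))⁻¹ * H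

/-- The average of `λ / (λ + σ²)` over the `min N M` largest eigenvalues `λ` of `H Hᴴ`. As `H Hᴴ`
has rank at most `min N M`, all the others vanish. -/
def eigenAverage (σ : ℝ) {N : ℕ} (H : Matrix (Fin N) (Fin M) ℂ) : ℝ :=
  (∑ j : Fin (min N M),
    (isHermitian_mul_conjTranspose_self H).eigenvalues₀ (Fin.castLE (by simp) j) /
      ((isHermitian_mul_conjTranspose_self H).eigenvalues₀ (Fin.castLE (by simp) j) + σ ^ 2))
    / (min N M : ℕ)

/-- `E[λ / (λ + σ²)]`, where `λ` is an unordered eigenvalue of `H Hᴴ` for an `N × M` Rayleigh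
matrix `H`, i.e. one picked uniformly at random among its `min N M` (almost surely positive)
leading eigenvalues. -/
def eigenMean (M N : ℕ) (σ : ℝ) : ℝ :=
  ∫ H, eigenAverage σ H ∂(rayleighLaw N M)

/-- The quantization noise level
`D = (T / M) E[λ / (λ + σ²)] / (2 ^ (C / M) - 1)`, with `T = min N M`. -/
def quantNoise (M N : ℕ) (σ C : ℝ) : ℝ :=
  ((min N M : ℕ) / (M : ℝ) * eigenMean M N σ) / ((2 : ℝ) ^ (C / (M : ℝ)) - 1)

/-- The diagonal block `Fᴴ H Hᴴ F + σ² Fᴴ F + D I` of the covariance of `(z₁, z₂)` given the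
channels. -/
def covDiag (σ D : ℝ) {N : ℕ} (H : Matrix (Fin N) (Fin M) ℂ) : Matrix (Fin M) (Fin M) ℂ :=
  (mmseF σ H)ᴴ * H * Hᴴ * mmseF σ H + ((σ ^ 2 : ℝ) : ℂ) • ((mmseF σ H)ᴴ * mmseF σ H)
    + (D : ℂ) • (1 : Matrix (Fin M) (Fin M) ℂ)

/-- The off-diagonal block `F_iᴴ H_i H_jᴴ F_j` of the covariance of `(z₁, z₂)` given the
channels. -/
def covCross (σ : ℝ) {N N' : ℕ} (H : Matrix (Fin N) (Fin M) ℂ)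
    (H' : Matrix (Fin N') (Fin M) ℂ) : Matrix (Fin M) (Fin M) ℂ :=
  (mmseF σ H)ᴴ * H * H'ᴴ * mmseF σ H'

/-- The `2 × 2` block matrix `K` with blocks `K_{ij}`; relay `k = 1, 2` is indexed by
`0, 1 : Fin 2`. -/
def covBlock {N : Fin 2 → ℕ} (σ : ℝ) (D : Fin 2 → ℝ)
    (H : (k : Fin 2) → Matrix (Fin (N k)) (Fin M) ℂ) :
    Matrix (Fin M ⊕ Fin M) (Fin M ⊕ Fin M) ℂ :=
  fromBlocks (covDiag σ (D 0) (H 0)) (covCross σ (H 0) (H 1))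
    (covCross σ (H 1) (H 0)) (covDiag σ (D 1) (H 1))

/-- The entrywise expectation of a random matrix that is a function of a Rayleigh matrix. -/
def meanMatrix {N : ℕ} (f : Matrix (Fin N) (Fin M) ℂ → Matrix (Fin M) (Fin M) ℂ) :
    Matrix (Fin M) (Fin M) ℂ :=
  Matrix.of fun a b => ∫ H, f H a b ∂(rayleighLaw N M)

/-- `G = E[Fᴴ H Hᴴ F] - (E[Fᴴ H])² + σ² E[Fᴴ F] + D I`. -/
def matG (M N : ℕ) (σ D : ℝ) : Matrix (Fin M) (Fin M) ℂ :=
  meanMatrix (N := N) (fun H => (mmseF σ H)ᴴ * H * Hᴴ * mmseF σ H)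
    - meanMatrix (N := N) (fun H => (mmseF σ H)ᴴ * H) ^ 2
    + ((σ ^ 2 : ℝ) : ℂ) • meanMatrix (N := N) (fun H => (mmseF σ H)ᴴ * mmseF σ H)
    + (D : ℂ) • (1 : Matrix (Fin M) (Fin M) ℂ)

/-- `log₂ det K` as a function of the channel realization (`K` is Hermitian, so that its
determinant is real). -/
def logDetCov {N : Fin 2 → ℕ} (σ : ℝ) (D : Fin 2 → ℝ)
    (H : (k : Fin 2) → Matrix (Fin (N k)) (Fin M) ℂ) : ℝ :=
  Real.logb 2 (covBlock σ D H).det.re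

/-- The joint law of the independent channels. -/
def channelLaw (M : ℕ) (N : Fin 2 → ℕ) :
    Measure ((k : Fin 2) → Matrix (Fin (N k)) (Fin M) ℂ) :=
  Measure.pi fun k => rayleighLaw (N k) M

/-- The rate `E[log₂ det K] - ∑ₖ log₂ det Gₖ`. -/
def rateLB (M : ℕ) (N : Fin 2 → ℕ) (σ : ℝ) (C : Fin 2 → ℝ) : ℝ :=
  (∫ H, logDetCov σ (fun k => quantNoise M (N k) σ (C k)) H ∂(channelLaw M N))
    - ∑ k, Real.logb 2 (matG M (N k) σ (quantNoise M (N k) σ (C k))).det.re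

/-- The law of the tuple `(x, (Hₖ)ₖ, (nₖ)ₖ, (qₖ)ₖ)` of mutually independent inputs, channels,
receiver noises and quantization noises: `x ∼ CN(0, I_M)`, `Hₖ` Rayleigh of size `Nₖ × M`,
`nₖ ∼ CN(0, σ² I_{Nₖ})`, `qₖ ∼ CN(0, Dₖ I_M)`. -/
def systemLaw (M : ℕ) (N : Fin 2 → ℕ) (σ : ℝ) (D : Fin 2 → ℝ) :
    Measure ((Fin M → ℂ) × ((k : Fin 2) → Matrix (Fin (N k)) (Fin M) ℂ) ×
      ((k : Fin 2) → Fin (N k) → ℂ) × (Fin 2 → Fin M → ℂ)) :=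
  (complexGaussianVec M 1).prod ((channelLaw M N).prod
    ((Measure.pi fun k => complexGaussianVec (N k) (σ ^ 2)).prod
      (Measure.pi fun k => complexGaussianVec M (D k))))

end Scheme

end Diamond

end

noncomputable section

namespace Diamond

/-! ### Kullback-Leibler divergence -/

section KullbackLeibler

open InformationTheory

variable {α β γ Ω : Type*} [MeasurableSpace α] [MeasurableSpace β] [MeasurableSpace γ]
  [MeasurableSpace Ω]

/-! Write `a` for the mean diagonal entry of `Fᴴ H` (`mmseGain`), one for each relay.

Constraints: `z = x̄ + q` with `q` Gaussian and independent of everything else. For every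
probability measure `Q`, the divergence that defines `I(A; B | G)` is at most the divergence of the
law of `((G, A), B)` from `P_{GA} × Q` (`klDiv_condDistrib_le`). For `Q` Gaussian with the output
powers `a + D`, the log-density is quadratic, so only second moments enter and the bound is the
Gaussian capacity, the sum of `M log₂ ((a + D) / D)` (`condMutualInfo_le_of_additive_noise`). The
level `D` makes each summand equal to `C`.

Form of `G`: the Rayleigh law is invariant under right multiplication by unitaries, hence `E[Fᴴ H] =
a I` (`meanMatrix_mmseF_mul`). The identity `Fᴴ H Hᴴ F + σ² Fᴴ F = Fᴴ H` (`mmse_covariance`) then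
reduces `G` to `(a - a² + D) I`.

Rate: in terms of entropies, `h(z) ≥ h(z | H)`, where `z` given `H` is Gaussian with covariance `K`,
while `h(z | x)` is at most the entropy of Gaussian noise with the mean square error of `z - a x`,
which is `a - a² + D` per coordinate. With divergences from `Q = CN(0, I)`, this reads `I(x; z) =
KL(P_{xz} ‖ P_x × Q) - KL(P_z ‖ Q)`. The first term is bounded below by the mean log-density of the
test channel `a x + noise` (`ofReal_integral_le_klDiv`), although the true channel given `x` need
not be Gaussian. The second is at most `KL(P_{Hz} ‖ P_H × Q)`, which is explicit
(`map_pairOut_eq_withDensity`). Quadratic terms cancel in the mean, leaving `E[log det K] - M ∑ log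
(a - a² + D)` (`ofReal_rate_le_klDiv`). -/

lemma klDiv_map_measurableEquiv (P Q : Measure α) [IsFiniteMeasure P] [IsFiniteMeasure Q]
    (e : α ≃ᵐ β) : klDiv (P.map e) (Q.map e) = klDiv P Q := by
  refine le_antisymm (klDiv_map_le P Q e.measurable) ?_
  have h := klDiv_map_le (P.map e) (Q.map e) e.symm.measurable
  simpa [Measure.map_map e.symm.measurable e.measurable] using h

/-- The log-likelihood ratio is `l` almost everywhere for `Q`, hence for `P ≪ Q`. Nonnegativity is
recorded because it is lost under `ENNReal.ofReal` and is needed later to split a difference. -/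
lemma klDiv_withDensity_exp {P Q : Measure α} [IsProbabilityMeasure P] [IsProbabilityMeasure Q]
    {l : α → ℝ} (hl : Measurable l) (hP : P = Q.withDensity fun a => ENNReal.ofReal (Real.exp (l a)))
    (hint : Integrable l P) :
    0 ≤ ∫ a, l a ∂P ∧ klDiv P Q = ENNReal.ofReal (∫ a, l a ∂P) := by
  have hac : P ≪ Q := hP ▸ withDensity_absolutelyContinuous _ _
  have hllr : llr P Q =ᵐ[P] l := by
    apply hac.ae_le
    have h := Measure.rnDeriv_withDensity Q
      (f := fun a => ENNReal.ofReal (Real.exp (l a))) (by fun_prop)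
    rw [← hP] at h
    filter_upwards [h] with a ha
    simp [llr, ha, ENNReal.toReal_ofReal (Real.exp_pos _).le]
  have h := integral_llr_add_sub_measure_univ_nonneg hac ((integrable_congr hllr).2 hint)
  rw [klDiv_of_ac_of_integrable hac ((integrable_congr hllr).2 hint)]
  rw [integral_congr_ae hllr] at h ⊢
  simpa using h

/-- A variational lower bound on the divergence. -/
lemma ofReal_integral_le_klDiv {P Q : Measure α} [IsProbabilityMeasure P] [IsProbabilityMeasure Q]
    {l : α → ℝ} (hexp : Integrable (fun a => Real.exp (l a)) Q)
    (hone : ∫ a, Real.exp (l a) ∂Q = 1) (hint : Integrable l P) :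
    ENNReal.ofReal (∫ a, l a ∂P) ≤ klDiv P Q := by
  by_cases htop : klDiv P Q = ∞
  · simp [htop]
  obtain ⟨hac, hllr⟩ := klDiv_ne_top_iff.1 htop
  -- Nonnegativity of the divergence from `Q` tilted by `l` is the claim: its log-likelihood ratio
  -- is `llr P Q - l` plus the logarithm of the normalizing constant, which is 1.
  have := isProbabilityMeasure_tilted hexp
  have h := integral_llr_add_sub_measure_univ_nonneg
    (hac.trans (absolutelyContinuous_tilted hexp)) (integrable_llr_tilted_right hac hint hllr hexp)
  rw [integral_llr_tilted_right hac hint hexp hllr, hone] at h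
  rw [klDiv_of_ac_of_integrable hac hllr]
  apply ENNReal.ofReal_le_ofReal
  simp at h ⊢
  linarith

/-- Chain rule with `B` taken first: both product measures have the same constant kernel, the law of
`A`, over their `B`-marginals. It trades the intractable marginal of `B` for an explicit `Q`. -/
lemma klDiv_map_prodMk_prod [StandardBorelSpace α] [Nonempty α] (P : Measure Ω)
    [IsProbabilityMeasure P] {A : Ω → α} {B : Ω → β} (hA : AEMeasurable A P)
    (hB : AEMeasurable B P) (Q : Measure β) [IsProbabilityMeasure Q] :
    klDiv (P.map fun ω => (A ω, B ω)) ((P.map A).prod Q) =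
      klDiv (P.map B) Q + klDiv (P.map fun ω => (A ω, B ω)) ((P.map A).prod (P.map B)) := by
  have := Measure.isProbabilityMeasure_map hA
  have := Measure.isProbabilityMeasure_map hB
  have := Measure.isProbabilityMeasure_map (hA.prodMk hB)
  have := Measure.isProbabilityMeasure_map (hB.prodMk hA)
  have hjoint : (P.map fun ω => (A ω, B ω)).map (MeasurableEquiv.prodComm : α × β ≃ᵐ β × α) =
      (P.map B) ⊗ₘ condDistrib A B P := by
    rw [compProd_map_condDistrib hA, AEMeasurable.map_map_of_aemeasurable
      (MeasurableEquiv.measurable _).aemeasurable (hA.prodMk hB)]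
    rfl
  have hprod (S : Measure β) [IsProbabilityMeasure S] :
      ((P.map A).prod S).map (MeasurableEquiv.prodComm : α × β ≃ᵐ β × α) =
      S ⊗ₘ Kernel.const β (P.map A) := by
    rw [Measure.compProd_const]
    exact Measure.prod_swap
  rw [← klDiv_map_measurableEquiv _ ((P.map A).prod Q) MeasurableEquiv.prodComm,
    ← klDiv_map_measurableEquiv _ ((P.map A).prod (P.map B)) MeasurableEquiv.prodComm,
    hjoint, hprod, hprod, klDiv_compProd_eq_add]

/-- The divergence that defines conditional mutual information is at most the one from any product
law. -/
lemma klDiv_condDistrib_le [StandardBorelSpace α] [Nonempty α] [StandardBorelSpace β] [Nonempty β]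
    (P : Measure Ω) [IsProbabilityMeasure P] {A : Ω → α} {B : Ω → β} {G : Ω → γ}
    (hA : AEMeasurable A P) (hB : AEMeasurable B P) (hG : AEMeasurable G P)
    (Q : Measure β) [IsProbabilityMeasure Q] :
    klDiv (P.map fun ω => (G ω, (A ω, B ω)))
        (P.map G ⊗ₘ (condDistrib A G P ×ₖ condDistrib B G P)) ≤
      klDiv (P.map fun ω => ((G ω, A ω), B ω)) ((P.map fun ω => (G ω, A ω)).prod Q) := by
  have := Measure.isProbabilityMeasure_map hG
  have := Measure.isProbabilityMeasure_map (hG.prodMk hA)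
  have := Measure.isProbabilityMeasure_map (hG.prodMk hB)
  have := Measure.isProbabilityMeasure_map (hG.prodMk (hA.prodMk hB))
  have := Measure.isProbabilityMeasure_map ((hG.prodMk hA).prodMk hB)
  -- Both sides are rearranged so that `(G, B)` comes first and `A` second. The two reference
  -- measures then share the kernel `κ`, the law of `A` given `G` alone, and the chain rule shows
  -- that the right side exceeds the left by the divergence of `P_{GB}` from `P_G × Q`.
  let e₁ : (γ × α) × β ≃ᵐ (γ × β) × α :=
    { toFun := fun p => ((p.1.1, p.2), p.1.2)
      invFun := fun p => ((p.1.1, p.2), p.1.2)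
      left_inv := fun _ => rfl
      right_inv := fun _ => rfl
      measurable_toFun := by dsimp; fun_prop
      measurable_invFun := by dsimp; fun_prop }
  let e₂ : γ × (α × β) ≃ᵐ (γ × β) × α :=
    { toFun := fun p => ((p.1, p.2.2), p.2.1)
      invFun := fun p => (p.1.1, (p.2, p.1.2))
      left_inv := fun _ => rfl
      right_inv := fun _ => rfl
      measurable_toFun := by dsimp; fun_prop
      measurable_invFun := by dsimp; fun_prop }
  let κ : Kernel (γ × β) α := (condDistrib A G P).comap Prod.fst measurable_fst
  have h₁ : (P.map fun ω => ((G ω, A ω), B ω)).map e₁ =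
      (P.map fun ω => (G ω, B ω)) ⊗ₘ condDistrib A (fun ω => (G ω, B ω)) P := by
    rw [compProd_map_condDistrib hA, AEMeasurable.map_map_of_aemeasurable
      (MeasurableEquiv.measurable _).aemeasurable ((hG.prodMk hA).prodMk hB)]
    rfl
  have h₂ : (P.map fun ω => (G ω, (A ω, B ω))).map e₂ =
      (P.map fun ω => (G ω, B ω)) ⊗ₘ condDistrib A (fun ω => (G ω, B ω)) P := by
    rw [compProd_map_condDistrib hA, AEMeasurable.map_map_of_aemeasurable
      (MeasurableEquiv.measurable _).aemeasurable (hG.prodMk (hA.prodMk hB))]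
    rfl
  have h₃ : ((P.map fun ω => (G ω, A ω)).prod Q).map e₁ = ((P.map G).prod Q) ⊗ₘ κ := by
    refine Measure.ext_of_lintegral _ fun f hf => ?_
    rw [lintegral_map hf e₁.measurable, ← compProd_map_condDistrib hA,
      lintegral_prod _ (by fun_prop), Measure.lintegral_compProd
        (f := fun p => ∫⁻ b, f (e₁ (p, b)) ∂Q) (hf.comp e₁.measurable).lintegral_prod_right',
      Measure.lintegral_compProd hf, lintegral_prod _ (Measurable.aemeasurable (Measurable.lintegral_kernel_prod_right' hf))]
    refine lintegral_congr fun g => ?_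
    simp only [κ, Kernel.comap_apply]
    exact lintegral_lintegral_swap
      (f := fun a b => f ((g, b), a)) (by fun_prop)
  have h₄ : (P.map G ⊗ₘ (condDistrib A G P ×ₖ condDistrib B G P)).map e₂ =
      (P.map fun ω => (G ω, B ω)) ⊗ₘ κ := by
    refine Measure.ext_of_lintegral _ fun f hf => ?_
    rw [lintegral_map hf e₂.measurable, Measure.lintegral_compProd
        (f := fun p => f (e₂ p)) (hf.comp e₂.measurable),
      ← compProd_map_condDistrib hB, Measure.lintegral_compProd hf, Measure.lintegral_compProd
        (Measurable.lintegral_kernel_prod_right' hf)]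
    refine lintegral_congr fun g => ?_
    simp only [κ, Kernel.comap_apply, Kernel.prod_apply]
    exact lintegral_prod_symm' (f := fun ab : α × β => f ((g, ab.2), ab.1)) (by fun_prop)
  rw [← klDiv_map_measurableEquiv _ _ e₁, ← klDiv_map_measurableEquiv _ _ e₂, h₁, h₂, h₃, h₄,
    klDiv_compProd_eq_add (ν := (P.map G).prod Q)]
  exact self_le_add_left _ _

end KullbackLeibler

/-! ### Densities of exponential form -/

section Density

variable {α β γ : Type*} [MeasurableSpace α] [MeasurableSpace β] [MeasurableSpace γ]

lemma pi_withDensity_exp {ι : Type*} [Fintype ι] {E : ι → Type*} [∀ i, MeasurableSpace (E i)]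
    (ν : ∀ i, Measure (E i)) [∀ i, SigmaFinite (ν i)] (l : ∀ i, E i → ℝ)
    (hl : ∀ i, Measurable (l i))
    [∀ i, IsFiniteMeasure ((ν i).withDensity fun a => ENNReal.ofReal (Real.exp (l i a)))] :
    (Measure.pi fun i => (ν i).withDensity fun a => ENNReal.ofReal (Real.exp (l i a))) =
      (Measure.pi ν).withDensity fun a => ENNReal.ofReal (Real.exp (∑ i, l i (a i))) := by
  -- Finiteness of each factor gives integrability, so that the measure of a box can be computed by
  -- the product formula for Bochner integrals.
  have hint : ∀ i, Integrable (fun a => Real.exp (l i a)) (ν i) := fun i => by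
    refine ⟨(Real.measurable_exp.comp (hl i)).aestronglyMeasurable, ?_⟩
    have h := measure_lt_top ((ν i).withDensity fun a => ENNReal.ofReal (Real.exp (l i a))) Set.univ
    rw [withDensity_apply _ MeasurableSet.univ, setLIntegral_univ] at h
    rw [hasFiniteIntegral_iff_ofReal (Filter.Eventually.of_forall fun a => (Real.exp_pos _).le)]
    exact h
  refine Measure.pi_eq fun s hs => ?_
  have hind : ∀ i, Integrable ((s i).indicator fun a => Real.exp (l i a)) (ν i) :=
    fun i => (hint i).indicator (hs i)
  have hnn : ∀ i a, 0 ≤ (s i).indicator (fun a => Real.exp (l i a)) a :=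
    fun i a => Set.indicator_nonneg (fun a _ => (Real.exp_pos _).le) a
  have h1 : ∀ i, (ν i).withDensity (fun a => ENNReal.ofReal (Real.exp (l i a))) (s i) =
      ENNReal.ofReal (∫ a, (s i).indicator (fun a => Real.exp (l i a)) a ∂ν i) := fun i => by
    rw [withDensity_apply _ (hs i), ofReal_integral_eq_lintegral_ofReal (hind i)
      (Filter.Eventually.of_forall (hnn i)), ← lintegral_indicator (hs i)]
    refine lintegral_congr fun a => ?_
    by_cases ha : a ∈ s i <;> simp [ha]
  rw [Finset.prod_congr rfl fun i _ => h1 i, ← ENNReal.ofReal_prod_of_nonneg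
    fun i _ => integral_nonneg (hnn i), ← integral_fintype_prod_eq_prod,
    ofReal_integral_eq_lintegral_ofReal (Integrable.fintype_prod_dep hind)
      (Filter.Eventually.of_forall fun a => Finset.prod_nonneg fun i _ => hnn i _),
    withDensity_apply _ (MeasurableSet.univ_pi hs), ← lintegral_indicator (MeasurableSet.univ_pi hs)]
  refine lintegral_congr fun a => ?_
  by_cases ha : a ∈ Set.univ.pi s
  · rw [Set.indicator_of_mem ha, Real.exp_sum]
    congr 1
    exact Finset.prod_congr rfl fun i _ => by rw [Set.indicator_of_mem (ha i trivial)]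
  · rw [Set.indicator_of_notMem ha]
    simp only [Set.mem_pi, Set.mem_univ, true_implies, not_forall] at ha
    obtain ⟨i, hi⟩ := ha
    rw [Finset.prod_eq_zero (Finset.mem_univ i) (Set.indicator_of_notMem hi _), ENNReal.ofReal_zero]

/-- The joint law of a parameter and a variable whose law given the parameter has a density. -/
lemma map_prodMk_eq_withDensity {P : Measure α} {ν : Measure β} {Q : Measure γ} [SFinite P]
    [SFinite ν] [SFinite Q] {φ : α × β → γ} (hφ : Measurable φ) {f : α × γ → ℝ≥0∞}
    (hf : Measurable f)
    (h : ∀ a, ν.map (fun b => φ (a, b)) = Q.withDensity fun c => f (a, c)) :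
    (P.prod ν).map (fun p => (p.1, φ p)) = (P.prod Q).withDensity f := by
  refine Measure.ext_of_lintegral _ fun g hg => ?_
  rw [lintegral_map hg (by fun_prop), lintegral_prod _ (by fun_prop),
    lintegral_withDensity_eq_lintegral_mul _ hf hg, lintegral_prod _ (by fun_prop)]
  refine lintegral_congr fun a => ?_
  have hga : Measurable fun c => g (a, c) := by fun_prop
  have hφa : Measurable fun b => φ (a, b) := by fun_prop
  have hfa : Measurable fun c => f (a, c) := by fun_prop
  rw [← lintegral_map (f := fun c => g (a, c)) hga hφa, h,
    lintegral_withDensity_eq_lintegral_mul _ hfa hga]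
  rfl

end Density

/-! ### Complex Gaussian measures -/

section Gaussian

instance isProbabilityMeasure_complexGaussian (v : ℝ) :
    IsProbabilityMeasure (complexGaussian v) :=
  Measure.isProbabilityMeasure_map
    (Complex.measurableEquivRealProd.symm.measurable.aemeasurable)

instance isProbabilityMeasure_complexGaussianVec (n : ℕ) (v : ℝ) :
    IsProbabilityMeasure (complexGaussianVec n v) := by
  unfold complexGaussianVec; infer_instance

instance isProbabilityMeasure_rayleighLaw (N M : ℕ) :
    IsProbabilityMeasure (rayleighLaw N M) :=
  inferInstanceAs (IsProbabilityMeasure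
    (Measure.pi fun _ : Fin N => Measure.pi fun _ : Fin M => complexGaussian 1))

instance isProbabilityMeasure_channelLaw (M : ℕ) (N : Fin 2 → ℕ) :
    IsProbabilityMeasure (channelLaw M N) := by
  unfold channelLaw; infer_instance

lemma map_withDensity_measurableEquiv {α β : Type*} [MeasurableSpace α] [MeasurableSpace β]
    (μ : Measure α) (e : α ≃ᵐ β) {f : α → ℝ≥0∞} (hf : Measurable f) :
    (μ.withDensity f).map e = (μ.map e).withDensity (f ∘ e.symm) := by
  refine Measure.ext_of_lintegral _ fun g hg => ?_
  rw [lintegral_map hg e.measurable, lintegral_withDensity_eq_lintegral_mul _ hf (by fun_prop),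
    lintegral_withDensity_eq_lintegral_mul _ (by fun_prop) hg, lintegral_map (by fun_prop)
      e.measurable]
  simp

lemma complexGaussian_eq_withDensity {v : ℝ} (hv : 0 < v) :
    complexGaussian v = (volume : Measure ℂ).withDensity
      fun z => ENNReal.ofReal (Real.exp (-Real.log (Real.pi * v) - ‖z‖ ^ 2 / v)) := by
  have hv' : (v / 2).toNNReal ≠ 0 := by
    simpa using hv
  have h1 : complexGaussian v = ((gaussianReal 0 (v / 2).toNNReal).prod
      (gaussianReal 0 (v / 2).toNNReal)).map Complex.measurableEquivRealProd.symm := rfl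
  rw [h1, gaussianReal_of_var_ne_zero _ hv', prod_withDensity (measurable_gaussianPDF _ _)
    (measurable_gaussianPDF _ _), map_withDensity_measurableEquiv _ _ (by fun_prop),
    ← Measure.volume_eq_prod, (Complex.volume_preserving_equiv_real_prod.symm).map_eq]
  congr 1
  funext z
  have hπ := Real.pi_pos
  simp only [Function.comp, gaussianPDF, gaussianPDFReal, MeasurableEquiv.symm_symm,
    Complex.measurableEquivRealProd_apply, sub_zero]
  rw [← ENNReal.ofReal_mul (by positivity), Real.coe_toNNReal _ (by positivity), sub_eq_add_neg,
    Real.exp_add, Real.exp_neg, Real.exp_log (by positivity)]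
  congr 1
  -- The two normalizing constants `√(2π · v/2)` multiply to `π v`.
  rw [mul_mul_mul_comm, ← Real.exp_add, ← mul_inv, Real.mul_self_sqrt (by positivity),
    Complex.sq_norm, Complex.normSq_apply]
  congr 2
  · field_simp
  · field_simp
    ring

/-- The logarithm of the density of `CN(m, D)` with respect to `CN(0, v)`. -/
def logRatio (D v : ℝ) (m z : ℂ) : ℝ := Real.log (v / D) - ‖z - m‖ ^ 2 / D + ‖z‖ ^ 2 / v

lemma map_add_complexGaussian {D v : ℝ} (hD : 0 < D) (hv : 0 < v) (m : ℂ) :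
    (complexGaussian D).map (fun z => m + z) = (complexGaussian v).withDensity
      fun z => ENNReal.ofReal (Real.exp (logRatio D v m z)) := by
  have h1 := map_withDensity_measurableEquiv (volume : Measure ℂ) (MeasurableEquiv.addLeft m)
    (f := fun z => ENNReal.ofReal (Real.exp (-Real.log (Real.pi * D) - ‖z‖ ^ 2 / D)))
    (by fun_prop)
  rw [complexGaussian_eq_withDensity hD, complexGaussian_eq_withDensity hv]
  refine h1.trans ?_
  have h2 : (volume : Measure ℂ).map (MeasurableEquiv.addLeft m) = volume :=
    map_add_left_eq_self _ m
  rw [h2, ← withDensity_mul _ (by fun_prop) (by unfold logRatio; fun_prop)]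
  congr 1
  funext z
  have hπ := Real.pi_pos
  simp only [Function.comp, Pi.mul_apply, MeasurableEquiv.symm_addLeft,
    MeasurableEquiv.coe_addLeft]
  rw [← ENNReal.ofReal_mul (Real.exp_pos _).le, ← Real.exp_add, logRatio,
    Real.log_div hv.ne' hD.ne', Real.log_mul hπ.ne' hv.ne', Real.log_mul hπ.ne' hD.ne',
    neg_add_eq_sub]
  congr 2
  ring

lemma map_add_pi_complexGaussian {ι : Type*} [Fintype ι] {D v : ι → ℝ} (hD : ∀ i, 0 < D i)
    (hv : ∀ i, 0 < v i) (m : ι → ℂ) :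
    (Measure.pi fun i => complexGaussian (D i)).map (fun z => m + z) =
      (Measure.pi fun i => complexGaussian (v i)).withDensity
        fun z => ENNReal.ofReal (Real.exp (∑ i, logRatio (D i) (v i) (m i) (z i))) := by
  have hp : ∀ i, IsProbabilityMeasure ((complexGaussian (v i)).withDensity
      fun z => ENNReal.ofReal (Real.exp (logRatio (D i) (v i) (m i) z))) := fun i => by
    rw [← map_add_complexGaussian (hD i) (hv i)]
    exact Measure.isProbabilityMeasure_map (by fun_prop)
  have hp' : ∀ i, IsProbabilityMeasure ((complexGaussian (D i)).map (fun z => m i + z)) :=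
    fun i => Measure.isProbabilityMeasure_map (by fun_prop)
  rw [← pi_withDensity_exp _ _ fun i => by unfold logRatio; fun_prop]
  rw [← funext fun i => map_add_complexGaussian (hD i) (hv i) (m i),
    ← Measure.pi_map_pi (f := fun i z => m i + z) (fun i => by fun_prop)]
  rfl

/-! #### Laws of linear functionals -/

/-- Centered Gaussian laws are recognized through characteristic functions; this lemma and the next
translate in the two directions. -/
lemma map_eq_gaussianReal_of_integral {α : Type*} [MeasurableSpace α] {P : Measure α}
    [IsProbabilityMeasure P] {X : α → ℝ} (hX : Measurable X) {w : NNReal}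
    (h : ∀ t : ℝ, ∫ a, Complex.exp (t * X a * Complex.I) ∂P = Complex.exp (-(w * t ^ 2 / 2))) :
    P.map X = gaussianReal 0 w := by
  have := Measure.isProbabilityMeasure_map (μ := P) hX.aemeasurable
  refine Measure.ext_of_charFun (funext fun t => ?_)
  rw [charFun_gaussianReal, charFun_apply_real, integral_map hX.aemeasurable (by fun_prop), h]
  simp

lemma integral_exp_of_map_eq_gaussianReal {α : Type*} [MeasurableSpace α] {P : Measure α}
    {X : α → ℝ} (hX : Measurable X) {w : NNReal} (h : P.map X = gaussianReal 0 w) (t : ℝ) :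
    ∫ a, Complex.exp (t * X a * Complex.I) ∂P = Complex.exp (-(w * t ^ 2 / 2)) := by
  have h2 := charFun_gaussianReal (μ := 0) (v := w) t
  rw [← h, charFun_apply_real, integral_map hX.aemeasurable (by fun_prop)] at h2
  simpa using h2

lemma map_sum_pi_gaussianReal {ι : Type*} [Fintype ι] {E : ι → Type*} [∀ i, MeasurableSpace (E i)]
    {P : ∀ i, Measure (E i)} [∀ i, IsProbabilityMeasure (P i)] {X : ∀ i, E i → ℝ}
    (hX : ∀ i, Measurable (X i)) {w : ι → NNReal} (h : ∀ i, (P i).map (X i) = gaussianReal 0 (w i)) :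
    (Measure.pi P).map (fun a => ∑ i, X i (a i)) = gaussianReal 0 (∑ i, w i) := by
  refine map_eq_gaussianReal_of_integral (by fun_prop) fun t => ?_
  have h1 : ∀ a : ∀ i, E i, Complex.exp (t * ((∑ i, X i (a i) : ℝ) : ℂ) * Complex.I) =
      ∏ i, Complex.exp (t * X i (a i) * Complex.I) := fun a => by
    rw [← Complex.exp_sum, Complex.ofReal_sum, Finset.mul_sum, Finset.sum_mul]
  simp_rw [h1]
  rw [integral_fintype_prod_eq_prod (f := fun i b => Complex.exp (t * X i b * Complex.I)),
    Finset.prod_congr rfl fun i _ => integral_exp_of_map_eq_gaussianReal (hX i) (h i) t,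
    ← Complex.exp_sum]
  congr 1
  push_cast
  rw [Finset.sum_neg_distrib, Finset.sum_mul, Finset.sum_div]

lemma map_add_prod_gaussianReal {α β : Type*} [MeasurableSpace α] [MeasurableSpace β]
    {P : Measure α} {Q : Measure β} [IsProbabilityMeasure P] [IsProbabilityMeasure Q]
    {X : α → ℝ} {Y : β → ℝ} (hX : Measurable X) (hY : Measurable Y) {v w : NNReal}
    (h : P.map X = gaussianReal 0 v) (h' : Q.map Y = gaussianReal 0 w) :
    (P.prod Q).map (fun p => X p.1 + Y p.2) = gaussianReal 0 (v + w) := by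
  refine map_eq_gaussianReal_of_integral (by fun_prop) fun t => ?_
  have h1 : ∀ p : α × β, Complex.exp (t * ((X p.1 + Y p.2 : ℝ) : ℂ) * Complex.I) =
      Complex.exp (t * X p.1 * Complex.I) * Complex.exp (t * Y p.2 * Complex.I) := fun a => by
    rw [← Complex.exp_add]
    push_cast
    ring_nf
  simp_rw [h1]
  rw [integral_prod_mul (f := fun b => Complex.exp (t * X b * Complex.I))
    (g := fun b => Complex.exp (t * Y b * Complex.I)),
    integral_exp_of_map_eq_gaussianReal hX h t, integral_exp_of_map_eq_gaussianReal hY h' t,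
    ← Complex.exp_add]
  congr 1
  push_cast
  ring

lemma map_re_mul_complexGaussian {v : ℝ} (hv : 0 ≤ v) (b : ℂ) :
    (complexGaussian v).map (fun z => (b * z).re) = gaussianReal 0 (v * ‖b‖ ^ 2 / 2).toNNReal := by
  have h1 : ∀ c : ℝ, (gaussianReal 0 (v / 2).toNNReal).map (fun x => c * x) =
      gaussianReal 0 (v * c ^ 2 / 2).toNNReal := fun c => by
    have h := gaussianReal_map_const_mul (μ := 0) (v := (v / 2).toNNReal) c
    rw [mul_zero] at h
    refine h.trans ?_
    congr 1
    ext
    rw [NNReal.coe_mul, Real.coe_toNNReal _ (by positivity), Real.coe_toNNReal _ (by positivity)]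
    simp
    ring
  -- `Re (b z) = b.re x - b.im y` with `x` and `y` independent.
  have h2 := map_add_prod_gaussianReal (by fun_prop) (by fun_prop) (h1 b.re) (h1 (-b.im))
  have hm : Measurable fun p : ℝ × ℝ => (⟨p.1, p.2⟩ : ℂ) :=
    Complex.measurableEquivRealProd.symm.measurable
  rw [complexGaussian, Measure.map_map (by fun_prop) hm]
  convert h2 using 1
  · congr 1
    funext p
    simp
    ring
  · congr 1
    ext
    rw [NNReal.coe_add, Real.coe_toNNReal _ (by positivity), Real.coe_toNNReal _ (by positivity),
      Real.coe_toNNReal _ (by positivity), Complex.sq_norm, Complex.normSq_apply]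
    ring

lemma map_re_dotProduct_pi_complexGaussian {ι : Type*} [Fintype ι] {v : ι → ℝ} (hv : ∀ i, 0 ≤ v i)
    (b : ι → ℂ) :
    (Measure.pi fun i => complexGaussian (v i)).map (fun z => (b ⬝ᵥ z).re) =
      gaussianReal 0 (∑ i, v i * ‖b i‖ ^ 2 / 2).toNNReal := by
  have h := map_sum_pi_gaussianReal (P := fun i => complexGaussian (v i))
    (X := fun i z => (b i * z).re) (fun i => by fun_prop)
    (fun i => map_re_mul_complexGaussian (hv i) (b i))
  convert h using 1
  · simp [dotProduct]
  · rw [Real.toNNReal_sum_of_nonneg fun i _ => by have := hv i; positivity]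

lemma lintegral_sq_gaussianReal (w : NNReal) :
    ∫⁻ x, ENNReal.ofReal (x ^ 2) ∂gaussianReal 0 w = w := by
  have h1 : ∫ x, x ^ 2 ∂gaussianReal 0 w = w := by
    have h := variance_id_gaussianReal (μ := 0) (v := w)
    rw [variance_of_integral_eq_zero aemeasurable_id (by simp)] at h
    simpa using h
  have h2 : Integrable (fun x : ℝ => x ^ 2) (gaussianReal 0 w) :=
    (memLp_id_gaussianReal 2).integrable_sq
  rw [← ofReal_integral_eq_lintegral_ofReal h2 (Filter.Eventually.of_forall fun x => sq_nonneg x),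
    h1]
  simp

/-- The second moment of a complex variable whose real functionals are Gaussian. -/
lemma lintegral_norm_sq_of_map {α : Type*} [MeasurableSpace α] {P : Measure α} {Z : α → ℂ}
    (hZ : Measurable Z) {w : NNReal}
    (h : ∀ c : ℂ, ‖c‖ = 1 → P.map (fun a => (c * Z a).re) = gaussianReal 0 w) :
    ∫⁻ a, ENNReal.ofReal (‖Z a‖ ^ 2) ∂P = 2 * w := by
  have h1 : ∀ c : ℂ, ‖c‖ = 1 → ∫⁻ a, ENNReal.ofReal ((c * Z a).re ^ 2) ∂P = w := fun c hc => by
    rw [← lintegral_sq_gaussianReal w, ← h c hc, lintegral_map (by fun_prop) (by fun_prop)]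
  -- The choices `c = 1` and `c = I` pick out the real part and, up to sign, the imaginary part.
  have h2 : ∀ a, ENNReal.ofReal (‖Z a‖ ^ 2) = ENNReal.ofReal ((1 * Z a).re ^ 2) +
      ENNReal.ofReal ((Complex.I * Z a).re ^ 2) := fun a => by
    rw [← ENNReal.ofReal_add (sq_nonneg _) (sq_nonneg _), Complex.sq_norm, Complex.normSq_apply]
    simp
    ring_nf
  simp_rw [h2]
  rw [lintegral_add_left (by fun_prop), h1 _ (by simp), h1 _ (by simp), two_mul]

/-! #### Linear images of a standard complex Gaussian vector -/

/-- `CN(0, I)` on `ℂ^ι`. -/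
abbrev stdComplexGaussian (ι : Type*) [Fintype ι] : Measure (ι → ℂ) :=
  Measure.pi fun _ => complexGaussian 1

lemma stdComplexGaussian_eq_withDensity (ι : Type*) [Fintype ι] :
    stdComplexGaussian ι = (volume : Measure (ι → ℂ)).withDensity fun z =>
      ENNReal.ofReal (Real.exp (∑ i, (-Real.log (Real.pi * 1) - ‖z i‖ ^ 2 / 1))) := by
  have key : ∀ (μ : Measure ℂ) [SigmaFinite μ], (complexGaussian 1 = μ.withDensity fun z =>
      ENNReal.ofReal (Real.exp (-Real.log (Real.pi * 1) - ‖z‖ ^ 2 / 1))) →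
      stdComplexGaussian ι = (Measure.pi fun _ => μ).withDensity fun z =>
        ENNReal.ofReal (Real.exp (∑ i, (-Real.log (Real.pi * 1) - ‖z i‖ ^ 2 / 1))) :=
    fun μ _ hμ => by
      have : IsFiniteMeasure (μ.withDensity fun z =>
          ENNReal.ofReal (Real.exp (-Real.log (Real.pi * 1) - ‖z‖ ^ 2 / 1))) := by
        rw [← hμ]; infer_instance
      rw [stdComplexGaussian, hμ, ← pi_withDensity_exp (fun _ : ι => μ)
        (fun _ z => -Real.log (Real.pi * 1) - ‖z‖ ^ 2 / 1) (fun _ => by fun_prop)]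
  exact key _ (complexGaussian_eq_withDensity one_pos)

/-- Linear change of variables. The density is taken relative to the Gaussian itself, hence the
added `‖z‖²`. -/
lemma map_mulVec_stdComplexGaussian {ι : Type*} [Fintype ι] [DecidableEq ι] (A : Matrix ι ι ℂ)
    (hA : A.det ≠ 0) :
    (stdComplexGaussian ι).map (fun z => A *ᵥ z) = (stdComplexGaussian ι).withDensity fun z =>
      ENNReal.ofReal (Real.exp (-Real.log (‖A.det‖ ^ 2) - ∑ i, ‖(A⁻¹ *ᵥ z) i‖ ^ 2
        + ∑ i, ‖z i‖ ^ 2)) := by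
  have hu : IsUnit A.det := isUnit_iff_ne_zero.2 hA
  let e : (ι → ℂ) ≃ᵐ (ι → ℂ) :=
    { toFun := fun z => A *ᵥ z
      invFun := fun z => A⁻¹ *ᵥ z
      left_inv := fun z => by simp [Matrix.mulVec_mulVec, Matrix.nonsing_inv_mul _ hu]
      right_inv := fun z => by simp [Matrix.mulVec_mulVec, Matrix.mul_nonsing_inv _ hu]
      measurable_toFun := (Continuous.matrix_mulVec continuous_const continuous_id).measurable
      measurable_invFun := (Continuous.matrix_mulVec continuous_const continuous_id).measurable }
  -- The real determinant of a complex-linear map is the squared modulus of its complex determinant.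
  have hdet : ((Matrix.toLin' A).restrictScalars ℝ).det = ‖A.det‖ ^ 2 := by
    rw [LinearMap.det_restrictScalars, LinearMap.det_toLin', Algebra.norm_complex_apply,
      Complex.sq_norm]
  have hpos : 0 < ‖A.det‖ ^ 2 := by positivity
  have hvol : (volume : Measure (ι → ℂ)).map e = ENNReal.ofReal (‖A.det‖ ^ 2)⁻¹ • volume := by
    have h := Measure.map_linearMap_addHaar_eq_smul_addHaar (volume : Measure (ι → ℂ))
      (f := (Matrix.toLin' A).restrictScalars ℝ) (by rw [hdet]; exact hpos.ne')
    rw [hdet, abs_of_pos (inv_pos.2 hpos)] at h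
    exact h
  have hm : Measurable fun z : ι → ℂ => A⁻¹ *ᵥ z := e.symm.measurable
  have hm' : ∀ i, Measurable fun z : ι → ℂ => (A⁻¹ *ᵥ z) i := fun i => by fun_prop
  change (stdComplexGaussian ι).map e = _
  rw [stdComplexGaussian_eq_withDensity, map_withDensity_measurableEquiv _ _ (by fun_prop), hvol,
    withDensity_smul_measure, ← withDensity_smul _ (by fun_prop),
    ← withDensity_mul _ (by fun_prop) (by fun_prop)]
  congr 1
  funext z
  simp only [Pi.smul_apply, Function.comp, Pi.mul_apply, smul_eq_mul]
  rw [← ENNReal.ofReal_mul (by positivity), ← ENNReal.ofReal_mul (by positivity), ← Real.exp_add,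
    ← Real.exp_log (inv_pos.2 hpos), ← Real.exp_add, Real.log_inv]
  congr 2
  simp only [Finset.sum_sub_distrib, div_one]
  change _ + (_ - ∑ i, ‖(A⁻¹ *ᵥ z) i‖ ^ 2) = _
  ring

/-- The Cramér-Wold device on `ℂ^ι`. -/
lemma ext_of_map_re_dotProduct {ι : Type*} [Fintype ι] {P Q : Measure (ι → ℂ)}
    [IsFiniteMeasure P] [IsFiniteMeasure Q]
    (h : ∀ b : ι → ℂ, P.map (fun z => (b ⬝ᵥ z).re) = Q.map (fun z => (b ⬝ᵥ z).re)) : P = Q := by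
  classical
  refine Measure.ext_of_charFunDual (funext fun L => ?_)
  -- `L` is only real-linear, so its values on both `e_i` and `I e_i` are needed; the sign comes
  -- from `Re (b z) = b.re z.re - b.im z.im`.
  let b : ι → ℂ := fun i => ⟨L (Pi.single i 1), -L (Pi.single i Complex.I)⟩
  have hL : ∀ z, L z = (b ⬝ᵥ z).re := fun z => by
    have hz : z = ∑ i, ((z i).re • (Pi.single i (1 : ℂ) : ι → ℂ) +
        (z i).im • (Pi.single i Complex.I : ι → ℂ)) := by
      funext j
      simp [Finset.sum_apply, Pi.single_apply, Finset.sum_add_distrib]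
    conv_lhs => rw [hz]
    simp only [map_sum, map_add, map_smul, smul_eq_mul, dotProduct, Complex.re_sum, b,
      Complex.mul_re]
    exact Finset.sum_congr rfl fun i _ => by ring
  have hb : Measurable fun z : ι → ℂ => (b ⬝ᵥ z).re := by unfold dotProduct; fun_prop
  have key : ∀ S : Measure (ι → ℂ), charFunDual S L =
      ∫ x, Complex.exp (x * Complex.I) ∂(S.map fun z => (b ⬝ᵥ z).re) := fun S => by
    rw [charFunDual_apply, integral_map hb.aemeasurable (by fun_prop)]
    simp_rw [hL]
  rw [key, key, h]

end Gaussian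

/-! ### The channel matrices -/

section Matrices

instance matrixBorelSpace (m n : ℕ) : BorelSpace (Matrix (Fin m) (Fin n) ℂ) :=
  inferInstanceAs (BorelSpace (Fin m → Fin n → ℂ))

instance matrixSecondCountableTopology (m n : ℕ) :
    SecondCountableTopology (Matrix (Fin m) (Fin n) ℂ) :=
  inferInstanceAs (SecondCountableTopology (Fin m → Fin n → ℂ))

variable {M N : ℕ} {σ : ℝ}

open ComplexOrder

lemma posDef_gram_add (hσ : 0 < σ) (H : Matrix (Fin N) (Fin M) ℂ) :
    (H * Hᴴ + ((σ ^ 2 : ℝ) : ℂ) • (1 : Matrix (Fin N) (Fin N) ℂ)).PosDef := by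
  refine Matrix.PosDef.posSemidef_add (Matrix.posSemidef_self_mul_conjTranspose H) ?_
  refine Matrix.PosDef.one.smul ?_
  exact_mod_cast (by positivity : (0 : ℝ) < σ ^ 2)

lemma conjTranspose_mmseF (σ : ℝ) (H : Matrix (Fin N) (Fin M) ℂ) :
    (mmseF σ H)ᴴ = Hᴴ * (H * Hᴴ + ((σ ^ 2 : ℝ) : ℂ) • (1 : Matrix (Fin N) (Fin N) ℂ))⁻¹ := by
  rw [mmseF, conjTranspose_mul, conjTranspose_nonsing_inv]
  congr 2
  simp [conjTranspose_add, conjTranspose_mul, conjTranspose_smul]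

/-- The covariance of the MMSE estimate given the channel equals `Fᴴ H`. -/
lemma mmse_covariance (hσ : 0 < σ) (H : Matrix (Fin N) (Fin M) ℂ) :
    (mmseF σ H)ᴴ * H * Hᴴ * mmseF σ H + ((σ ^ 2 : ℝ) : ℂ) • ((mmseF σ H)ᴴ * mmseF σ H) =
      (mmseF σ H)ᴴ * H := by
  have hu := (Matrix.isUnit_iff_isUnit_det _).1 (posDef_gram_add hσ H).isUnit
  -- Replacing the last `H` of `Fᴴ H` by `(H Hᴴ + σ² I) F` produces the two terms.
  have h : (H * Hᴴ + ((σ ^ 2 : ℝ) : ℂ) • (1 : Matrix (Fin N) (Fin N) ℂ)) * mmseF σ H = H := by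
    rw [mmseF, ← Matrix.mul_assoc, Matrix.mul_nonsing_inv _ hu, Matrix.one_mul]
  conv_rhs => enter [2]; rw [← h]
  simp only [Matrix.add_mul, Matrix.mul_add, Matrix.mul_assoc, Matrix.smul_mul, Matrix.mul_smul,
    Matrix.one_mul]

lemma mmse_covariance_signal (σ : ℝ) (H : Matrix (Fin N) (Fin M) ℂ) :
    (mmseF σ H)ᴴ * H * Hᴴ * mmseF σ H = ((mmseF σ H)ᴴ * H) * ((mmseF σ H)ᴴ * H)ᴴ := by
  rw [conjTranspose_mul, conjTranspose_conjTranspose, ← Matrix.mul_assoc]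

lemma trace_mul_conjTranspose_re {m n : Type*} [Fintype m] [Fintype n] (A : Matrix m n ℂ) :
    (A * Aᴴ).trace = ((∑ i, ∑ j, ‖A i j‖ ^ 2 : ℝ) : ℂ) := by
  simp only [trace, diag_apply, mul_apply, conjTranspose_apply, Complex.ofReal_sum]
  refine Finset.sum_congr rfl fun i _ => Finset.sum_congr rfl fun j _ => ?_
  rw [Complex.star_def, Complex.mul_conj, Complex.sq_norm]

/-! #### Eigenvalues -/

/-- By cyclicity this is the trace of `(H Hᴴ + σ² I)⁻¹ H Hᴴ`, which is diagonal in an eigenbasis of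
`H Hᴴ`. -/
lemma trace_mmseF_mul_eq_sum (hσ : 0 < σ) (H : Matrix (Fin N) (Fin M) ℂ) :
    ((mmseF σ H)ᴴ * H).trace =
      ((∑ i, (isHermitian_mul_conjTranspose_self H).eigenvalues i /
        ((isHermitian_mul_conjTranspose_self H).eigenvalues i + σ ^ 2) : ℝ) : ℂ) := by
  set hG := isHermitian_mul_conjTranspose_self H
  have hnn : ∀ i, 0 ≤ hG.eigenvalues i := fun i =>
    Matrix.eigenvalues_self_mul_conjTranspose_nonneg H i
  have hpos : ∀ i, (0 : ℝ) < hG.eigenvalues i + σ ^ 2 := fun i => by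
    have := hnn i; positivity
  set U : Matrix (Fin N) (Fin N) ℂ := hG.eigenvectorUnitary.1
  have hUU : U * star U = 1 := Unitary.coe_mul_star_self hG.eigenvectorUnitary
  have hUU' : star U * U = 1 := Unitary.coe_star_mul_self hG.eigenvectorUnitary
  have hsp : H * Hᴴ = U * diagonal (fun i => (hG.eigenvalues i : ℂ)) * star U := by
    have h := hG.spectral_theorem
    rw [Unitary.conjStarAlgAut_apply] at h
    exact h
  have hS : H * Hᴴ + ((σ ^ 2 : ℝ) : ℂ) • (1 : Matrix (Fin N) (Fin N) ℂ) =
      U * diagonal (fun i => ((hG.eigenvalues i + σ ^ 2 : ℝ) : ℂ)) * star U := by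
    have h1 : diagonal (fun i => ((hG.eigenvalues i + σ ^ 2 : ℝ) : ℂ)) =
        diagonal (fun i => (hG.eigenvalues i : ℂ)) + ((σ ^ 2 : ℝ) : ℂ) • 1 := by
      ext i j
      by_cases hij : i = j
      · subst hij; simp
      · simp [hij]
    rw [h1, Matrix.mul_add, Matrix.add_mul, ← hsp, Matrix.mul_smul, Matrix.smul_mul, Matrix.mul_one,
      hUU]
  have hinv : (H * Hᴴ + ((σ ^ 2 : ℝ) : ℂ) • (1 : Matrix (Fin N) (Fin N) ℂ))⁻¹ =
      U * diagonal (fun i => ((hG.eigenvalues i + σ ^ 2 : ℝ) : ℂ)⁻¹) * star U := by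
    refine Matrix.inv_eq_left_inv ?_
    rw [hS, show ∀ A B : Matrix (Fin N) (Fin N) ℂ, U * A * star U * (U * B * star U) =
      U * (A * (star U * U) * B) * star U from fun A B => by simp only [Matrix.mul_assoc],
      hUU', Matrix.mul_one, diagonal_mul_diagonal]
    have h1 : (fun i => ((hG.eigenvalues i + σ ^ 2 : ℝ) : ℂ)⁻¹ *
        ((hG.eigenvalues i + σ ^ 2 : ℝ) : ℂ)) = fun _ => 1 := funext fun i =>
      inv_mul_cancel₀ (by exact_mod_cast (hpos i).ne')
    rw [h1, diagonal_one, Matrix.mul_one, hUU]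
  have hmul : (H * Hᴴ + ((σ ^ 2 : ℝ) : ℂ) • (1 : Matrix (Fin N) (Fin N) ℂ))⁻¹ * (H * Hᴴ) =
      U * diagonal (fun i => ((hG.eigenvalues i + σ ^ 2 : ℝ) : ℂ)⁻¹) * star U *
        (U * diagonal (fun i => (hG.eigenvalues i : ℂ)) * star U) :=
    congrArg₂ (· * ·) hinv hsp
  rw [conjTranspose_mmseF, Matrix.mul_assoc, Matrix.trace_mul_comm, Matrix.mul_assoc, hmul,
    show ∀ A B : Matrix (Fin N) (Fin N) ℂ, U * A * star U * (U * B * star U) =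
      U * (A * (star U * U) * B) * star U from fun A B => by simp only [Matrix.mul_assoc],
    hUU', Matrix.mul_one, diagonal_mul_diagonal, Matrix.trace_mul_comm, ← Matrix.mul_assoc, hUU',
    Matrix.one_mul, trace_diagonal, Complex.ofReal_sum]
  refine Finset.sum_congr rfl fun i _ => ?_
  push_cast
  rw [div_eq_inv_mul]

lemma eigenvalues₀_nonneg (H : Matrix (Fin N) (Fin M) ℂ) (j : Fin (Fintype.card (Fin N))) :
    0 ≤ (isHermitian_mul_conjTranspose_self H).eigenvalues₀ j := by
  have h := Matrix.eigenvalues_self_mul_conjTranspose_nonneg H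
    (Fintype.equivOfCardEq (Fintype.card_fin _) j)
  simpa [Matrix.IsHermitian.eigenvalues] using h

/-- `eigenvalues₀` is sorted decreasingly: a nonzero value at `j` would give `j + 1` nonzero
eigenvalues, more than the rank of `H Hᴴ`. -/
lemma eigenvalues₀_eq_zero (H : Matrix (Fin N) (Fin M) ℂ) (j : Fin (Fintype.card (Fin N)))
    (hj : min N M ≤ j) : (isHermitian_mul_conjTranspose_self H).eigenvalues₀ j = 0 := by
  set hG := isHermitian_mul_conjTranspose_self H
  by_contra hne
  have hpos : 0 < hG.eigenvalues₀ j := lt_of_le_of_ne (eigenvalues₀_nonneg H j) (Ne.symm hne)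
  have hrank : (H * Hᴴ).rank ≤ min N M :=
    (Matrix.rank_mul_le_left _ _).trans (le_min (by simpa using H.rank_le_card_height)
      (by simpa using H.rank_le_card_width))
  rw [hG.rank_eq_card_non_zero_eigs] at hrank
  let e : Fin (Fintype.card (Fin N)) ≃ Fin N := Fintype.equivOfCardEq (Fintype.card_fin _)
  have hinj : Fintype.card (Fin (j + 1)) ≤ Fintype.card {i // hG.eigenvalues i ≠ 0} := by
    refine Fintype.card_le_of_injective
      (fun i : Fin (j + 1) => ⟨e ⟨i, by omega⟩, ?_⟩) fun a b hab => ?_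
    · have h1 : hG.eigenvalues (e ⟨i, by omega⟩) = hG.eigenvalues₀ ⟨i, by omega⟩ := by
        simp [Matrix.IsHermitian.eigenvalues, e]
      rw [h1]
      refine (hpos.trans_le (hG.eigenvalues₀_antitone ?_)).ne'
      rw [Fin.le_def]
      exact Nat.lt_succ_iff.1 i.2
    · simp only [Subtype.mk.injEq, EmbeddingLike.apply_eq_iff_eq, Fin.mk.injEq] at hab
      exact Fin.ext hab
  rw [Fintype.card_fin] at hinj
  omega

lemma sum_eigenvalues_eq (f : ℝ → ℝ) (hf : f 0 = 0) (H : Matrix (Fin N) (Fin M) ℂ) :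
    ∑ i, f ((isHermitian_mul_conjTranspose_self H).eigenvalues i) =
      ∑ j : Fin (min N M), f ((isHermitian_mul_conjTranspose_self H).eigenvalues₀
        (Fin.castLE (by simp) j)) := by
  set hG := isHermitian_mul_conjTranspose_self H
  let e : Fin (Fintype.card (Fin N)) ≃ Fin N := Fintype.equivOfCardEq (Fintype.card_fin _)
  have h1 : ∑ i, f (hG.eigenvalues i) = ∑ j, f (hG.eigenvalues₀ j) := by
    rw [← e.sum_comp]
    simp [Matrix.IsHermitian.eigenvalues, e]
  rw [h1]
  symm
  refine Finset.sum_of_injOn (Fin.castLE (by simp)) ?_ ?_ ?_ ?_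
  · exact (Fin.castLE_injective _).injOn
  · simp
  · intro j _ hj
    rw [eigenvalues₀_eq_zero H j, hf]
    by_contra hlt
    push Not at hlt
    exact hj ⟨⟨j, hlt⟩, by simp, by ext; simp⟩
  · simp

lemma trace_mmseF_mul (hσ : 0 < σ) (H : Matrix (Fin N) (Fin M) ℂ) :
    ((mmseF σ H)ᴴ * H).trace = (((min N M : ℕ) * eigenAverage σ H : ℝ) : ℂ) := by
  rw [trace_mmseF_mul_eq_sum hσ, sum_eigenvalues_eq (fun l => l / (l + σ ^ 2)) (by simp)]
  congr 1
  rw [eigenAverage]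
  -- If there is no eigenvalue to average, `eigenAverage` is `0 / 0 = 0`, and both sides vanish.
  by_cases h0 : min N M = 0
  · have : IsEmpty (Fin (min N M)) := by rw [h0]; infer_instance
    rw [Finset.univ_eq_empty, Finset.sum_empty]
    simp
  · rw [mul_div_cancel₀]
    exact_mod_cast h0

lemma eigenAverage_nonneg (σ : ℝ) (H : Matrix (Fin N) (Fin M) ℂ) : 0 ≤ eigenAverage σ H := by
  refine div_nonneg (Finset.sum_nonneg fun j _ => ?_) (Nat.cast_nonneg _)
  have := eigenvalues₀_nonneg H (Fin.castLE (by simp) j)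
  positivity

lemma eigenAverage_le_one (σ : ℝ) (H : Matrix (Fin N) (Fin M) ℂ) : eigenAverage σ H ≤ 1 := by
  refine div_le_one_of_le₀ ?_ (Nat.cast_nonneg _)
  refine (Finset.sum_le_card_nsmul _ _ 1 fun j _ => ?_).trans (by simp)
  have := eigenvalues₀_nonneg H (Fin.castLE (by simp) j)
  exact div_le_one_of_le₀ (by nlinarith [sq_nonneg σ]) (by positivity)

/-- Every summand is nonnegative, so every eigenvalue vanishes and so does the trace of `H Hᴴ`. This
is what makes `a` strictly positive. -/
lemma eq_zero_of_eigenAverage_eq_zero (hσ : 0 < σ) (H : Matrix (Fin N) (Fin M) ℂ)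
    (h : eigenAverage σ H = 0) : H = 0 := by
  have h1 := trace_mmseF_mul hσ H
  rw [h, mul_zero, trace_mmseF_mul_eq_sum hσ, Complex.ofReal_inj] at h1
  have hnn := Matrix.eigenvalues_self_mul_conjTranspose_nonneg H
  rw [Finset.sum_eq_zero_iff_of_nonneg fun i _ => by have := hnn i; positivity] at h1
  rw [← Matrix.trace_mul_conjTranspose_self_eq_zero_iff,
    (isHermitian_mul_conjTranspose_self H).trace_eq_sum_eigenvalues]
  refine Finset.sum_eq_zero fun i hi => ?_
  have h2 := h1 i hi
  have := hnn i
  rw [div_eq_zero_iff] at h2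
  rcases h2 with h2 | h2
  · simp [h2]
  · have : 0 < σ ^ 2 := by positivity
    linarith

/-! #### Bounds -/

/-- The trace of `mmse_covariance`. Since the right side is at most `M`, the entries of `Fᴴ H` are
bounded uniformly in `H`, and integrability requires no estimate on Rayleigh matrices. -/
lemma sum_norm_sq_mmse (hσ : 0 < σ) (H : Matrix (Fin N) (Fin M) ℂ) :
    ∑ a, ∑ b, ‖((mmseF σ H)ᴴ * H) a b‖ ^ 2 + σ ^ 2 * ∑ a, ∑ b, ‖(mmseF σ H)ᴴ a b‖ ^ 2 =
      (min N M : ℕ) * eigenAverage σ H := by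
  have h := congrArg Matrix.trace (mmse_covariance hσ H)
  rw [trace_mmseF_mul hσ, mmse_covariance_signal, Matrix.trace_add, Matrix.trace_smul,
    trace_mul_conjTranspose_re] at h
  have h2 := trace_mul_conjTranspose_re (mmseF σ H)ᴴ
  rw [conjTranspose_conjTranspose] at h2
  rw [h2, smul_eq_mul] at h
  exact_mod_cast h

lemma min_mul_eigenAverage_le (σ : ℝ) (H : Matrix (Fin N) (Fin M) ℂ) :
    (min N M : ℕ) * eigenAverage σ H ≤ M := by
  have h1 : ((min N M : ℕ) : ℝ) ≤ M := by exact_mod_cast min_le_right N M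
  have h2 := mul_le_mul h1 (eigenAverage_le_one σ H) (eigenAverage_nonneg σ H) (Nat.cast_nonneg M)
  rwa [mul_one] at h2

lemma norm_sq_le_sum {m n : Type*} [Fintype m] [Fintype n] (A : Matrix m n ℂ) (a : m) (b : n) :
    ‖A a b‖ ^ 2 ≤ ∑ a, ∑ b, ‖A a b‖ ^ 2 :=
  (Finset.single_le_sum (f := fun b => ‖A a b‖ ^ 2) (fun _ _ => sq_nonneg _)
    (Finset.mem_univ b)).trans (Finset.single_le_sum (f := fun a => ∑ b, ‖A a b‖ ^ 2)
      (fun _ _ => Finset.sum_nonneg fun _ _ => sq_nonneg _) (Finset.mem_univ a))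

lemma norm_mmseF_mul_apply_le (hσ : 0 < σ) (H : Matrix (Fin N) (Fin M) ℂ) (a b : Fin M) :
    ‖((mmseF σ H)ᴴ * H) a b‖ ^ 2 ≤ M := by
  have h := sum_norm_sq_mmse hσ H
  have h1 : 0 ≤ σ ^ 2 * ∑ a, ∑ b, ‖(mmseF σ H)ᴴ a b‖ ^ 2 := by positivity
  linarith [norm_sq_le_sum ((mmseF σ H)ᴴ * H) a b, min_mul_eigenAverage_le σ H]

/-! #### Continuity -/

lemma continuous_mmseF (hσ : 0 < σ) : Continuous (mmseF (N := N) (M := M) σ) := by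
  unfold mmseF
  simp only [Matrix.inv_def, Ring.inverse_eq_inv']
  have h1 : Continuous fun H : Matrix (Fin N) (Fin M) ℂ =>
      H * Hᴴ + ((σ ^ 2 : ℝ) : ℂ) • (1 : Matrix (Fin N) (Fin N) ℂ) := by fun_prop
  have h2 := h1.matrix_det.inv₀ fun H => (posDef_gram_add hσ H).det_pos.ne'
  have h3 := h2.smul h1.matrix_adjugate
  exact Continuous.matrix_mul h3 continuous_id

/-- The trace formula makes the average a continuous function of `H`, avoiding measurability of
sorted eigenvalues. -/
lemma measurable_eigenAverage (hσ : 0 < σ) (hM : 0 < M) (hN : 0 < N) :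
    Measurable (eigenAverage (M := M) (N := N) σ) := by
  have hT : ((min N M : ℕ) : ℝ) ≠ 0 := by
    have : 0 < min N M := lt_min hN hM
    exact_mod_cast this.ne'
  have h : (eigenAverage (M := M) (N := N) σ) =
      fun H => (((mmseF σ H)ᴴ * H).trace).re / (min N M : ℕ) := funext fun H => by
    rw [trace_mmseF_mul hσ, Complex.ofReal_re, mul_div_cancel_left₀ _ hT]
  rw [h]
  have := continuous_mmseF (N := N) (M := M) hσ
  exact Continuous.measurable (by fun_prop)

lemma integrable_eigenAverage (hσ : 0 < σ) (hM : 0 < M) (hN : 0 < N) :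
    Integrable (eigenAverage (M := M) (N := N) σ) (rayleighLaw N M) :=
  Integrable.of_bound (measurable_eigenAverage hσ hM hN).aestronglyMeasurable 1
    (Filter.Eventually.of_forall fun H => by
      rw [Real.norm_eq_abs, abs_of_nonneg (eigenAverage_nonneg σ H)]
      exact eigenAverage_le_one σ H)

end Matrices

/-! ### The covariance of the relay outputs -/

section Covariance

open ComplexOrder

variable {M : ℕ} {N : Fin 2 → ℕ} {σ : ℝ}

lemma covBlock_posSemidef {D : Fin 2 → ℝ} (hD : ∀ k, 0 ≤ D k)
    (H : (k : Fin 2) → Matrix (Fin (N k)) (Fin M) ℂ) : (covBlock σ D H).PosSemidef := by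
  -- The covariance splits into the contributions of the common input, the receiver noises and the
  -- quantization noises. The zero block column keeps the first factor square.
  have h : covBlock σ D H =
      fromBlocks ((mmseF σ (H 0))ᴴ * H 0) 0 ((mmseF σ (H 1))ᴴ * H 1) 0 *
        (fromBlocks ((mmseF σ (H 0))ᴴ * H 0) 0 ((mmseF σ (H 1))ᴴ * H 1) 0 :
          Matrix (Fin M ⊕ Fin M) (Fin M ⊕ Fin M) ℂ)ᴴ +
      ((σ ^ 2 : ℝ) : ℂ) • (fromBlocks (mmseF σ (H 0))ᴴ 0 0 (mmseF σ (H 1))ᴴ *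
        (fromBlocks (mmseF σ (H 0))ᴴ 0 0 (mmseF σ (H 1))ᴴ)ᴴ) +
      fromBlocks ((D 0 : ℂ) • 1) 0 0 ((D 1 : ℂ) • 1) := by
    simp [covBlock, covDiag, covCross, fromBlocks_conjTranspose, fromBlocks_multiply,
      fromBlocks_add, fromBlocks_smul, conjTranspose_mul, Matrix.mul_assoc]
  have hdiag : (fromBlocks ((D 0 : ℂ) • 1) 0 0 ((D 1 : ℂ) • 1) :
      Matrix (Fin M ⊕ Fin M) (Fin M ⊕ Fin M) ℂ) =
      diagonal (Sum.elim (fun _ => (D 0 : ℂ)) fun _ => (D 1 : ℂ)) := by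
    rw [← fromBlocks_diagonal, smul_one_eq_diagonal, smul_one_eq_diagonal]
  rw [h, hdiag]
  refine Matrix.PosSemidef.add (Matrix.PosSemidef.add
    (Matrix.posSemidef_self_mul_conjTranspose _)
    ((Matrix.posSemidef_self_mul_conjTranspose _).smul ?_)) (Matrix.PosSemidef.diagonal ?_)
  · exact_mod_cast sq_nonneg σ
  · intro i
    rcases i with i | i
    · simpa using hD 0
    · simpa using hD 1

/-- Subtracting `d I` only lowers the noise levels to `D k - d`, so the result is again a
covariance. -/
lemma covBlock_sub_posSemidef {D : Fin 2 → ℝ} {d : ℝ} (hd : ∀ k, d ≤ D k)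
    (H : (k : Fin 2) → Matrix (Fin (N k)) (Fin M) ℂ) :
    (covBlock σ D H - (d : ℂ) • 1).PosSemidef := by
  have h : covBlock σ D H - (d : ℂ) • 1 = covBlock σ (fun k => D k - d) H := by
    rw [sub_eq_iff_eq_add, ← fromBlocks_one, fromBlocks_smul, covBlock, covBlock, fromBlocks_add]
    congr 1
    · simp [covDiag, sub_smul, add_assoc]
    · simp
    · simp
    · simp [covDiag, sub_smul, add_assoc]
  rw [h]
  exact covBlock_posSemidef (fun k => sub_nonneg.2 (hd k)) H

lemma posDef_of_sub_smul_one {ι : Type*} [Fintype ι] [DecidableEq ι] {K : Matrix ι ι ℂ} {d : ℝ}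
    (hd : 0 < d) (h : (K - (d : ℂ) • 1).PosSemidef) : K.PosDef := by
  have h1 := Matrix.PosDef.posSemidef_add h
    (Matrix.PosDef.one.smul (by exact_mod_cast hd : (0 : ℂ) < d))
  rwa [sub_add_cancel] at h1

lemma det_eq_re_of_posDef {ι : Type*} [Fintype ι] [DecidableEq ι] {K : Matrix ι ι ℂ}
    (h : K.PosDef) : 0 < K.det.re ∧ K.det = (K.det.re : ℂ) := by
  have h1 := h.det_pos
  rw [Complex.lt_def] at h1
  exact ⟨h1.1, Complex.ext (by simp) (by simpa using h1.2.symm)⟩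

/-- All eigenvalues are at least `d`, which gives the lower bound; the upper one is `log t ≤ t - 1`
summed over the eigenvalues. -/
lemma log_det_bounds {ι : Type*} [Fintype ι] [DecidableEq ι] {K : Matrix ι ι ℂ} {d : ℝ}
    (hd : 0 < d) (h : (K - (d : ℂ) • 1).PosSemidef) :
    Fintype.card ι * Real.log d ≤ Real.log K.det.re ∧
      Real.log K.det.re ≤ K.trace.re - Fintype.card ι := by
  have hK := posDef_of_sub_smul_one hd h
  have hH := hK.isHermitian
  -- The quadratic form of `K - d I` at a unit eigenvector is the eigenvalue minus `d`.
  have hev : ∀ i, d ≤ hH.eigenvalues i := fun i => by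
    have h1 := h.re_dotProduct_nonneg (hH.eigenvectorBasis i).ofLp
    rw [Matrix.sub_mulVec, dotProduct_sub, Matrix.smul_mulVec, Matrix.one_mulVec, dotProduct_smul]
      at h1
    have h2 := hH.eigenvalues_eq i
    have h3 : star ((hH.eigenvectorBasis i).ofLp) ⬝ᵥ (hH.eigenvectorBasis i).ofLp = 1 := by
      have h4 := hH.eigenvectorBasis.orthonormal.1 i
      have h5 := inner_self_eq_norm_sq_to_K (𝕜 := ℂ) (hH.eigenvectorBasis i)
      rw [h4, EuclideanSpace.inner_eq_star_dotProduct, dotProduct_comm] at h5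
      simpa using h5
    rw [h3, map_sub, ← h2] at h1
    simpa using h1
  have hdet : K.det.re = ∏ i, hH.eigenvalues i := by
    rw [hH.det_eq_prod_eigenvalues]
    have : ∏ i, ((hH.eigenvalues i : ℝ) : ℂ) = ((∏ i, hH.eigenvalues i : ℝ) : ℂ) := by
      push_cast; rfl
    exact (congrArg Complex.re this).trans (Complex.ofReal_re _)
  have htr : K.trace.re = ∑ i, hH.eigenvalues i := by
    rw [hH.trace_eq_sum_eigenvalues, Complex.re_sum]
    rfl
  have hpos : ∀ i, 0 < hH.eigenvalues i := fun i => hd.trans_le (hev i)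
  rw [hdet, htr, Real.log_prod fun i _ => (hpos i).ne']
  constructor
  · rw [← nsmul_eq_mul, ← Finset.card_univ]
    exact Finset.card_nsmul_le_sum _ _ _ fun i _ => Real.log_le_log hd (hev i)
  · have : (Fintype.card ι : ℝ) = ∑ _i : ι, (1 : ℝ) := by simp
    rw [this, ← Finset.sum_sub_distrib]
    exact Finset.sum_le_sum fun i _ => Real.log_le_sub_one_of_pos (hpos i)

lemma trace_covBlock (hσ : 0 < σ) (D : Fin 2 → ℝ)
    (H : (k : Fin 2) → Matrix (Fin (N k)) (Fin M) ℂ) :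
    (covBlock σ D H).trace.re =
      ∑ k, ((min (N k) M : ℕ) * eigenAverage σ (H k) + D k * M) := by
  have htr : ∀ A B C E : Matrix (Fin M) (Fin M) ℂ,
      (fromBlocks A B C E).trace = A.trace + E.trace := fun A B C E => by
    simp [trace, Fintype.sum_sum_type]
  rw [covBlock, htr, covDiag, covDiag, mmse_covariance hσ, mmse_covariance hσ,
    Matrix.trace_add, Matrix.trace_add, trace_mmseF_mul hσ, trace_mmseF_mul hσ, Fin.sum_univ_two]
  simp [Matrix.trace_smul]

lemma continuous_covBlock (hσ : 0 < σ) (D : Fin 2 → ℝ) :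
    Continuous (covBlock (M := M) (N := N) σ D) := by
  have h : ∀ k, Continuous fun H : (k : Fin 2) → Matrix (Fin (N k)) (Fin M) ℂ => mmseF σ (H k) :=
    fun k => (continuous_mmseF hσ).comp (continuous_apply k)
  have h0 := h 0
  have h1 := h 1
  unfold covBlock covDiag covCross
  exact Continuous.matrix_fromBlocks (by fun_prop) (by fun_prop) (by fun_prop) (by fun_prop)

lemma exists_pos_le (D : Fin 2 → ℝ) (hD : ∀ k, 0 < D k) : ∃ d, 0 < d ∧ ∀ k, d ≤ D k :=
  ⟨min (D 0) (D 1), lt_min (hD 0) (hD 1), fun k => by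
    fin_cases k
    · exact min_le_left _ _
    · exact min_le_right _ _⟩

lemma covBlock_posDef {D : Fin 2 → ℝ} (hD : ∀ k, 0 < D k)
    (H : (k : Fin 2) → Matrix (Fin (N k)) (Fin M) ℂ) : (covBlock σ D H).PosDef := by
  obtain ⟨d, hd, hdD⟩ := exists_pos_le D hD
  exact posDef_of_sub_smul_one hd (covBlock_sub_posSemidef hdD H)

/-- The integrand is bounded: `K` dominates a fixed multiple of the identity, and its trace is at
most a constant independent of the channels. -/
lemma integrable_logDetCov (hσ : 0 < σ) {D : Fin 2 → ℝ} (hD : ∀ k, 0 < D k) :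
    Integrable (logDetCov (M := M) (N := N) σ D) (channelLaw M N) := by
  obtain ⟨d, hd, hdD⟩ := exists_pos_le D hD
  have hint : Integrable (fun H => Real.log ((covBlock (M := M) (N := N) σ D H).det.re))
      (channelLaw M N) := by
    refine Integrable.of_bound (C := |Fintype.card (Fin M ⊕ Fin M) * Real.log d| +
      |∑ k, ((M : ℝ) + D k * M) - Fintype.card (Fin M ⊕ Fin M)|)
      (Continuous.aestronglyMeasurable ((Complex.continuous_re.comp
        (continuous_covBlock hσ D).matrix_det).log
          fun H => (det_eq_re_of_posDef (covBlock_posDef hD H)).1.ne'))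
      (Filter.Eventually.of_forall fun H => ?_)
    obtain ⟨h1, h2⟩ := log_det_bounds hd (covBlock_sub_posSemidef (σ := σ) hdD H)
    have h3 : (covBlock σ D H).trace.re ≤ ∑ k, ((M : ℝ) + D k * M) := by
      rw [trace_covBlock hσ]
      exact Finset.sum_le_sum fun k _ => by linarith [min_mul_eigenAverage_le σ (H k)]
    have h4 := neg_abs_le (Fintype.card (Fin M ⊕ Fin M) * Real.log d)
    have h5 := le_abs_self (∑ k, ((M : ℝ) + D k * M) - Fintype.card (Fin M ⊕ Fin M))
    have h6 := abs_nonneg (Fintype.card (Fin M ⊕ Fin M) * Real.log d)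
    have h7 := abs_nonneg (∑ k, ((M : ℝ) + D k * M) - Fintype.card (Fin M ⊕ Fin M))
    rw [Real.norm_eq_abs, abs_le]
    constructor <;> linarith
  exact hint.div_const _

end Covariance

/-! ### Unitary invariance of the Rayleigh law -/

section Invariance

variable {M N : ℕ} {σ : ℝ}

/-- The law of `Re (b ⬝ᵥ z)` depends only on the norm of `b`, which `U` preserves. -/
lemma map_vecMul_stdComplexGaussian {ι : Type*} [Fintype ι] [DecidableEq ι] {U : Matrix ι ι ℂ}
    (hU : Uᴴ * U = 1) :
    (stdComplexGaussian ι).map (fun z => z ᵥ* U) = stdComplexGaussian ι := by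
  have hm : Measurable fun z : ι → ℂ => z ᵥ* U :=
    (Continuous.matrix_vecMul continuous_id continuous_const).measurable
  have := Measure.isProbabilityMeasure_map (μ := stdComplexGaussian ι) hm.aemeasurable
  refine ext_of_map_re_dotProduct fun b => ?_
  have hb : Measurable fun z : ι → ℂ => (b ⬝ᵥ z).re := by unfold dotProduct; fun_prop
  have h1 : ((fun z : ι → ℂ => (b ⬝ᵥ z).re) ∘ fun z => z ᵥ* U) =
      fun z => ((U *ᵥ b) ⬝ᵥ z).re := by
    funext z
    simp only [Function.comp]
    rw [dotProduct_comm, ← dotProduct_mulVec, dotProduct_comm]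
  rw [Measure.map_map hb hm, h1, map_re_dotProduct_pi_complexGaussian fun _ => zero_le_one,
    map_re_dotProduct_pi_complexGaussian fun _ => zero_le_one]
  have h2 : ∀ u : ι → ℂ, ((∑ i, ‖u i‖ ^ 2 : ℝ) : ℂ) = star u ⬝ᵥ u := fun u => by
    simp only [dotProduct, Complex.ofReal_sum]
    exact Finset.sum_congr rfl fun i _ => by
      rw [Pi.star_apply, Complex.star_def, mul_comm, Complex.mul_conj, Complex.sq_norm]
  have h3 : ∑ i, ‖(U *ᵥ b) i‖ ^ 2 = ∑ i, ‖b i‖ ^ 2 := by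
    rw [← Complex.ofReal_inj, h2, h2, star_mulVec, ← dotProduct_mulVec, mulVec_mulVec, hU,
      one_mulVec]
  simp only [one_mul, ← Finset.sum_div, h3]

lemma map_mul_rayleighLaw {U : Matrix (Fin M) (Fin M) ℂ} (hU : Uᴴ * U = 1) :
    (rayleighLaw N M).map (fun H => H * U) = rayleighLaw N M := by
  have hm : Measurable fun z : Fin M → ℂ => z ᵥ* U :=
    (Continuous.matrix_vecMul continuous_id continuous_const).measurable
  have h := map_vecMul_stdComplexGaussian hU
  have : IsProbabilityMeasure ((stdComplexGaussian (Fin M)).map fun z => z ᵥ* U) :=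
    Measure.isProbabilityMeasure_map hm.aemeasurable
  have h1 := Measure.pi_map_pi (μ := fun _ : Fin N => stdComplexGaussian (Fin M))
    (f := fun _ z => z ᵥ* U) (fun _ => hm.aemeasurable)
  rw [h] at h1
  exact h1

lemma mmseF_mul_unitary {U : Matrix (Fin M) (Fin M) ℂ} (hU : Uᴴ * U = 1)
    (H : Matrix (Fin N) (Fin M) ℂ) : mmseF σ (H * U) = mmseF σ H * U := by
  have hU' : U * Uᴴ = 1 := mul_eq_one_comm.1 hU
  rw [mmseF, mmseF, conjTranspose_mul, Matrix.mul_assoc H, ← Matrix.mul_assoc U, hU',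
    Matrix.one_mul, ← Matrix.mul_assoc]

lemma integrable_mmseF_mul_apply (hσ : 0 < σ) (a b : Fin M) :
    Integrable (fun H => ((mmseF σ H)ᴴ * H) a b) (rayleighLaw N M) := by
  have h := continuous_mmseF (N := N) (M := M) hσ
  refine Integrable.of_bound (C := Real.sqrt M)
    (Continuous.aestronglyMeasurable (by fun_prop)) (Filter.Eventually.of_forall fun H => ?_)
  exact Real.le_sqrt_of_sq_le (norm_mmseF_mul_apply_le hσ H a b)

lemma integrable_signal_apply (hσ : 0 < σ) (a b : Fin M) :
    Integrable (fun H => ((mmseF σ H)ᴴ * H * Hᴴ * mmseF σ H) a b) (rayleighLaw N M) := by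
  have h := continuous_mmseF (N := N) (M := M) hσ
  refine Integrable.of_bound (C := ∑ _c : Fin M, Real.sqrt M * Real.sqrt M)
    (Continuous.aestronglyMeasurable (by fun_prop)) (Filter.Eventually.of_forall fun H => ?_)
  rw [mmse_covariance_signal, mul_apply]
  refine (norm_sum_le _ _).trans (Finset.sum_le_sum fun c _ => ?_)
  rw [norm_mul, conjTranspose_apply, norm_star]
  exact mul_le_mul (Real.le_sqrt_of_sq_le (norm_mmseF_mul_apply_le hσ H _ _))
    (Real.le_sqrt_of_sq_le (norm_mmseF_mul_apply_le hσ H _ _)) (norm_nonneg _) (Real.sqrt_nonneg _)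

/-- Since `F(HU) = F(H) U`, the mean is fixed by unitary conjugation and is therefore scalar; its
trace identifies the scalar. Sign changes and transpositions are enough unitaries. -/
lemma meanMatrix_mmseF_mul (hσ : 0 < σ) :
    meanMatrix (N := N) (fun H => (mmseF σ H)ᴴ * H) =
      (((min N M : ℕ) / (M : ℝ) * eigenMean M N σ : ℝ) : ℂ) •
        (1 : Matrix (Fin M) (Fin M) ℂ) := by
  set E := meanMatrix (M := M) (N := N) (fun H => (mmseF σ H)ᴴ * H) with hE
  have hcont := continuous_mmseF (N := N) (M := M) hσ
  have hinv : ∀ U : Matrix (Fin M) (Fin M) ℂ, Uᴴ * U = 1 → ∀ a b,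
      E a b = ∫ H, (Uᴴ * ((mmseF σ H)ᴴ * H) * U) a b ∂(rayleighLaw N M) := fun U hU a b => by
    have hm : Measurable fun H : Matrix (Fin N) (Fin M) ℂ => H * U :=
      Continuous.measurable (by fun_prop)
    rw [hE, meanMatrix, of_apply]
    conv_lhs => rw [← map_mul_rayleighLaw hU]
    rw [integral_map hm.aemeasurable (Continuous.aestronglyMeasurable (by fun_prop))]
    refine integral_congr_ae (Filter.Eventually.of_forall fun H => ?_)
    simp only [mmseF_mul_unitary hU, conjTranspose_mul, Matrix.mul_assoc]
  have hoff : ∀ a b, a ≠ b → E a b = 0 := fun a b hab => by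
    -- Flipping the sign of coordinate `a` alone turns the entry `(a, b)` into its negative.
    let s : Fin M → ℂ := Function.update 1 a (-1)
    have hs : ∀ i, star (s i) * s i = 1 := fun i => by
      by_cases hi : i = a
      · subst hi; simp [s]
      · simp [s, hi]
    have hU : (diagonal s)ᴴ * diagonal s = 1 := by
      rw [diagonal_conjTranspose, diagonal_mul_diagonal, ← diagonal_one]
      congr 1
      exact funext hs
    have h := hinv _ hU a b
    simp only [diagonal_conjTranspose, Matrix.mul_diagonal, Matrix.diagonal_mul] at h
    have hsa : s a = -1 := by simp [s]
    have hsb : s b = 1 := by simp [s, hab.symm]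
    simp only [Pi.star_apply, hsa, hsb, star_neg, star_one, mul_one, neg_mul, one_mul,
      integral_neg] at h
    have h' : E a b = -E a b := h
    exact self_eq_neg.1 h'
  have hdiag : ∀ a b, E a a = E b b := fun a b => by
    -- Conjugation by the transposition of `a` and `b` exchanges the two diagonal entries.
    have hU : ((Equiv.swap a b).permMatrix ℂ)ᴴ * (Equiv.swap a b).permMatrix ℂ = 1 := by
      rw [Matrix.conjTranspose_permMatrix, ← Matrix.permMatrix_mul]
      simp
    rw [hinv _ hU a a]
    rw [hE, meanMatrix, of_apply]
    refine integral_congr_ae (Filter.Eventually.of_forall fun H => ?_)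
    simp only [Matrix.conjTranspose_permMatrix, Equiv.swap_inv]
    rw [Equiv.Perm.permMatrix, PEquiv.mul_toMatrix_toPEquiv, PEquiv.toMatrix_toPEquiv_mul]
    simp
  have htr : E.trace = (((min N M : ℕ) * eigenMean M N σ : ℝ) : ℂ) := by
    have h1 : E.trace = ∫ H, ((mmseF σ H)ᴴ * H).trace ∂(rayleighLaw N M) := by
      simp only [trace, diag_apply]
      rw [integral_finsetSum _ fun i _ => integrable_mmseF_mul_apply hσ i i]
      rfl
    rw [h1]
    simp_rw [trace_mmseF_mul hσ]
    exact integral_complex_ofReal.trans (congrArg _ (integral_const_mul _ _))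
  ext a b
  by_cases hab : a = b
  · subst hab
    have hM : (M : ℂ) ≠ 0 := by
      have : 0 < M := a.pos
      exact_mod_cast this.ne'
    have h2 : (M : ℂ) * E a a = (((min N M : ℕ) * eigenMean M N σ : ℝ) : ℂ) := by
      rw [← htr, trace]
      simp only [diag_apply, hdiag _ a]
      simp
    rw [Matrix.smul_apply, one_apply_eq, smul_eq_mul, mul_one]
    push_cast at h2 ⊢
    rw [div_mul_eq_mul_div, eq_div_iff hM, mul_comm, h2]
  · rw [hoff a b hab, Matrix.smul_apply, one_apply_ne hab, smul_zero]

/-- By `mmse_covariance`, the signal and receiver noise terms add up to `E[Fᴴ H]`, whose square is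
also the subtracted term. -/
lemma matG_eq (hσ : 0 < σ) (D : ℝ) :
    matG M N σ D = (((min N M : ℕ) / (M : ℝ) * eigenMean M N σ -
      ((min N M : ℕ) / (M : ℝ)) ^ 2 * eigenMean M N σ ^ 2 + D : ℝ) : ℂ) •
        (1 : Matrix (Fin M) (Fin M) ℂ) := by
  have h : meanMatrix (N := N) (fun H => (mmseF σ H)ᴴ * H * Hᴴ * mmseF σ H) +
      ((σ ^ 2 : ℝ) : ℂ) • meanMatrix (N := N) (fun H => (mmseF σ H)ᴴ * mmseF σ H) =
      meanMatrix (M := M) (N := N) (fun H => (mmseF σ H)ᴴ * H) := by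
    ext a b
    simp only [meanMatrix, Matrix.add_apply, Matrix.smul_apply, of_apply, smul_eq_mul]
    rw [← integral_const_mul]
    have h2 : ∀ H : Matrix (Fin N) (Fin M) ℂ, ((σ ^ 2 : ℝ) : ℂ) * ((mmseF σ H)ᴴ * mmseF σ H) a b =
        ((mmseF σ H)ᴴ * H) a b - ((mmseF σ H)ᴴ * H * Hᴴ * mmseF σ H) a b := fun H => by
      rw [eq_sub_iff_add_eq']
      exact congrFun (congrFun (mmse_covariance hσ H) a) b
    simp_rw [h2]
    rw [integral_sub (integrable_mmseF_mul_apply hσ a b) (integrable_signal_apply hσ a b)]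
    ring
  rw [matG, sub_add_eq_add_sub, h, meanMatrix_mmseF_mul hσ, sq, smul_mul_smul_comm, Matrix.one_mul,
    ← sub_smul, ← add_smul]
  congr 1
  push_cast
  ring

lemma eigenMean_nonneg (M N : ℕ) (σ : ℝ) : 0 ≤ eigenMean M N σ :=
  integral_nonneg fun H => eigenAverage_nonneg σ H

lemma eigenMean_le_one (hσ : 0 < σ) (hM : 0 < M) (hN : 0 < N) : eigenMean M N σ ≤ 1 := by
  have h := integral_mono (integrable_eigenAverage (M := M) hσ hM hN) (integrable_const (1 : ℝ))
    (fun H => eigenAverage_le_one σ H)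
  rw [integral_const, probReal_univ, one_smul] at h
  exact h

lemma lintegral_norm_sq_complexGaussian {v : ℝ} (hv : 0 ≤ v) :
    ∫⁻ z, ENNReal.ofReal (‖z‖ ^ 2) ∂complexGaussian v = ENNReal.ofReal v := by
  rw [lintegral_norm_sq_of_map (w := (v / 2).toNNReal) (Z := fun z => z) measurable_id fun c hc => by
    rw [map_re_mul_complexGaussian hv, hc, one_pow, mul_one]]
  rw [← ENNReal.ofReal, show (2 : ℝ≥0∞) = ENNReal.ofReal 2 by simp,
    ← ENNReal.ofReal_mul zero_le_two]
  congr 1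
  ring

/-- A zero mean would force `H = 0` almost surely, but an entry of `H` has second moment 1. -/
lemma eigenMean_pos (hσ : 0 < σ) (hM : 0 < M) (hN : 0 < N) : 0 < eigenMean M N σ := by
  refine lt_of_le_of_ne (eigenMean_nonneg M N σ) fun h => ?_
  have h1 := (integral_eq_zero_iff_of_nonneg (fun H => eigenAverage_nonneg σ H)
    (integrable_eigenAverage (M := M) hσ hM hN)).1 h.symm
  have h2 : ∀ᵐ H ∂(rayleighLaw N M), H = 0 := by
    filter_upwards [h1] with H hH using eq_zero_of_eigenAverage_eq_zero hσ H hH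
  have e1 : MeasurePreserving (Function.eval (⟨0, hN⟩ : Fin N)) (rayleighLaw N M)
      (stdComplexGaussian (Fin M)) :=
    measurePreserving_eval (fun _ : Fin N => stdComplexGaussian (Fin M)) ⟨0, hN⟩
  have e2 : MeasurePreserving (Function.eval (⟨0, hM⟩ : Fin M)) (stdComplexGaussian (Fin M))
      (complexGaussian 1) :=
    measurePreserving_eval (fun _ : Fin M => complexGaussian 1) ⟨0, hM⟩
  have h3 := (e2.comp e1).lintegral_comp (f := fun z : ℂ => ENNReal.ofReal (‖z‖ ^ 2))
    (by fun_prop)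
  rw [lintegral_norm_sq_complexGaussian zero_le_one] at h3
  have h4 : ∫⁻ H : Matrix (Fin N) (Fin M) ℂ, ENNReal.ofReal (‖H ⟨0, hN⟩ ⟨0, hM⟩‖ ^ 2)
      ∂(rayleighLaw N M) = 0 := by
    rw [← lintegral_zero (μ := rayleighLaw N M)]
    refine lintegral_congr_ae ?_
    filter_upwards [h2] with H hH
    simp [hH]
  have h5 := h4.symm.trans h3
  simp at h5

end Invariance

/-! ### Reordering threefold product measures -/

section Product

variable {α β γ : Type*} [MeasurableSpace α] [MeasurableSpace β] [MeasurableSpace γ]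

lemma measurePreserving_prod_left_comm (P : Measure α) (Q : Measure β) (S : Measure γ)
    [SFinite P] [SFinite Q] [SFinite S] :
    MeasurePreserving (fun t : α × β × γ => (t.2.1, (t.1, t.2.2))) (P.prod (Q.prod S))
      (Q.prod (P.prod S)) :=
  (measurePreserving_prodAssoc Q P S).comp
    (((Measure.measurePreserving_swap (μ := P) (ν := Q)).prod (MeasurePreserving.id S)).comp
      ((measurePreserving_prodAssoc P Q S).symm _))

/-- Used with the channel as the middle factor: at a fixed channel the inner integral is purely
Gaussian. -/
lemma lintegral_prod_left_comm (P : Measure α) (Q : Measure β) (S : Measure γ)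
    [SFinite P] [SFinite Q] [SFinite S] {f : α × β × γ → ℝ≥0∞} (hf : Measurable f) :
    ∫⁻ t, f t ∂(P.prod (Q.prod S)) = ∫⁻ b, ∫⁻ p, f (p.1, (b, p.2)) ∂(P.prod S) ∂Q := by
  have hg : Measurable fun t : β × α × γ => f (t.2.1, (t.1, t.2.2)) := by fun_prop
  rw [← lintegral_prod (fun t : β × α × γ => f (t.2.1, (t.1, t.2.2))) hg.aemeasurable,
    ← (measurePreserving_prod_left_comm P Q S).lintegral_comp hg]

end Product

/-! ### Second moments of the relay outputs -/

section Moments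

variable {M N : ℕ} {σ : ℝ}

/-- Second moments are computed as lower integrals, which presuppose no integrability; this converts
them. -/
lemma integrable_and_integral_eq_of_lintegral {α : Type*} [MeasurableSpace α] {P : Measure α}
    {f : α → ℝ} (hf : AEMeasurable f P) (h0 : ∀ a, 0 ≤ f a) {r : ℝ} (hr : 0 ≤ r)
    (h : ∫⁻ a, ENNReal.ofReal (f a) ∂P = ENNReal.ofReal r) :
    Integrable f P ∧ ∫ a, f a ∂P = r := by
  refine ⟨⟨hf.aestronglyMeasurable, ?_⟩, ?_⟩
  · rw [hasFiniteIntegral_iff_ofReal (Filter.Eventually.of_forall h0), h]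
    exact ENNReal.ofReal_lt_top
  · rw [integral_eq_lintegral_of_nonneg_ae (Filter.Eventually.of_forall h0)
      hf.aestronglyMeasurable, h, ENNReal.toReal_ofReal hr]

lemma integral_affine {α : Type*} [MeasurableSpace α] {P : Measure α} [IsProbabilityMeasure P]
    {f : α → ℝ} (hf : Integrable f P) (a b d : ℝ) :
    Integrable (fun x => a * f x + b + d) P ∧
      ∫ x, (a * f x + b + d) ∂P = a * ∫ x, f x ∂P + b + d := by
  refine ⟨((hf.const_mul a).add (integrable_const b)).add (integrable_const d), ?_⟩
  simp_rw [add_assoc]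
  rw [integral_add (hf.const_mul a) (integrable_const _), integral_const_mul]
  simp

/-- The estimate `Fᴴ (H x + n)` of a relay with quantization noise `q` added. -/
def relayOut (σ : ℝ) (H : Matrix (Fin N) (Fin M) ℂ) (x : Fin M → ℂ) (n : Fin N → ℂ)
    (q : Fin M → ℂ) : Fin M → ℂ :=
  (mmseF σ H)ᴴ *ᵥ (H *ᵥ x + n) + q

lemma continuous_relayOut (hσ : 0 < σ) : Continuous
    fun t : (Fin M → ℂ) × Matrix (Fin N) (Fin M) ℂ × (Fin N → ℂ) × (Fin M → ℂ) =>
      relayOut σ t.2.1 t.1 t.2.2.1 t.2.2.2 := by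
  have h := (continuous_mmseF (N := N) (M := M) hσ).comp
    (continuous_fst.comp (continuous_snd (X := Fin M → ℂ)
      (Y := Matrix (Fin N) (Fin M) ℂ × (Fin N → ℂ) × (Fin M → ℂ))))
  have h' : Continuous fun t : (Fin M → ℂ) × Matrix (Fin N) (Fin M) ℂ × (Fin N → ℂ) ×
    (Fin M → ℂ) => (mmseF σ t.2.1)ᴴ := h.matrix_conjTranspose
  unfold relayOut
  refine Continuous.add (h'.matrix_mulVec (Continuous.add (Continuous.matrix_mulVec ?_ ?_) ?_)) ?_
  all_goals fun_prop

lemma lintegral_norm_sq_affine {v D : ℝ} (hv : 0 ≤ v) (hD : 0 ≤ D) (B : Matrix (Fin M) (Fin M) ℂ)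
    (C : Matrix (Fin M) (Fin N) ℂ) (i : Fin M) :
    ∫⁻ p, ENNReal.ofReal (‖(B *ᵥ p.1) i + ((C *ᵥ p.2.1) i + p.2.2 i)‖ ^ 2)
      ∂((complexGaussianVec M 1).prod ((complexGaussianVec N v).prod (complexGaussianVec M D))) =
      ENNReal.ofReal (∑ j, ‖B i j‖ ^ 2 + v * ∑ j, ‖C i j‖ ^ 2 + D) := by
  have hsum : 0 ≤ ∑ j, ‖B i j‖ ^ 2 := Finset.sum_nonneg fun j _ => sq_nonneg _
  have hsum' : 0 ≤ ∑ j, ‖C i j‖ ^ 2 := Finset.sum_nonneg fun j _ => sq_nonneg _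
  rw [lintegral_norm_sq_of_map (w := ((∑ j, ‖B i j‖ ^ 2 + v * ∑ j, ‖C i j‖ ^ 2 + D) / 2).toNNReal)
    (by unfold mulVec dotProduct; fun_prop) fun c hc => ?_]
  · rw [← ENNReal.ofReal, show (2 : ℝ≥0∞) = ENNReal.ofReal 2 by simp,
      ← ENNReal.ofReal_mul zero_le_two]
    congr 1
    ring
  · have h1 : (complexGaussianVec M 1).map (fun x => ((c • B i) ⬝ᵥ x).re) = gaussianReal 0
        (∑ j, 1 * ‖(c • B i) j‖ ^ 2 / 2).toNNReal :=
      map_re_dotProduct_pi_complexGaussian (fun _ => zero_le_one) _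
    have h2 : (complexGaussianVec N v).map (fun x => ((c • C i) ⬝ᵥ x).re) = gaussianReal 0
        (∑ j, v * ‖(c • C i) j‖ ^ 2 / 2).toNNReal :=
      map_re_dotProduct_pi_complexGaussian (fun _ => hv) _
    -- The single coordinate `q i` is written as a dot product so that all three terms are linear
    -- functionals.
    have h3 : (complexGaussianVec M D).map (fun x => ((Pi.single i c : Fin M → ℂ) ⬝ᵥ x).re) =
        gaussianReal 0 (∑ j, D * ‖(Pi.single i c : Fin M → ℂ) j‖ ^ 2 / 2).toNNReal :=
      map_re_dotProduct_pi_complexGaussian (fun _ => hD) _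
    have h4 := map_add_prod_gaussianReal (by unfold dotProduct; fun_prop)
      (by unfold dotProduct; fun_prop) h1 (map_add_prod_gaussianReal
        (by unfold dotProduct; fun_prop) (by unfold dotProduct; fun_prop) h2 h3)
    convert h4 using 1
    · congr 1
      funext p
      rw [mul_add, mul_add, Complex.add_re, Complex.add_re, smul_dotProduct, smul_dotProduct,
        single_dotProduct]
      rfl
    · congr 1
      simp only [Pi.smul_apply, smul_eq_mul, norm_mul, hc, one_mul]
      have h5 : ∑ j, D * ‖(Pi.single i c : Fin M → ℂ) j‖ ^ 2 / 2 = D / 2 := by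
        rw [Finset.sum_eq_single i (fun j _ hj => by simp [hj]) (by simp)]
        simp [hc]
      rw [h5, ← Finset.sum_div, ← Finset.sum_div, ← Finset.mul_sum, ← Real.toNNReal_add
        (by positivity) (by positivity), ← Real.toNNReal_add (by positivity) (by positivity)]
      congr 1
      ring

/-- For `c = 0` this is a diagonal entry of `mmse_covariance`; subtracting `c I` changes only the
entry `(i, i)` of the row. -/
lemma sum_norm_sq_mmse_row (hσ : 0 < σ) (H : Matrix (Fin N) (Fin M) ℂ) (c : ℝ) (i : Fin M) :
    ∑ j, ‖((mmseF σ H)ᴴ * H - (c : ℂ) • (1 : Matrix (Fin M) (Fin M) ℂ)) i j‖ ^ 2 + σ ^ 2 * ∑ j, ‖(mmseF σ H)ᴴ i j‖ ^ 2 =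
      (1 - 2 * c) * (((mmseF σ H)ᴴ * H) i i).re + c ^ 2 := by
  have hrow : ∀ {n : ℕ} (A : Matrix (Fin M) (Fin n) ℂ),
      (A * Aᴴ) i i = ((∑ j, ‖A i j‖ ^ 2 : ℝ) : ℂ) := fun A => by
    rw [mul_apply, Complex.ofReal_sum]
    exact Finset.sum_congr rfl fun j _ => by
      rw [conjTranspose_apply, Complex.star_def, Complex.mul_conj, Complex.sq_norm]
  have h1 := congrArg Complex.re (congrFun (congrFun (mmse_covariance hσ H) i) i)
  have h2 := hrow (mmseF σ H)ᴴ
  rw [conjTranspose_conjTranspose] at h2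
  rw [mmse_covariance_signal, Matrix.add_apply, Matrix.smul_apply, hrow, h2, smul_eq_mul,
    Complex.add_re, ← Complex.ofReal_mul, Complex.ofReal_re, Complex.ofReal_re] at h1
  set W := (mmseF σ H)ᴴ * H
  have h3 : ∀ j, ‖(W - (c : ℂ) • (1 : Matrix (Fin M) (Fin M) ℂ)) i j‖ ^ 2 = ‖W i j‖ ^ 2 +
      if i = j then -2 * c * (W i i).re + c ^ 2 else 0 := fun j => by
    rw [Matrix.sub_apply, Matrix.smul_apply]
    by_cases hij : i = j
    · subst hij
      rw [one_apply_eq, if_pos rfl, Complex.sq_norm, Complex.sq_norm, Complex.normSq_apply,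
        Complex.normSq_apply]
      simp
      ring
    · simp [hij]
  simp_rw [h3]
  rw [Finset.sum_add_distrib, Finset.sum_ite_eq, if_pos (Finset.mem_univ i)]
  linarith

lemma integral_re_mmseF_mul_apply (hσ : 0 < σ) (i : Fin M) :
    ∫ H, (((mmseF σ H)ᴴ * H) i i).re ∂(rayleighLaw N M) =
      (min N M : ℕ) / (M : ℝ) * eigenMean M N σ := by
  have h := congrFun (congrFun (meanMatrix_mmseF_mul (M := M) (N := N) hσ) i) i
  rw [Matrix.smul_apply, one_apply_eq, smul_eq_mul, mul_one, meanMatrix, of_apply] at h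
  have h2 := integral_re (𝕜 := ℂ) (integrable_mmseF_mul_apply (N := N) hσ i i)
  exact h2.trans (by rw [h]; exact Complex.ofReal_re _)

/-- Computed at fixed `H` and then averaged. The value `c = 0` gives the output power `a + D`, and
`c = a` gives the error variance `a - a² + D`. -/
lemma lintegral_norm_sq_relayOut_sub (hσ : 0 < σ) {D : ℝ} (hD : 0 ≤ D) (c : ℝ) (i : Fin M) :
    ∫⁻ t, ENNReal.ofReal (‖relayOut σ t.2.1 t.1 t.2.2.1 t.2.2.2 i - c * t.1 i‖ ^ 2)
      ∂((complexGaussianVec M 1).prod ((rayleighLaw N M).prod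
        ((complexGaussianVec N (σ ^ 2)).prod (complexGaussianVec M D)))) =
      ENNReal.ofReal ((1 - 2 * c) * ((min N M : ℕ) / (M : ℝ) * eigenMean M N σ) + c ^ 2 + D) := by
  have hcont := continuous_relayOut (M := M) (N := N) hσ
  have hi : Continuous fun t : (Fin M → ℂ) × Matrix (Fin N) (Fin M) ℂ × (Fin N → ℂ) ×
      (Fin M → ℂ) => relayOut σ t.2.1 t.1 t.2.2.1 t.2.2.2 i := (continuous_apply i).comp hcont
  have hx : Continuous fun t : (Fin M → ℂ) × Matrix (Fin N) (Fin M) ℂ × (Fin N → ℂ) ×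
      (Fin M → ℂ) => (c : ℂ) * t.1 i := by fun_prop
  have hf : Measurable fun t : (Fin M → ℂ) × Matrix (Fin N) (Fin M) ℂ × (Fin N → ℂ) ×
      (Fin M → ℂ) => ENNReal.ofReal
        (‖relayOut σ t.2.1 t.1 t.2.2.1 t.2.2.2 i - c * t.1 i‖ ^ 2) := by
    have := hi.measurable
    have := hx.measurable
    fun_prop
  rw [lintegral_prod_left_comm _ _ _ hf]
  have h2 : ∀ H : Matrix (Fin N) (Fin M) ℂ, ∫⁻ p, ENNReal.ofReal
      (‖relayOut σ H p.1 p.2.1 p.2.2 i - c * p.1 i‖ ^ 2)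
        ∂((complexGaussianVec M 1).prod
          ((complexGaussianVec N (σ ^ 2)).prod (complexGaussianVec M D))) =
      ENNReal.ofReal ((1 - 2 * c) * (((mmseF σ H)ᴴ * H) i i).re + c ^ 2 + D) := fun H => by
    rw [← sum_norm_sq_mmse_row hσ, ← lintegral_norm_sq_affine (sq_nonneg σ) hD]
    refine lintegral_congr fun p => ?_
    congr 3
    simp only [relayOut, Pi.add_apply, mulVec_add, mulVec_mulVec, sub_mulVec, Pi.sub_apply,
      smul_mulVec, one_mulVec, Pi.smul_apply, smul_eq_mul]
    ring
  simp_rw [h2]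
  have hint : Integrable (fun H : Matrix (Fin N) (Fin M) ℂ => (((mmseF σ H)ᴴ * H) i i).re)
      (rayleighLaw N M) := (integrable_mmseF_mul_apply hσ i i).re
  obtain ⟨hint', hval⟩ := integral_affine hint (1 - 2 * c) (c ^ 2) D
  rw [← ofReal_integral_eq_lintegral_ofReal hint' (Filter.Eventually.of_forall fun H => ?_)]
  · rw [hval, integral_re_mmseF_mul_apply hσ]
  · simp only [Pi.zero_apply]
    rw [← sum_norm_sq_mmse_row hσ]
    positivity

end Moments

/-! ### Conditional mutual information under additive Gaussian noise -/

section AdditiveNoise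

variable {Ω α γ κ : Type*} [MeasurableSpace Ω] [MeasurableSpace α] [MeasurableSpace γ] [Fintype κ]
  {M : ℕ}

lemma map_add_pi_complexGaussianVec {D v : κ → ℝ} (hD : ∀ k, 0 < D k) (hv : ∀ k, 0 < v k)
    (m : κ → Fin M → ℂ) :
    (Measure.pi fun k => complexGaussianVec M (D k)).map (fun z => m + z) =
      (Measure.pi fun k => complexGaussianVec M (v k)).withDensity fun z =>
        ENNReal.ofReal (Real.exp (∑ k, ∑ i, logRatio (D k) (v k) (m k i) (z k i))) := by
  have h1 : ∀ k, (complexGaussianVec M (D k)).map (fun z => m k + z) =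
      (complexGaussianVec M (v k)).withDensity fun z =>
        ENNReal.ofReal (Real.exp (∑ i, logRatio (D k) (v k) (m k i) (z i))) := fun k =>
    map_add_pi_complexGaussian (fun _ => hD k) (fun _ => hv k) (m k)
  have hp' : ∀ k, IsProbabilityMeasure ((complexGaussianVec M (D k)).map (fun z => m k + z)) :=
    fun k => Measure.isProbabilityMeasure_map (by fun_prop)
  have hp : ∀ k, IsProbabilityMeasure ((complexGaussianVec M (v k)).withDensity fun z =>
      ENNReal.ofReal (Real.exp (∑ i, logRatio (D k) (v k) (m k i) (z i)))) := fun k => by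
    rw [← h1]
    exact hp' k
  rw [← pi_withDensity_exp (E := fun _ : κ => Fin M → ℂ) (fun k => complexGaussianVec M (v k))
    (fun k z => ∑ i, logRatio (D k) (v k) (m k i) (z i))
    fun k => by unfold logRatio; fun_prop]
  rw [← funext h1, ← Measure.pi_map_pi (f := fun k z => m k + z) (fun k => by fun_prop)]
  rfl

/-- Additive Gaussian noise bounds the conditional mutual information between the noisy and the
noiseless signal by the capacity at the given output powers. -/
lemma condMutualInfo_le_of_additive_noise [StandardBorelSpace α] [Nonempty α] (P : Measure Ω)
    [IsProbabilityMeasure P] {A : Ω → α} {G : Ω → γ} {r B : Ω → κ → Fin M → ℂ}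
    {m : α → κ → Fin M → ℂ} (hA : AEMeasurable A P) (hG : AEMeasurable G P)
    (hr : AEMeasurable r P) (hm : Measurable m) (hB : ∀ ω, B ω = m (A ω) + r ω) {D v : κ → ℝ}
    (hD : ∀ k, 0 < D k) (hv : ∀ k, 0 < v k)
    (hlaw : P.map (fun ω => ((G ω, A ω), r ω)) =
      (P.map fun ω => (G ω, A ω)).prod (Measure.pi fun k => complexGaussianVec M (D k)))
    (hr2 : ∀ k i, ∫⁻ ω, ENNReal.ofReal (‖r ω k i‖ ^ 2) ∂P = ENNReal.ofReal (D k))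
    (hB2 : ∀ k i, ∫⁻ ω, ENNReal.ofReal (‖B ω k i‖ ^ 2) ∂P = ENNReal.ofReal (v k)) :
    condMutualInfo A B G P ≤ ENNReal.ofReal (∑ k, M * Real.logb 2 (v k / D k)) := by
  have hBm : AEMeasurable B P := by
    rw [funext hB]
    exact (hm.comp_aemeasurable hA).add hr
  have hlog : (0 : ℝ) < Real.log 2 := Real.log_pos one_lt_two
  have hGA := hG.prodMk hA
  have := Measure.isProbabilityMeasure_map hGA
  have := Measure.isProbabilityMeasure_map (hGA.prodMk hBm)
  -- Given `(G, A)`, the output is Gaussian noise around `m A`; the dependence on `G` disappears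
  -- because `r` is independent of the pair.
  have hdens : P.map (fun ω => ((G ω, A ω), B ω)) =
      ((P.map fun ω => (G ω, A ω)).prod (Measure.pi fun k => complexGaussianVec M (v k))).withDensity
        fun p => ENNReal.ofReal (Real.exp
          (∑ k, ∑ i, logRatio (D k) (v k) (m p.1.2 k i) (p.2 k i))) := by
    rw [← map_prodMk_eq_withDensity (ν := Measure.pi fun k => complexGaussianVec M (D k))
      (φ := fun p => m p.1.2 + p.2) (by fun_prop) (by unfold logRatio; fun_prop)
      fun ga => map_add_pi_complexGaussianVec hD hv (m ga.2), ← hlaw,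
      AEMeasurable.map_map_of_aemeasurable (by fun_prop) (hGA.prodMk hr)]
    congr 1
    funext ω
    simp [hB]
  have hval : ∀ k i, Integrable (fun ω => ‖r ω k i‖ ^ 2) P ∧ ∫ ω, ‖r ω k i‖ ^ 2 ∂P = D k :=
    fun k i => integrable_and_integral_eq_of_lintegral (by fun_prop) (fun _ => sq_nonneg _)
      (hD k).le (hr2 k i)
  have hval' : ∀ k i, Integrable (fun ω => ‖B ω k i‖ ^ 2) P ∧ ∫ ω, ‖B ω k i‖ ^ 2 ∂P = v k :=
    fun k i => integrable_and_integral_eq_of_lintegral (by fun_prop) (fun _ => sq_nonneg _)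
      (hv k).le (hB2 k i)
  have hl : Measurable fun p : (γ × α) × (κ → Fin M → ℂ) =>
      ∑ k, ∑ i, logRatio (D k) (v k) (m p.1.2 k i) (p.2 k i) := by unfold logRatio; fun_prop
  -- The two quadratic terms have means `-1` and `1` because the reference variance `v` equals the
  -- power of `B`.
  have hterm : ∀ k i, Integrable (fun ω => Real.log (v k / D k) - ‖r ω k i‖ ^ 2 / D k +
      ‖B ω k i‖ ^ 2 / v k) P ∧ ∫ ω, (Real.log (v k / D k) - ‖r ω k i‖ ^ 2 / D k +
      ‖B ω k i‖ ^ 2 / v k) ∂P = Real.log (v k / D k) := fun k i => by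
    have i1 := (hval k i).1.div_const (D k)
    have i2 := (hval' k i).1.div_const (v k)
    refine ⟨((integrable_const _).sub i1).add i2, ?_⟩
    rw [integral_add (f := fun ω => Real.log (v k / D k) - ‖r ω k i‖ ^ 2 / D k)
      ((integrable_const _).sub i1) i2, integral_sub (integrable_const _) i1,
      integral_div, integral_div, (hval k i).2, (hval' k i).2, div_self (hD k).ne',
      div_self (hv k).ne']
    simp
  have hcomp : ∀ ω, ∑ k, ∑ i, logRatio (D k) (v k) (m (A ω) k i) (B ω k i) =
      ∑ k, ∑ i, (Real.log (v k / D k) - ‖r ω k i‖ ^ 2 / D k + ‖B ω k i‖ ^ 2 / v k) := fun ω =>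
    Finset.sum_congr rfl fun k _ => Finset.sum_congr rfl fun i _ => by simp [logRatio, hB]
  have hsumint : Integrable (fun ω => ∑ k, ∑ i, (Real.log (v k / D k) - ‖r ω k i‖ ^ 2 / D k +
      ‖B ω k i‖ ^ 2 / v k)) P :=
    integrable_finsetSum _ fun k _ => integrable_finsetSum _ fun i _ => (hterm k i).1
  have hkl := klDiv_condDistrib_le P hA hBm hG (Measure.pi fun k => complexGaussianVec M (v k))
  rw [(klDiv_withDensity_exp hl hdens ?_).2, integral_map (hGA.prodMk hBm) hl.aestronglyMeasurable]
    at hkl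
  · simp_rw [hcomp] at hkl
    rw [integral_finsetSum _ fun k _ => integrable_finsetSum _ fun i _ => (hterm k i).1,
      Finset.sum_congr rfl fun k _ => integral_finsetSum _ fun i _ => (hterm k i).1,
      Finset.sum_congr rfl fun k _ => Finset.sum_congr rfl fun i _ => (hterm k i).2] at hkl
    rw [condMutualInfo]
    refine (ENNReal.div_le_div_right hkl _).trans (le_of_eq ?_)
    rw [← ENNReal.ofReal_div_of_pos hlog, Finset.sum_div]
    congr 1
    refine Finset.sum_congr rfl fun k _ => ?_
    simp [Real.logb, mul_div_assoc]
  · rw [integrable_map_measure hl.aestronglyMeasurable (hGA.prodMk hBm)]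
    refine hsumint.congr (Filter.Eventually.of_forall fun ω => ?_)
    exact (hcomp ω).symm

end AdditiveNoise

/-! ### The joint output of the relays given the channels -/

section JointOutput

open ComplexOrder MatrixOrder

variable {M : ℕ} {N : Fin 2 → ℕ} {σ : ℝ}

lemma exists_eq_mul_conjTranspose {ι : Type*} [Fintype ι] [DecidableEq ι] {K : Matrix ι ι ℂ}
    (hK : K.PosDef) : ∃ A : Matrix ι ι ℂ, K = A * Aᴴ ∧ A.det ≠ 0 := by
  obtain ⟨B, hB⟩ := CStarAlgebra.nonneg_iff_eq_star_mul_self.mp hK.posSemidef.nonneg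
  refine ⟨Bᴴ, by rw [conjTranspose_conjTranspose, hB, star_eq_conjTranspose], fun h => ?_⟩
  have h1 := hK.det_pos
  rw [hB, det_mul, star_eq_conjTranspose, h, zero_mul] at h1
  exact lt_irrefl _ h1

lemma sum_norm_sq_eq_dotProduct {ι : Type*} [Fintype ι] (u : ι → ℂ) :
    ((∑ i, ‖u i‖ ^ 2 : ℝ) : ℂ) = u ⬝ᵥ star u := by
  rw [dotProduct, Complex.ofReal_sum]
  exact Finset.sum_congr rfl fun i _ => by
    rw [Pi.star_apply, Complex.star_def, Complex.mul_conj, Complex.sq_norm]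

lemma vecMul_dotProduct_star_vecMul {l m n : Type*} [Fintype l] [Fintype m] [Fintype n]
    (u : l → ℂ) (w : n → ℂ) (X : Matrix l m ℂ) (Y : Matrix n m ℂ) :
    (u ᵥ* X) ⬝ᵥ star (w ᵥ* Y) = (u ᵥ* (X * Yᴴ)) ⬝ᵥ star w := by
  rw [star_vecMul, dotProduct_mulVec, vecMul_vecMul]

/-- The joint law of the inputs, receiver noises and quantization noises. -/
def noiseLaw (M : ℕ) (N : Fin 2 → ℕ) (σ : ℝ) (D : Fin 2 → ℝ) :
    Measure ((Fin M → ℂ) × ((k : Fin 2) → Fin (N k) → ℂ) × (Fin 2 → Fin M → ℂ)) :=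
  (complexGaussianVec M 1).prod ((Measure.pi fun k => complexGaussianVec (N k) (σ ^ 2)).prod
    (Measure.pi fun k => complexGaussianVec M (D k)))

instance isProbabilityMeasure_noiseLaw (D : Fin 2 → ℝ) :
    IsProbabilityMeasure (noiseLaw M N σ D) := by
  unfold noiseLaw; infer_instance

/-- The stacked outputs of both relays. -/
def pairOut (σ : ℝ) (H : (k : Fin 2) → Matrix (Fin (N k)) (Fin M) ℂ)
    (r : (Fin M → ℂ) × ((k : Fin 2) → Fin (N k) → ℂ) × (Fin 2 → Fin M → ℂ)) :
    Fin M ⊕ Fin M → ℂ :=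
  Sum.elim (relayOut σ (H 0) r.1 (r.2.1 0) (r.2.2 0)) (relayOut σ (H 1) r.1 (r.2.1 1) (r.2.2 1))

lemma measurable_relayOut {n : ℕ} (hσ : 0 < σ) {α : Type*} [MeasurableSpace α]
    {G : α → Matrix (Fin n) (Fin M) ℂ} {x q : α → Fin M → ℂ} {w : α → Fin n → ℂ}
    (hG : Measurable G) (hx : Measurable x) (hw : Measurable w) (hq : Measurable q) :
    Measurable fun a => relayOut σ (G a) (x a) (w a) (q a) := by
  have h1 : Measurable fun a => mmseF σ (G a) := (continuous_mmseF hσ).measurable.comp hG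
  have h2 : ∀ i j, Measurable fun a => mmseF σ (G a) i j := fun i j =>
    (measurable_pi_apply j).comp ((measurable_pi_apply i).comp h1)
  have h3 : ∀ i j, Measurable fun a => G a i j := fun i j =>
    (measurable_pi_apply j).comp ((measurable_pi_apply i).comp hG)
  refine measurable_pi_lambda _ fun i => ?_
  simp only [relayOut, mulVec, dotProduct, Pi.add_apply, conjTranspose_apply,
    Complex.star_def]
  fun_prop

lemma measurable_pairOut (hσ : 0 < σ) :
    Measurable fun p : ((k : Fin 2) → Matrix (Fin (N k)) (Fin M) ℂ) ×
      (Fin M → ℂ) × ((k : Fin 2) → Fin (N k) → ℂ) × (Fin 2 → Fin M → ℂ) =>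
      pairOut σ p.1 p.2 := by
  refine measurable_pi_lambda _ fun s => ?_
  rcases s with i | i
  · exact (measurable_pi_apply i).comp (measurable_relayOut hσ
      ((measurable_pi_apply 0).comp measurable_fst) (by fun_prop) (by fun_prop) (by fun_prop))
  · exact (measurable_pi_apply i).comp (measurable_relayOut hσ
      ((measurable_pi_apply 1).comp measurable_fst) (by fun_prop) (by fun_prop) (by fun_prop))

lemma measurable_pairOut_right (hσ : 0 < σ)
    (H : (k : Fin 2) → Matrix (Fin (N k)) (Fin M) ℂ) : Measurable (pairOut σ H) := by
  refine measurable_pi_lambda _ fun s => ?_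
  rcases s with i | i
  · exact (measurable_pi_apply i).comp (measurable_relayOut hσ measurable_const
      (by fun_prop) (by fun_prop) (by fun_prop))
  · exact (measurable_pi_apply i).comp (measurable_relayOut hσ measurable_const
      (by fun_prop) (by fun_prop) (by fun_prop))

lemma dotProduct_relayOut {n : ℕ} (H : Matrix (Fin n) (Fin M) ℂ) (x : Fin M → ℂ) (w : Fin n → ℂ)
    (q u : Fin M → ℂ) :
    u ⬝ᵥ relayOut σ H x w q =
      (u ᵥ* ((mmseF σ H)ᴴ * H)) ⬝ᵥ x + ((u ᵥ* (mmseF σ H)ᴴ) ⬝ᵥ w + u ⬝ᵥ q) := by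
  rw [relayOut, dotProduct_add, dotProduct_mulVec, dotProduct_add, dotProduct_mulVec,
    vecMul_vecMul, add_assoc]

/-- The variance of a linear functional of the stacked outputs, split by source. The relays share
`x`, so their vectors are added before taking the norm; the noises are independent and add in
squares. -/
lemma covBlock_quadratic (D : Fin 2 → ℝ) (H : (k : Fin 2) → Matrix (Fin (N k)) (Fin M) ℂ)
    (u : Fin 2 → Fin M → ℂ) :
    (Sum.elim (u 0) (u 1) ᵥ* covBlock σ D H) ⬝ᵥ star (Sum.elim (u 0) (u 1)) =
      ((∑ i, ‖(∑ k, u k ᵥ* ((mmseF σ (H k))ᴴ * H k)) i‖ ^ 2 +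
        (∑ k, σ ^ 2 * ∑ j, ‖(u k ᵥ* (mmseF σ (H k))ᴴ) j‖ ^ 2 +
          ∑ k, D k * ∑ i, ‖u k i‖ ^ 2) : ℝ) : ℂ) := by
  have hW : ∀ k, (u k ᵥ* (mmseF σ (H k))ᴴ) ⬝ᵥ star (u k ᵥ* (mmseF σ (H k))ᴴ) =
      (u k ᵥ* ((mmseF σ (H k))ᴴ * mmseF σ (H k))) ⬝ᵥ star (u k) := fun k => by
    rw [vecMul_dotProduct_star_vecMul, conjTranspose_conjTranspose]
  have hX : ∀ k l, (u k ᵥ* ((mmseF σ (H k))ᴴ * H k)) ⬝ᵥ star (u l ᵥ* ((mmseF σ (H l))ᴴ * H l)) =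
      (u k ᵥ* ((mmseF σ (H k))ᴴ * H k * (H l)ᴴ * mmseF σ (H l))) ⬝ᵥ star (u l) := fun k l => by
    rw [vecMul_dotProduct_star_vecMul, conjTranspose_mul, conjTranspose_conjTranspose,
      ← Matrix.mul_assoc]
  simp only [Complex.ofReal_add, Complex.ofReal_sum (Finset.univ : Finset (Fin 2)),
    Complex.ofReal_mul, sum_norm_sq_eq_dotProduct, hW]
  simp only [Fin.sum_univ_two, star_add, dotProduct_add, add_dotProduct, hX]
  simp only [covBlock, vecMul_fromBlocks, Sum.elim_comp_inl, Sum.elim_comp_inr, covDiag, covCross,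
    Function.star_sumElim, dotProduct, Fintype.sum_sum_type, Sum.elim_inl, Sum.elim_inr,
    vecMul_add, vecMul_smul, vecMul_one, Pi.add_apply, Pi.smul_apply, smul_eq_mul, add_mul,
    Finset.sum_add_distrib, mul_assoc, Finset.mul_sum]
  ring

/-- At a fixed channel the outputs are linear in Gaussian vectors, so every real functional is
Gaussian on both sides; the variances agree because `u K uᴴ = ‖u A‖²`. -/
lemma map_pairOut_eq_map_mulVec (hσ : 0 < σ) {D : Fin 2 → ℝ} (hD : ∀ k, 0 < D k)
    (H : (k : Fin 2) → Matrix (Fin (N k)) (Fin M) ℂ)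
    {A : Matrix (Fin M ⊕ Fin M) (Fin M ⊕ Fin M) ℂ} (hA : covBlock σ D H = A * Aᴴ) :
    (noiseLaw M N σ D).map (pairOut σ H) =
      (stdComplexGaussian (Fin M ⊕ Fin M)).map fun z => A *ᵥ z := by
  have hm : Measurable (pairOut σ H) := measurable_pairOut_right hσ H
  have hm' : Measurable fun z : Fin M ⊕ Fin M → ℂ => A *ᵥ z :=
    (Continuous.matrix_mulVec continuous_const continuous_id).measurable
  have := Measure.isProbabilityMeasure_map (μ := noiseLaw M N σ D) hm.aemeasurable
  have := Measure.isProbabilityMeasure_map (μ := stdComplexGaussian (Fin M ⊕ Fin M))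
    hm'.aemeasurable
  refine ext_of_map_re_dotProduct fun b => ?_
  have hb : Measurable fun z : Fin M ⊕ Fin M → ℂ => (b ⬝ᵥ z).re := by unfold dotProduct; fun_prop
  rw [Measure.map_map hb hm, Measure.map_map hb hm']
  let u : Fin 2 → Fin M → ℂ := ![b ∘ Sum.inl, b ∘ Sum.inr]
  have hbu : b = Sum.elim (u 0) (u 1) := (Sum.elim_comp_inl_inr b).symm
  have hl : ((fun z : Fin M ⊕ Fin M → ℂ => (b ⬝ᵥ z).re) ∘ pairOut σ H) = fun r =>
      ((∑ k, u k ᵥ* ((mmseF σ (H k))ᴴ * H k)) ⬝ᵥ r.1).re +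
        (∑ k, ((u k ᵥ* (mmseF σ (H k))ᴴ) ⬝ᵥ r.2.1 k).re + ∑ k, (u k ⬝ᵥ r.2.2 k).re) := by
    funext r
    have h1 : b ⬝ᵥ pairOut σ H r = ∑ k, u k ⬝ᵥ relayOut σ (H k) r.1 (r.2.1 k) (r.2.2 k) := by
      rw [Fin.sum_univ_two, hbu, pairOut]
      simp [dotProduct, Fintype.sum_sum_type]
    simp only [Function.comp, h1, dotProduct_relayOut, Fin.sum_univ_two, add_dotProduct,
      Complex.add_re]
    ring
  have hr : ((fun z : Fin M ⊕ Fin M → ℂ => (b ⬝ᵥ z).re) ∘ fun z => A *ᵥ z) =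
      fun z => ((b ᵥ* A) ⬝ᵥ z).re := by
    funext z
    simp only [Function.comp, dotProduct_mulVec]
  rw [hl, hr, map_re_dotProduct_pi_complexGaussian fun _ => zero_le_one]
  have hmeas : ∀ {n : ℕ} (c : Fin n → ℂ), Measurable fun z : Fin n → ℂ => (c ⬝ᵥ z).re :=
    fun c => by unfold dotProduct; fun_prop
  have h1 : (complexGaussianVec M 1).map
      (fun z => ((∑ k, u k ᵥ* ((mmseF σ (H k))ᴴ * H k)) ⬝ᵥ z).re) = gaussianReal 0
        (∑ i, 1 * ‖(∑ k, u k ᵥ* ((mmseF σ (H k))ᴴ * H k)) i‖ ^ 2 / 2).toNNReal :=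
    map_re_dotProduct_pi_complexGaussian (fun _ => zero_le_one) _
  have h2 : ∀ k, (complexGaussianVec (N k) (σ ^ 2)).map
      (fun z => ((u k ᵥ* (mmseF σ (H k))ᴴ) ⬝ᵥ z).re) = gaussianReal 0
        (∑ i, σ ^ 2 * ‖(u k ᵥ* (mmseF σ (H k))ᴴ) i‖ ^ 2 / 2).toNNReal := fun k =>
    map_re_dotProduct_pi_complexGaussian (fun _ => sq_nonneg σ) _
  have h3 : ∀ k, (complexGaussianVec M (D k)).map (fun z => (u k ⬝ᵥ z).re) = gaussianReal 0
        (∑ i, D k * ‖u k i‖ ^ 2 / 2).toNNReal := fun k =>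
    map_re_dotProduct_pi_complexGaussian (fun _ => (hD k).le) _
  have m2 : Measurable fun w : (k : Fin 2) → Fin (N k) → ℂ =>
      ∑ k, ((u k ᵥ* (mmseF σ (H k))ᴴ) ⬝ᵥ w k).re := Finset.measurable_fun_sum _ fun k _ =>
    (hmeas (u k ᵥ* (mmseF σ (H k))ᴴ)).comp (measurable_pi_apply k)
  have m3 : Measurable fun w : Fin 2 → Fin M → ℂ => ∑ k, (u k ⬝ᵥ w k).re :=
    Finset.measurable_fun_sum _ fun k _ => (hmeas (u k)).comp (measurable_pi_apply k)
  refine (map_add_prod_gaussianReal (hmeas _)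
    ((m2.comp measurable_fst).add (m3.comp measurable_snd)) h1
    (map_add_prod_gaussianReal m2 m3
      (map_sum_pi_gaussianReal (fun k => hmeas (u k ᵥ* (mmseF σ (H k))ᴴ)) h2)
      (map_sum_pi_gaussianReal (fun k => hmeas (u k)) h3))).trans ?_
  have hD' : ∀ k, 0 ≤ D k := fun k => (hD k).le
  have hq : ∀ k, 0 ≤ ∑ i, D k * ‖u k i‖ ^ 2 / 2 := fun k =>
    Finset.sum_nonneg fun i _ => by have := hD' k; positivity
  have hn : ∀ k, 0 ≤ ∑ i, σ ^ 2 * ‖(u k ᵥ* (mmseF σ (H k))ᴴ) i‖ ^ 2 / 2 := fun k => by positivity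
  rw [← Real.toNNReal_sum_of_nonneg fun k _ => hn k, ← Real.toNNReal_sum_of_nonneg fun k _ => hq k,
    ← Real.toNNReal_add (Finset.sum_nonneg fun k _ => hn k) (Finset.sum_nonneg fun k _ => hq k),
    ← Real.toNNReal_add (by positivity)
      (add_nonneg (Finset.sum_nonneg fun k _ => hn k) (Finset.sum_nonneg fun k _ => hq k))]
  congr 2
  have hquad := covBlock_quadratic (σ := σ) D H u
  rw [← hbu, hA, ← vecMul_dotProduct_star_vecMul, ← sum_norm_sq_eq_dotProduct,
    Complex.ofReal_inj] at hquad
  simp only [one_mul, ← Finset.sum_div, ← Finset.mul_sum] at hquad ⊢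
  rw [hquad]
  ring

/-- The logarithm of the density of the stacked relay outputs given the channels with respect to
`CN(0, I)`. -/
def outputLogDensity (σ : ℝ) (D : Fin 2 → ℝ)
    (p : ((k : Fin 2) → Matrix (Fin (N k)) (Fin M) ℂ) × (Fin M ⊕ Fin M → ℂ)) : ℝ :=
  -Real.log (covBlock σ D p.1).det.re - (star p.2 ⬝ᵥ (covBlock σ D p.1)⁻¹ *ᵥ p.2).re
    + ∑ s, ‖p.2 s‖ ^ 2

lemma continuous_inv_covBlock (hσ : 0 < σ) {D : Fin 2 → ℝ} (hD : ∀ k, 0 < D k) :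
    Continuous fun H : (k : Fin 2) → Matrix (Fin (N k)) (Fin M) ℂ => (covBlock σ D H)⁻¹ := by
  simp only [Matrix.inv_def, Ring.inverse_eq_inv']
  have h1 := continuous_covBlock (M := M) (N := N) hσ D
  have h2 := h1.matrix_det.inv₀ fun H => (covBlock_posDef hD H).det_pos.ne'
  exact h2.smul h1.matrix_adjugate

lemma measurable_quadratic (hσ : 0 < σ) {D : Fin 2 → ℝ} (hD : ∀ k, 0 < D k) :
    Measurable fun p : ((k : Fin 2) → Matrix (Fin (N k)) (Fin M) ℂ) × (Fin M ⊕ Fin M → ℂ) =>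
      (star p.2 ⬝ᵥ (covBlock σ D p.1)⁻¹ *ᵥ p.2).re := by
  have h := (continuous_inv_covBlock (M := M) (N := N) hσ hD).comp
    (continuous_fst (Y := Fin M ⊕ Fin M → ℂ))
  have h' : Continuous fun p : ((k : Fin 2) → Matrix (Fin (N k)) (Fin M) ℂ) ×
    (Fin M ⊕ Fin M → ℂ) => (covBlock σ D p.1)⁻¹ := h
  exact (Complex.continuous_re.comp (Continuous.dotProduct continuous_snd.star
    (h'.matrix_mulVec continuous_snd))).measurable

lemma measurable_outputLogDensity (hσ : 0 < σ) {D : Fin 2 → ℝ} (hD : ∀ k, 0 < D k) :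
    Measurable (outputLogDensity (M := M) (N := N) σ D) := by
  have h1 := measurable_quadratic (M := M) (N := N) hσ hD
  have h2 : Measurable fun H : (k : Fin 2) → Matrix (Fin (N k)) (Fin M) ℂ =>
      (covBlock σ D H).det.re :=
    (Complex.continuous_re.comp (continuous_covBlock hσ D).matrix_det).measurable
  have h3 : Measurable fun p : ((k : Fin 2) → Matrix (Fin (N k)) (Fin M) ℂ) ×
      (Fin M ⊕ Fin M → ℂ) => Real.log (covBlock σ D p.1).det.re :=
    Real.measurable_log.comp (h2.comp measurable_fst)
  unfold outputLogDensity
  exact (h3.neg.sub h1).add (by fun_prop)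

/-- Expresses the exponent through `K = A Aᴴ` alone, so the density depends measurably on the
channel without a measurable choice of `A`. -/
lemma sum_norm_sq_inv_mulVec {ι : Type*} [Fintype ι] [DecidableEq ι] (A : Matrix ι ι ℂ)
    (z : ι → ℂ) : ∑ i, ‖(A⁻¹ *ᵥ z) i‖ ^ 2 = (star z ⬝ᵥ (A * Aᴴ)⁻¹ *ᵥ z).re := by
  have h : ((∑ i, ‖(A⁻¹ *ᵥ z) i‖ ^ 2 : ℝ) : ℂ) = star z ⬝ᵥ (A * Aᴴ)⁻¹ *ᵥ z := by
    rw [sum_norm_sq_eq_dotProduct, dotProduct_comm, star_mulVec, ← dotProduct_mulVec, mulVec_mulVec,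
      conjTranspose_nonsing_inv, ← Matrix.mul_inv_rev]
  rw [← h, Complex.ofReal_re]

lemma map_pairOut_eq_withDensity (hσ : 0 < σ) {D : Fin 2 → ℝ} (hD : ∀ k, 0 < D k)
    (H : (k : Fin 2) → Matrix (Fin (N k)) (Fin M) ℂ) :
    (noiseLaw M N σ D).map (pairOut σ H) =
      (stdComplexGaussian (Fin M ⊕ Fin M)).withDensity fun z =>
        ENNReal.ofReal (Real.exp (outputLogDensity σ D (H, z))) := by
  obtain ⟨A, hA, hdet⟩ := exists_eq_mul_conjTranspose (covBlock_posDef (σ := σ) hD H)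
  rw [map_pairOut_eq_map_mulVec hσ hD H hA, map_mulVec_stdComplexGaussian A hdet]
  have h : (covBlock σ D H).det.re = ‖A.det‖ ^ 2 := by
    rw [hA, det_mul, det_conjTranspose, Complex.star_def, Complex.mul_conj, Complex.sq_norm,
      Complex.ofReal_re]
  congr 1
  funext z
  rw [outputLogDensity, h, sum_norm_sq_inv_mulVec, hA]

/-- For outputs `A z` with `z` standard, the quadratic form is `‖z‖²`, of mean the dimension. -/
lemma lintegral_quadratic (hσ : 0 < σ) {D : Fin 2 → ℝ} (hD : ∀ k, 0 < D k)
    (H : (k : Fin 2) → Matrix (Fin (N k)) (Fin M) ℂ) :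
    ∫⁻ r, ENNReal.ofReal (star (pairOut σ H r) ⬝ᵥ (covBlock σ D H)⁻¹ *ᵥ pairOut σ H r).re
      ∂(noiseLaw M N σ D) = ENNReal.ofReal (Fintype.card (Fin M ⊕ Fin M)) := by
  obtain ⟨A, hA, hdet⟩ := exists_eq_mul_conjTranspose (covBlock_posDef (σ := σ) hD H)
  have hm : Measurable (pairOut σ H) := measurable_pairOut_right hσ H
  have hm' : Measurable fun z : Fin M ⊕ Fin M → ℂ => A *ᵥ z :=
    (Continuous.matrix_mulVec continuous_const continuous_id).measurable
  have hq : Measurable fun z : Fin M ⊕ Fin M → ℂ =>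
      ENNReal.ofReal (star z ⬝ᵥ (covBlock σ D H)⁻¹ *ᵥ z).re :=
    ENNReal.measurable_ofReal.comp (Complex.measurable_re.comp
      (Continuous.dotProduct continuous_id.star
        (continuous_const.matrix_mulVec continuous_id)).measurable)
  rw [← lintegral_map hq hm, map_pairOut_eq_map_mulVec hσ hD H hA, lintegral_map hq hm']
  have h1 : ∀ z : Fin M ⊕ Fin M → ℂ,
      ENNReal.ofReal (star (A *ᵥ z) ⬝ᵥ (covBlock σ D H)⁻¹ *ᵥ (A *ᵥ z)).re =
        ∑ s, ENNReal.ofReal (‖z s‖ ^ 2) := fun z => by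
    rw [hA, ← sum_norm_sq_inv_mulVec, mulVec_mulVec, Matrix.nonsing_inv_mul _
      (isUnit_iff_ne_zero.2 hdet), one_mulVec, ENNReal.ofReal_sum_of_nonneg
        fun _ _ => sq_nonneg _]
  simp_rw [h1]
  rw [lintegral_finsetSum _ fun s _ => by fun_prop]
  have h2 : ∀ s : Fin M ⊕ Fin M, ∫⁻ z, ENNReal.ofReal (‖z s‖ ^ 2)
      ∂(stdComplexGaussian (Fin M ⊕ Fin M)) = 1 := fun s => by
    have h3 := (measurePreserving_eval (fun _ : Fin M ⊕ Fin M => complexGaussian 1) s).lintegral_comp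
      (f := fun z : ℂ => ENNReal.ofReal (‖z‖ ^ 2)) (by fun_prop)
    rw [lintegral_norm_sq_complexGaussian zero_le_one, ENNReal.ofReal_one] at h3
    exact h3
  simp only [h2]
  simp [ENNReal.ofReal_add]

end JointOutput

/-! ### A lower bound on mutual information -/

section LowerBound

open InformationTheory

variable {Ω α β η : Type*} [MeasurableSpace Ω] [MeasurableSpace α] [MeasurableSpace β]
  [MeasurableSpace η]

/-- A lower bound on `I(X; Z)` from a test channel from `X` to `Z` and the conditional density of
`Z` given a further variable `S`, both relative to a reference measure `Q`. -/
lemma ofReal_sub_le_klDiv [StandardBorelSpace α] [Nonempty α] [StandardBorelSpace η] [Nonempty η]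
    (P : Measure Ω) [IsProbabilityMeasure P] {X : Ω → α} {S : Ω → η} {Z : Ω → β}
    (hX : AEMeasurable X P) (hS : AEMeasurable S P) (hZ : AEMeasurable Z P) (Q : Measure β)
    [IsProbabilityMeasure Q] {f : α × β → ℝ} {g : η × β → ℝ} (hf : Measurable f)
    (hg : Measurable g)
    (hone : ∀ a, IsProbabilityMeasure
      (Q.withDensity fun b => ENNReal.ofReal (Real.exp (f (a, b)))))
    (hdens : P.map (fun ω => (S ω, Z ω)) =
      ((P.map S).prod Q).withDensity fun p => ENNReal.ofReal (Real.exp (g p)))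
    (hfint : Integrable (fun ω => f (X ω, Z ω)) P) (hgint : Integrable (fun ω => g (S ω, Z ω)) P) :
    ENNReal.ofReal (∫ ω, f (X ω, Z ω) ∂P - ∫ ω, g (S ω, Z ω) ∂P) ≤
      klDiv (P.map fun ω => (X ω, Z ω)) ((P.map X).prod (P.map Z)) := by
  have := Measure.isProbabilityMeasure_map hX
  have := Measure.isProbabilityMeasure_map hS
  have := Measure.isProbabilityMeasure_map (hX.prodMk hZ)
  have := Measure.isProbabilityMeasure_map (hS.prodMk hZ)
  have hexp : ∫⁻ p, ENNReal.ofReal (Real.exp (f p)) ∂((P.map X).prod Q) = ENNReal.ofReal 1 := by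
    rw [lintegral_prod _ (by fun_prop)]
    have h : ∀ a, ∫⁻ b, ENNReal.ofReal (Real.exp (f (a, b))) ∂Q = 1 := fun a => by
      have h1 := (hone a).measure_univ
      rwa [withDensity_apply _ MeasurableSet.univ, setLIntegral_univ] at h1
    simp [h]
  obtain ⟨hexpint, hexpval⟩ := integrable_and_integral_eq_of_lintegral
    (f := fun p => Real.exp (f p)) (by fun_prop) (fun p => (Real.exp_pos _).le) zero_le_one hexp
  have hlow := ofReal_integral_le_klDiv (P := P.map fun ω => (X ω, Z ω)) hexpint hexpval
    ((integrable_map_measure hf.aestronglyMeasurable (hX.prodMk hZ)).2 hfint)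
  rw [integral_map (hX.prodMk hZ) hf.aestronglyMeasurable, klDiv_map_prodMk_prod P hX hZ Q] at hlow
  obtain ⟨hnn, hup⟩ := klDiv_withDensity_exp hg hdens
    ((integrable_map_measure hg.aestronglyMeasurable (hS.prodMk hZ)).2 hgint)
  rw [integral_map (hS.prodMk hZ) hg.aestronglyMeasurable] at hnn hup
  -- The conditional density bounds the unknown marginal: adjoining `S` adds the divergence that
  -- defines `I(S; Z)`.
  have hle : klDiv (P.map Z) Q ≤ ENNReal.ofReal (∫ ω, g (S ω, Z ω) ∂P) := by
    rw [← hup, klDiv_map_prodMk_prod P hS hZ Q]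
    exact self_le_add_right _ _
  rw [ENNReal.ofReal_sub _ hnn, tsub_le_iff_left]
  exact hlow.trans (add_le_add_left hle _)

end LowerBound

/-! ### The relay system -/

section System

variable {M : ℕ} {N : Fin 2 → ℕ} {σ : ℝ}

lemma measurePreserving_restrict_compl {ι : Type*} [Fintype ι] [DecidableEq ι] {E : Type*}
    [MeasurableSpace E] (ν : ι → Measure E) [∀ i, IsProbabilityMeasure (ν i)] (T : Finset ι) :
    MeasurePreserving (fun q : ι → E => (Tᶜ.restrict q, T.restrict q)) (Measure.pi ν)
      ((Measure.pi fun i : (Tᶜ : Finset ι) => ν i).prod (Measure.pi fun i : T => ν i)) := by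
  have h1 : iIndepFun (fun (i : ι) (q : ι → E) => q i) (Measure.pi ν) :=
    iIndepFun_pi (X := fun _ e => e) fun _ => aemeasurable_id
  have h2 := (indepFun_iff_map_prod_eq_prod_map_map
    (Finset.measurable_restrict Tᶜ).aemeasurable (Finset.measurable_restrict T).aemeasurable).1
    (h1.indepFun_finset Tᶜ T disjoint_compl_left fun i => measurable_pi_apply i)
  refine ⟨by fun_prop, ?_⟩
  have h3 : ∀ S : Finset ι, (Measure.pi ν).map S.restrict =
      Measure.pi fun i : S => ν i := fun S => by
    rw [← Measure.infinitePi_eq_pi]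
    exact Measure.infinitePi_map_restrict ν
  rw [h3, h3] at h2
  exact h2

lemma map_prodMk_comp_eq_prod {Ω α β γ : Type*} [MeasurableSpace Ω] [MeasurableSpace α]
    [MeasurableSpace β] [MeasurableSpace γ] {P : Measure Ω} {U : Ω → α} {r : Ω → β}
    (hU : AEMeasurable U P) (hr : AEMeasurable r P) {Q : Measure α} {ν : Measure β} [SFinite Q]
    [IsProbabilityMeasure ν] (h : P.map (fun ω => (U ω, r ω)) = Q.prod ν) {φ : α → γ}
    (hφ : Measurable φ) :
    P.map (fun ω => (φ (U ω), r ω)) = (P.map fun ω => φ (U ω)).prod ν := by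
  have h1 : P.map (fun ω => φ (U ω)) = Q.map φ := by
    have h2 := congrArg (fun S => S.map fun p : α × β => φ p.1) h
    rw [AEMeasurable.map_map_of_aemeasurable (by fun_prop) (hU.prodMk hr)] at h2
    refine h2.trans ?_
    change Measure.map (φ ∘ Prod.fst) _ = _
    rw [← Measure.map_map (f := Prod.fst) hφ measurable_fst, Measure.map_fst_prod, measure_univ,
      one_smul]
  have h3 := congrArg (fun S => S.map (Prod.map φ (id : β → β))) h
  rw [AEMeasurable.map_map_of_aemeasurable (by fun_prop) (hU.prodMk hr)] at h3
  rw [h1]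
  refine h3.trans ?_
  rw [← Measure.map_prod_map Q ν hφ measurable_id, Measure.map_id]

lemma measurePreserving_relay (D : Fin 2 → ℝ) (k : Fin 2) :
    MeasurePreserving (fun t : (Fin M → ℂ) × ((k : Fin 2) → Matrix (Fin (N k)) (Fin M) ℂ) ×
      ((k : Fin 2) → Fin (N k) → ℂ) × (Fin 2 → Fin M → ℂ) =>
        (t.1, t.2.1 k, t.2.2.1 k, t.2.2.2 k)) (systemLaw M N σ D)
      ((complexGaussianVec M 1).prod ((rayleighLaw (N k) M).prod
        ((complexGaussianVec (N k) (σ ^ 2)).prod (complexGaussianVec M (D k))))) :=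
  (MeasurePreserving.id _).prod ((measurePreserving_eval (fun k => rayleighLaw (N k) M) k).prod
    ((measurePreserving_eval (fun k => complexGaussianVec (N k) (σ ^ 2)) k).prod
      (measurePreserving_eval (fun k => complexGaussianVec M (D k)) k)))

/-- Isolates the quantization noises in `T` from everything on which the observations and the
conditioning outputs depend, including the remaining quantization noises. -/
lemma measurePreserving_split_noise (D : Fin 2 → ℝ) (T : Finset (Fin 2)) :
    MeasurePreserving (fun t : (Fin M → ℂ) × ((k : Fin 2) → Matrix (Fin (N k)) (Fin M) ℂ) ×
      ((k : Fin 2) → Fin (N k) → ℂ) × (Fin 2 → Fin M → ℂ) =>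
        (((t.1, t.2.1, t.2.2.1), Tᶜ.restrict t.2.2.2), T.restrict t.2.2.2)) (systemLaw M N σ D)
      ((((complexGaussianVec M 1).prod ((channelLaw M N).prod
        (Measure.pi fun k => complexGaussianVec (N k) (σ ^ 2)))).prod
        (Measure.pi fun k : (Tᶜ : Finset (Fin 2)) => complexGaussianVec M (D k))).prod
          (Measure.pi fun k : T => complexGaussianVec M (D k))) := by
  have h1 := ((measurePreserving_prodAssoc (complexGaussianVec M 1) ((channelLaw M N).prod
    (Measure.pi fun k => complexGaussianVec (N k) (σ ^ 2)))
      (Measure.pi fun k => complexGaussianVec M (D k))).symm _).comp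
    ((MeasurePreserving.id (complexGaussianVec M 1)).prod
      ((measurePreserving_prodAssoc (channelLaw M N)
        (Measure.pi fun k => complexGaussianVec (N k) (σ ^ 2))
        (Measure.pi fun k => complexGaussianVec M (D k))).symm _))
  exact ((measurePreserving_prodAssoc _ _ _).symm _).comp (((MeasurePreserving.id _).prod
    (measurePreserving_restrict_compl (fun k => complexGaussianVec M (D k)) T)).comp h1)

/-- The mean diagonal entry of `Fᴴ H`. -/
def mmseGain (M N : ℕ) (σ : ℝ) : ℝ :=
  (min N M : ℕ) / (M : ℝ) * eigenMean M N σ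

lemma mmseGain_pos {N : ℕ} (hσ : 0 < σ) (hM : 0 < M) (hN : 0 < N) : 0 < mmseGain M N σ := by
  have h1 : (0 : ℝ) < (min N M : ℕ) := by exact_mod_cast lt_min hN hM
  have h2 : (0 : ℝ) < M := by exact_mod_cast hM
  exact mul_pos (div_pos h1 h2) (eigenMean_pos hσ hM hN)

lemma mmseGain_le_one {N : ℕ} (hσ : 0 < σ) (hM : 0 < M) (hN : 0 < N) : mmseGain M N σ ≤ 1 := by
  have h1 : ((min N M : ℕ) : ℝ) ≤ M := by exact_mod_cast min_le_right N M
  have h2 : (0 : ℝ) < M := by exact_mod_cast hM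
  exact mul_le_one₀ ((div_le_one h2).2 h1) (eigenMean_nonneg M N σ) (eigenMean_le_one hσ hM hN)

lemma quantNoise_pos {N : ℕ} {C : ℝ} (hσ : 0 < σ) (hM : 0 < M) (hN : 0 < N) (hC : 0 < C) :
    0 < quantNoise M N σ C := by
  have h2 : (0 : ℝ) < M := by exact_mod_cast hM
  exact div_pos (mmseGain_pos hσ hM hN)
    (sub_pos.2 (Real.one_lt_rpow one_lt_two (div_pos hC h2)))

/-- `D` is defined precisely so that `1 + a / D = 2 ^ (C / M)`. -/
lemma mul_logb_div_quantNoise {N : ℕ} {C : ℝ} (hσ : 0 < σ) (hM : 0 < M) (hN : 0 < N)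
    (hC : 0 < C) :
    M * Real.logb 2 ((mmseGain M N σ + quantNoise M N σ C) / quantNoise M N σ C) = C := by
  have h2 : (0 : ℝ) < M := by exact_mod_cast hM
  have h3 : (0 : ℝ) < 2 ^ (C / (M : ℝ)) - 1 :=
    sub_pos.2 (Real.one_lt_rpow one_lt_two (div_pos hC h2))
  have ha := mmseGain_pos hσ hM hN
  have h4 : (mmseGain M N σ + quantNoise M N σ C) / quantNoise M N σ C = 2 ^ (C / (M : ℝ)) := by
    have h5 : quantNoise M N σ C = mmseGain M N σ / (2 ^ (C / (M : ℝ)) - 1) := rfl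
    rw [h5]
    field_simp
    ring
  rw [h4, Real.logb_rpow two_pos (by norm_num)]
  field_simp

variable {Ω : Type*} [MeasurableSpace Ω] {μ : Measure Ω} {D : Fin 2 → ℝ}
  {x : Ω → Fin M → ℂ} {H : (k : Fin 2) → Ω → Matrix (Fin (N k)) (Fin M) ℂ}
  {n : (k : Fin 2) → Ω → Fin (N k) → ℂ} {q : Fin 2 → Ω → Fin M → ℂ}

lemma lintegral_norm_sq_output_sub
    (hlaw : HasLaw (fun ω => (x ω, (fun k => H k ω), (fun k => n k ω), (fun k => q k ω)))
      (systemLaw M N σ D) μ) (hσ : 0 < σ) (hD : ∀ k, 0 ≤ D k) (c : ℝ) (k : Fin 2) (i : Fin M) :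
    ∫⁻ ω, ENNReal.ofReal (‖relayOut σ (H k ω) (x ω) (n k ω) (q k ω) i - c * x ω i‖ ^ 2) ∂μ =
      ENNReal.ofReal ((1 - 2 * c) * mmseGain M (N k) σ + c ^ 2 + D k) := by
  have h1 := (measurePreserving_relay (M := M) (N := N) (σ := σ) D k).fun_comp_hasLaw hlaw
  have h2 : Measurable fun t : (Fin M → ℂ) × Matrix (Fin (N k)) (Fin M) ℂ × (Fin (N k) → ℂ) ×
      (Fin M → ℂ) => relayOut σ t.2.1 t.1 t.2.2.1 t.2.2.2 i :=
    (measurable_pi_apply i).comp (measurable_relayOut hσ (measurable_fst.comp measurable_snd)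
      (by fun_prop) (by fun_prop) (by fun_prop))
  have h3 : Measurable fun t : (Fin M → ℂ) × Matrix (Fin (N k)) (Fin M) ℂ × (Fin (N k) → ℂ) ×
      (Fin M → ℂ) => ENNReal.ofReal
        (‖relayOut σ t.2.1 t.1 t.2.2.1 t.2.2.2 i - c * t.1 i‖ ^ 2) := by fun_prop
  rw [mmseGain, ← lintegral_norm_sq_relayOut_sub hσ (hD k) c i]
  exact h1.lintegral_comp h3.aemeasurable

lemma lintegral_norm_sq_noise
    (hlaw : HasLaw (fun ω => (x ω, (fun k => H k ω), (fun k => n k ω), (fun k => q k ω)))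
      (systemLaw M N σ D) μ) (hD : ∀ k, 0 ≤ D k) (k : Fin 2) (i : Fin M) :
    ∫⁻ ω, ENNReal.ofReal (‖q k ω i‖ ^ 2) ∂μ = ENNReal.ofReal (D k) := by
  have h1 := (measurePreserving_relay (M := M) (N := N) (σ := σ) D k).fun_comp_hasLaw hlaw
  have h2 := ((((measurePreserving_eval (fun _ : Fin M => complexGaussian (D k)) i).comp
    (measurePreserving_snd (μ := complexGaussianVec (N k) (σ ^ 2)))).comp
    (measurePreserving_snd (μ := rayleighLaw (N k) M))).comp
    (measurePreserving_snd (μ := complexGaussianVec M 1))).comp_hasLaw h1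
  rw [← lintegral_norm_sq_complexGaussian (hD k)]
  exact h2.lintegral_comp (f := fun z : ℂ => ENNReal.ofReal (‖z‖ ^ 2)) (by fun_prop)

/-- The bottleneck constraint, for any observation that determines the estimates. -/
lemma condMutualInfo_output_le [IsProbabilityMeasure μ] {C : Fin 2 → ℝ}
    (hlaw : HasLaw (fun ω => (x ω, (fun k => H k ω), (fun k => n k ω), (fun k => q k ω)))
      (systemLaw M N σ D) μ) (hσ : 0 < σ) (hM : 0 < M) (hN : ∀ k, 0 < N k) (hC : ∀ k, 0 < C k)
    (hD : ∀ k, D k = quantNoise M (N k) σ (C k)) (T : Finset (Fin 2)) {α : Type*}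
    [MeasurableSpace α] [StandardBorelSpace α] [Nonempty α]
    {φ : (Fin M → ℂ) × ((k : Fin 2) → Matrix (Fin (N k)) (Fin M) ℂ) ×
      ((k : Fin 2) → Fin (N k) → ℂ) → α} (hφ : Measurable φ)
    {m : α → T → Fin M → ℂ} (hm : Measurable m)
    (hmφ : ∀ p, ∀ k : T, m (φ p) k = (mmseF σ (p.2.1 k))ᴴ *ᵥ (p.2.1 k *ᵥ p.1 + p.2.2 k)) :
    condMutualInfo (fun ω => φ (x ω, (fun k => H k ω), fun k => n k ω))
      (fun ω (k : T) => relayOut σ (H k ω) (x ω) (n k ω) (q k ω))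
      (fun ω (k : (Tᶜ : Finset (Fin 2))) => relayOut σ (H k ω) (x ω) (n k ω) (q k ω)) μ ≤
        ENNReal.ofReal (∑ k ∈ T, C k) := by
  have hDpos : ∀ k, 0 < D k := fun k => hD k ▸ quantNoise_pos hσ hM (hN k) (hC k)
  have hsplit := (measurePreserving_split_noise (M := M) (N := N) (σ := σ) D T).fun_comp_hasLaw hlaw
  have hU := hsplit.aemeasurable.fst
  have hr := hsplit.aemeasurable.snd
  have hG : Measurable fun (u : ((Fin M → ℂ) × ((k : Fin 2) → Matrix (Fin (N k)) (Fin M) ℂ) ×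
      ((k : Fin 2) → Fin (N k) → ℂ)) × ((Tᶜ : Finset (Fin 2)) → Fin M → ℂ))
      (k : (Tᶜ : Finset (Fin 2))) => relayOut σ (u.1.2.1 k) u.1.1 (u.1.2.2 k) (u.2 k) :=
    measurable_pi_lambda _ fun k => measurable_relayOut hσ
      ((measurable_pi_apply (k : Fin 2)).comp (measurable_fst.comp (measurable_snd.comp
        measurable_fst))) (by fun_prop) (by fun_prop) (by fun_prop)
  have hA : Measurable fun u : ((Fin M → ℂ) × ((k : Fin 2) → Matrix (Fin (N k)) (Fin M) ℂ) ×
      ((k : Fin 2) → Fin (N k) → ℂ)) × ((Tᶜ : Finset (Fin 2)) → Fin M → ℂ) => φ u.1 :=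
    hφ.comp measurable_fst
  have hprod := map_prodMk_comp_eq_prod hU hr hsplit.map_eq (hG.prodMk hA)
  refine (condMutualInfo_le_of_additive_noise μ
    (r := fun ω (k : T) => q k ω) (m := m) (D := fun k : T => D k)
    (v := fun k : T => mmseGain M (N k) σ + D k) (hA.comp_aemeasurable hU)
    (hG.comp_aemeasurable hU) hr hm (fun ω => ?_) (fun k => hDpos k)
    (fun k => add_pos (mmseGain_pos hσ hM (hN k)) (hDpos k)) hprod
    (fun k i => lintegral_norm_sq_noise hlaw (fun k => (hDpos k).le) k i)
    fun k i => ?_).trans (le_of_eq ?_)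
  · funext k
    exact congrArg (· + q k ω) (hmφ (x ω, (fun k => H k ω), fun k => n k ω) k).symm
  -- With `c = 0`, the formula gives the output power `a + D`.
  · have h := lintegral_norm_sq_output_sub hlaw hσ (fun k => (hDpos k).le) 0 k i
    simpa using h
  · rw [← Finset.sum_coe_sort T]
    congr 1
    exact Finset.sum_congr rfl fun k _ => by
      rw [hD]; exact mul_logb_div_quantNoise hσ hM (hN k) (hC k)

end System

/-! ### Mean log-density of the outputs given the channels -/

section Rate

open ComplexOrder MatrixOrder

variable {M : ℕ} {N : Fin 2 → ℕ} {σ : ℝ} {Ω : Type*} [MeasurableSpace Ω] {μ : Measure Ω}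
  {D : Fin 2 → ℝ} {x : Ω → Fin M → ℂ}
  {H : (k : Fin 2) → Ω → Matrix (Fin (N k)) (Fin M) ℂ}
  {n : (k : Fin 2) → Ω → Fin (N k) → ℂ} {q : Fin 2 → Ω → Fin M → ℂ}

lemma quadratic_nonneg (hD : ∀ k, 0 < D k) (G : (k : Fin 2) → Matrix (Fin (N k)) (Fin M) ℂ)
    (z : Fin M ⊕ Fin M → ℂ) : 0 ≤ (star z ⬝ᵥ (covBlock σ D G)⁻¹ *ᵥ z).re := by
  obtain ⟨A, hA, -⟩ := exists_eq_mul_conjTranspose (covBlock_posDef (σ := σ) hD G)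
  rw [hA, ← sum_norm_sq_inv_mulVec]
  exact Finset.sum_nonneg fun _ _ => sq_nonneg _

/-- The relay that produces a given coordinate of the stacked outputs. -/
def relayIndex : Fin M ⊕ Fin M → Fin 2 :=
  Sum.elim (fun _ => 0) fun _ => 1

/-- The coordinate of the input estimated by a given coordinate of the stacked outputs. -/
def inputIndex : Fin M ⊕ Fin M → Fin M :=
  Sum.elim id id

lemma pairOut_apply (G : (k : Fin 2) → Matrix (Fin (N k)) (Fin M) ℂ)
    (r : (Fin M → ℂ) × ((k : Fin 2) → Fin (N k) → ℂ) × (Fin 2 → Fin M → ℂ)) (s : Fin M ⊕ Fin M) :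
    pairOut σ G r s = relayOut σ (G (relayIndex s)) r.1 (r.2.1 (relayIndex s))
      (r.2.2 (relayIndex s)) (inputIndex s) := by
  rcases s with i | i <;> rfl

lemma hasLaw_channel_noise
    (hlaw : HasLaw (fun ω => (x ω, (fun k => H k ω), (fun k => n k ω), (fun k => q k ω)))
      (systemLaw M N σ D) μ) :
    HasLaw (fun ω => ((fun k => H k ω), (x ω, (fun k => n k ω), (fun k => q k ω))))
      ((channelLaw M N).prod (noiseLaw M N σ D)) μ :=
  (measurePreserving_prod_left_comm (complexGaussianVec M 1) (channelLaw M N)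
    ((Measure.pi fun k => complexGaussianVec (N k) (σ ^ 2)).prod
      (Measure.pi fun k => complexGaussianVec M (D k)))).fun_comp_hasLaw hlaw

lemma map_channel_pairOut
    (hlaw : HasLaw (fun ω => (x ω, (fun k => H k ω), (fun k => n k ω), (fun k => q k ω)))
      (systemLaw M N σ D) μ) (hσ : 0 < σ) (hD : ∀ k, 0 < D k) :
    μ.map (fun ω => ((fun k => H k ω),
      pairOut σ (fun k => H k ω) (x ω, (fun k => n k ω), (fun k => q k ω)))) =
      ((channelLaw M N).prod (stdComplexGaussian (Fin M ⊕ Fin M))).withDensity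
        fun p => ENNReal.ofReal (Real.exp (outputLogDensity σ D p)) := by
  have h := hasLaw_channel_noise hlaw
  have hm := measurable_outputLogDensity (M := M) (N := N) hσ hD
  have hp := measurable_pairOut (M := M) (N := N) hσ
  have h1 := map_prodMk_eq_withDensity (P := channelLaw M N) (ν := noiseLaw M N σ D)
    (Q := stdComplexGaussian (Fin M ⊕ Fin M)) (φ := fun p => pairOut σ p.1 p.2) hp
    (f := fun p => ENNReal.ofReal (Real.exp (outputLogDensity σ D p))) (by fun_prop)
    fun G => map_pairOut_eq_withDensity hσ hD G
  rw [← h1, ← h.map_eq,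
    AEMeasurable.map_map_of_aemeasurable (measurable_fst.prodMk hp).aemeasurable h.aemeasurable]
  rfl

lemma aemeasurable_channel_pairOut
    (hlaw : HasLaw (fun ω => (x ω, (fun k => H k ω), (fun k => n k ω), (fun k => q k ω)))
      (systemLaw M N σ D) μ) (hσ : 0 < σ) :
    AEMeasurable (fun ω => pairOut σ (fun k => H k ω)
      (x ω, (fun k => n k ω), (fun k => q k ω))) μ := by
  have h := (measurable_pairOut (M := M) (N := N) hσ).comp_aemeasurable
    (hasLaw_channel_noise hlaw).aemeasurable
  exact h

lemma integral_norm_sq_pairOut_sub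
    (hlaw : HasLaw (fun ω => (x ω, (fun k => H k ω), (fun k => n k ω), (fun k => q k ω)))
      (systemLaw M N σ D) μ) (hσ : 0 < σ) (hD : ∀ k, 0 < D k) (c : ℝ) (s : Fin M ⊕ Fin M)
    (hc : 0 ≤ (1 - 2 * c) * mmseGain M (N (relayIndex s)) σ + c ^ 2 + D (relayIndex s)) :
    Integrable (fun ω => ‖pairOut σ (fun k => H k ω) (x ω, (fun k => n k ω), (fun k => q k ω)) s
      - c * x ω (inputIndex s)‖ ^ 2) μ ∧
    ∫ ω, ‖pairOut σ (fun k => H k ω) (x ω, (fun k => n k ω), (fun k => q k ω)) s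
      - c * x ω (inputIndex s)‖ ^ 2 ∂μ =
        (1 - 2 * c) * mmseGain M (N (relayIndex s)) σ + c ^ 2 + D (relayIndex s) := by
  have h1 := aemeasurable_channel_pairOut hlaw hσ
  have h2 : AEMeasurable x μ := hlaw.aemeasurable.fst
  refine integrable_and_integral_eq_of_lintegral (by fun_prop) (fun _ => sq_nonneg _) hc ?_
  rw [← lintegral_norm_sq_output_sub hlaw hσ (fun k => (hD k).le) c (relayIndex s) (inputIndex s)]
  simp only [pairOut_apply]

lemma integral_norm_sq_pairOut
    (hlaw : HasLaw (fun ω => (x ω, (fun k => H k ω), (fun k => n k ω), (fun k => q k ω)))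
      (systemLaw M N σ D) μ) (hσ : 0 < σ) (hM : 0 < M) (hN : ∀ k, 0 < N k) (hD : ∀ k, 0 < D k)
    (s : Fin M ⊕ Fin M) :
    Integrable (fun ω =>
      ‖pairOut σ (fun k => H k ω) (x ω, (fun k => n k ω), (fun k => q k ω)) s‖ ^ 2) μ ∧
    ∫ ω, ‖pairOut σ (fun k => H k ω) (x ω, (fun k => n k ω), (fun k => q k ω)) s‖ ^ 2 ∂μ =
        mmseGain M (N (relayIndex s)) σ + D (relayIndex s) := by
  have h := integral_norm_sq_pairOut_sub hlaw hσ hD 0 s (by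
    have := mmseGain_pos hσ hM (hN (relayIndex s))
    have := hD (relayIndex s)
    norm_num
    linarith)
  simpa using h

lemma measurable_comp_prodMk {α β γ δ : Type*} [MeasurableSpace α] [MeasurableSpace β]
    [MeasurableSpace γ] [MeasurableSpace δ] {g : α × β → δ} (hg : Measurable g) {f : α × γ → β}
    (hf : Measurable f) : Measurable fun p => g (p.1, f p) :=
  hg.comp (measurable_fst.prodMk hf)

/-- The three terms are the log-determinant, the quadratic form, whose mean is the dimension `2M` at
every channel, and the total output power. -/
lemma integral_outputLogDensity
    (hlaw : HasLaw (fun ω => (x ω, (fun k => H k ω), (fun k => n k ω), (fun k => q k ω)))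
      (systemLaw M N σ D) μ) (hσ : 0 < σ) (hM : 0 < M) (hN : ∀ k, 0 < N k) (hD : ∀ k, 0 < D k) :
    Integrable (fun ω => outputLogDensity σ D ((fun k => H k ω),
      pairOut σ (fun k => H k ω) (x ω, (fun k => n k ω), (fun k => q k ω)))) μ ∧
    ∫ ω, outputLogDensity σ D ((fun k => H k ω),
      pairOut σ (fun k => H k ω) (x ω, (fun k => n k ω), (fun k => q k ω))) ∂μ =
      -(Real.log 2 * ∫ G, logDetCov σ D G ∂(channelLaw M N)) - Fintype.card (Fin M ⊕ Fin M)
        + ∑ s : Fin M ⊕ Fin M, (mmseGain M (N (relayIndex s)) σ + D (relayIndex s)) := by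
  have h := hasLaw_channel_noise hlaw
  have hch : HasLaw (fun ω k => H k ω) (channelLaw M N) μ :=
    (measurePreserving_fst (μ := channelLaw M N) (ν := noiseLaw M N σ D)).fun_comp_hasLaw h
  have hlog : ∀ G : (k : Fin 2) → Matrix (Fin (N k)) (Fin M) ℂ,
      Real.log (covBlock σ D G).det.re = Real.log 2 * logDetCov σ D G := fun G => by
    rw [logDetCov, Real.logb, mul_div_cancel₀ _ (Real.log_pos one_lt_two).ne']
  have hdet := integrable_logDetCov (M := M) (N := N) hσ hD
  have i1 : Integrable (fun ω => logDetCov σ D fun k => H k ω) μ := by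
    rw [← hch.map_eq] at hdet
    exact hdet.comp_aemeasurable hch.aemeasurable
  have e1 : ∫ ω, logDetCov σ D (fun k => H k ω) ∂μ = ∫ G, logDetCov σ D G ∂(channelLaw M N) :=
    hch.integral_comp hdet.aestronglyMeasurable
  have hq := measurable_quadratic (M := M) (N := N) hσ hD
  have hp := measurable_pairOut (M := M) (N := N) hσ
  have hqp := measurable_comp_prodMk hq hp
  have hqp' := hqp.comp_aemeasurable h.aemeasurable
  have hlq := h.lintegral_comp hqp.ennreal_ofReal.aemeasurable
  rw [lintegral_prod _ hqp.ennreal_ofReal.aemeasurable,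
    lintegral_congr fun G => lintegral_quadratic hσ hD G, lintegral_const, measure_univ,
    mul_one] at hlq
  obtain ⟨i2, e2⟩ := integrable_and_integral_eq_of_lintegral
    (f := fun ω => (star (pairOut σ (fun k => H k ω) (x ω, (fun k => n k ω), fun k => q k ω)) ⬝ᵥ
      (covBlock σ D fun k => H k ω)⁻¹ *ᵥ
        pairOut σ (fun k => H k ω) (x ω, (fun k => n k ω), fun k => q k ω)).re)
    hqp' (fun ω => quadratic_nonneg hD _ _)
    (Nat.cast_nonneg (Fintype.card (Fin M ⊕ Fin M))) hlq
  have h3 := integral_norm_sq_pairOut hlaw hσ hM hN hD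
  have i3 := integrable_finsetSum Finset.univ fun s _ => (h3 s).1
  unfold outputLogDensity
  simp only [hlog]
  have i4 := ((i1.const_mul (Real.log 2)).neg).sub i2
  refine ⟨i4.add i3, ?_⟩
  refine (integral_add i4 i3).trans ?_
  rw [integral_finsetSum _ fun s _ => (h3 s).1, Finset.sum_congr rfl fun s _ => (h3 s).2]
  congr 1
  refine (integral_sub (i1.const_mul (Real.log 2)).neg i2).trans ?_
  rw [e2, ← e1, ← integral_const_mul, ← integral_neg]
  rfl

end Rate

/-! ### The Gaussian test channel and the rate bound -/

section RateBound

variable {M : ℕ} {N : Fin 2 → ℕ} {σ : ℝ} {Ω : Type*} [MeasurableSpace Ω] {μ : Measure Ω}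
  {D : Fin 2 → ℝ} {x : Ω → Fin M → ℂ} {H : (k : Fin 2) → Ω → Matrix (Fin (N k)) (Fin M) ℂ}
  {n : (k : Fin 2) → Ω → Fin (N k) → ℂ} {q : Fin 2 → Ω → Fin M → ℂ}

/-- The variance of the error `z - a x` of a relay output about the scaled input. -/
def outputVar (M N : ℕ) (σ D : ℝ) : ℝ :=
  mmseGain M N σ - mmseGain M N σ ^ 2 + D

lemma outputVar_pos {N : ℕ} {D : ℝ} (hσ : 0 < σ) (hM : 0 < M) (hN : 0 < N) (hD : 0 < D) :
    0 < outputVar M N σ D := by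
  have h0 := mmseGain_pos hσ hM hN
  have h1 := mmseGain_le_one hσ hM hN
  rw [outputVar]
  nlinarith

/-- The logarithm of the density, relative to `CN(0, I)`, of the test channel which adds Gaussian
noise to the scaled input. -/
def testLogDensity (σ : ℝ) (N : Fin 2 → ℕ) (D : Fin 2 → ℝ)
    (p : (Fin M → ℂ) × (Fin M ⊕ Fin M → ℂ)) : ℝ :=
  ∑ s, logRatio (outputVar M (N (relayIndex s)) σ (D (relayIndex s))) 1
    (mmseGain M (N (relayIndex s)) σ * p.1 (inputIndex s)) (p.2 s)

lemma measurable_testLogDensity : Measurable (testLogDensity (M := M) σ N D) := by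
  unfold testLogDensity logRatio
  fun_prop

lemma isProbabilityMeasure_testChannel (hσ : 0 < σ) (hM : 0 < M) (hN : ∀ k, 0 < N k)
    (hD : ∀ k, 0 < D k) (a : Fin M → ℂ) :
    IsProbabilityMeasure ((stdComplexGaussian (Fin M ⊕ Fin M)).withDensity fun z =>
      ENNReal.ofReal (Real.exp (testLogDensity σ N D (a, z)))) := by
  have h := map_add_pi_complexGaussian (ι := Fin M ⊕ Fin M) (v := fun _ => 1)
    (fun s => outputVar_pos hσ hM (hN (relayIndex s)) (hD (relayIndex s)))
    (fun _ => zero_lt_one) fun s => mmseGain M (N (relayIndex s)) σ * a (inputIndex s)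
  unfold testLogDensity stdComplexGaussian
  rw [← h]
  exact Measure.isProbabilityMeasure_map (by fun_prop)

lemma integral_testLogDensity [IsProbabilityMeasure μ]
    (hlaw : HasLaw (fun ω => (x ω, (fun k => H k ω), (fun k => n k ω), (fun k => q k ω)))
      (systemLaw M N σ D) μ) (hσ : 0 < σ) (hM : 0 < M) (hN : ∀ k, 0 < N k) (hD : ∀ k, 0 < D k) :
    Integrable (fun ω => testLogDensity σ N D (x ω,
      pairOut σ (fun k => H k ω) (x ω, (fun k => n k ω), (fun k => q k ω)))) μ ∧
    ∫ ω, testLogDensity σ N D (x ω,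
      pairOut σ (fun k => H k ω) (x ω, (fun k => n k ω), (fun k => q k ω))) ∂μ =
      ∑ s : Fin M ⊕ Fin M, (-Real.log (outputVar M (N (relayIndex s)) σ (D (relayIndex s))) - 1 +
        (mmseGain M (N (relayIndex s)) σ + D (relayIndex s))) := by
  have hg : ∀ s : Fin M ⊕ Fin M, 0 < outputVar M (N (relayIndex s)) σ (D (relayIndex s)) :=
    fun s => outputVar_pos hσ hM (hN _) (hD _)
  -- At `c = a` the mean square error is exactly the variance of the test channel, so each
  -- normalized error term has mean 1.
  have hgeq : ∀ s : Fin M ⊕ Fin M, (1 - 2 * mmseGain M (N (relayIndex s)) σ) *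
      mmseGain M (N (relayIndex s)) σ + mmseGain M (N (relayIndex s)) σ ^ 2 + D (relayIndex s) =
        outputVar M (N (relayIndex s)) σ (D (relayIndex s)) := fun s => by
    rw [outputVar]; ring
  have h1 := fun s => integral_norm_sq_pairOut_sub hlaw hσ hD
    (mmseGain M (N (relayIndex s)) σ) s (by rw [hgeq]; exact (hg s).le)
  have h2 := integral_norm_sq_pairOut hlaw hσ hM hN hD
  have hterm : ∀ s, Integrable (fun ω => logRatio
      (outputVar M (N (relayIndex s)) σ (D (relayIndex s))) 1
      (mmseGain M (N (relayIndex s)) σ * x ω (inputIndex s))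
      (pairOut σ (fun k => H k ω) (x ω, (fun k => n k ω), (fun k => q k ω)) s)) μ ∧
      ∫ ω, logRatio (outputVar M (N (relayIndex s)) σ (D (relayIndex s))) 1
      (mmseGain M (N (relayIndex s)) σ * x ω (inputIndex s))
      (pairOut σ (fun k => H k ω) (x ω, (fun k => n k ω), (fun k => q k ω)) s) ∂μ =
      -Real.log (outputVar M (N (relayIndex s)) σ (D (relayIndex s))) - 1 +
        (mmseGain M (N (relayIndex s)) σ + D (relayIndex s)) := fun s => by
    have i1 := (h1 s).1.div_const (outputVar M (N (relayIndex s)) σ (D (relayIndex s)))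
    have i2 := (h2 s).1.div_const 1
    have i0 : Integrable (fun _ : Ω => Real.log
      (1 / outputVar M (N (relayIndex s)) σ (D (relayIndex s)))) μ := integrable_const _
    refine ⟨(i0.sub i1).add i2, ?_⟩
    refine (integral_add (i0.sub i1) i2).trans ?_
    refine (congrArg (· + _) (integral_sub i0 i1)).trans ?_
    rw [integral_div, integral_div, (h1 s).2, (h2 s).2, hgeq, div_self (hg s).ne',
      integral_const, probReal_univ, one_smul, one_div, Real.log_inv, div_one]
  unfold testLogDensity
  refine ⟨integrable_finsetSum _ fun s _ => (hterm s).1, ?_⟩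
  rw [integral_finsetSum _ fun s _ => (hterm s).1]
  exact Finset.sum_congr rfl fun s _ => (hterm s).2

/-- Subtracting the two mean log-densities cancels the output powers, and the `-1` per coordinate of
the test channel cancels the `-2M` of the quadratic form. -/
lemma ofReal_rate_le_klDiv [IsProbabilityMeasure μ]
    (hlaw : HasLaw (fun ω => (x ω, (fun k => H k ω), (fun k => n k ω), (fun k => q k ω)))
      (systemLaw M N σ D) μ) (hσ : 0 < σ) (hM : 0 < M) (hN : ∀ k, 0 < N k) (hD : ∀ k, 0 < D k) :
    ENNReal.ofReal (Real.log 2 * ∫ G, logDetCov σ D G ∂(channelLaw M N) -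
      M * ∑ k, Real.log (outputVar M (N k) σ (D k))) ≤
    InformationTheory.klDiv (μ.map fun ω => (x ω,
        pairOut σ (fun k => H k ω) (x ω, (fun k => n k ω), (fun k => q k ω))))
      ((μ.map x).prod (μ.map fun ω =>
        pairOut σ (fun k => H k ω) (x ω, (fun k => n k ω), (fun k => q k ω)))) := by
  obtain ⟨i1, e1⟩ := integral_testLogDensity hlaw hσ hM hN hD
  obtain ⟨i2, e2⟩ := integral_outputLogDensity hlaw hσ hM hN hD
  have hch : HasLaw (fun ω k => H k ω) (channelLaw M N) μ :=
    (measurePreserving_fst (μ := channelLaw M N) (ν := noiseLaw M N σ D)).fun_comp_hasLaw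
      (hasLaw_channel_noise hlaw)
  have hdens := map_channel_pairOut hlaw hσ hD
  rw [← hch.map_eq] at hdens
  have h := ofReal_sub_le_klDiv μ hlaw.aemeasurable.fst hch.aemeasurable
    (aemeasurable_channel_pairOut hlaw hσ) (stdComplexGaussian (Fin M ⊕ Fin M))
    measurable_testLogDensity (measurable_outputLogDensity hσ hD)
    (isProbabilityMeasure_testChannel hσ hM hN hD) hdens i1 i2
  rw [e1, e2] at h
  refine le_trans (le_of_eq (congrArg ENNReal.ofReal ?_)) h
  simp only [Finset.sum_add_distrib, Finset.sum_sub_distrib, Fintype.sum_sum_type, relayIndex,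
    Sum.elim_inl, Sum.elim_inr, Finset.sum_const, Finset.card_univ, Fintype.card_sum,
    Fintype.card_fin, Fin.sum_univ_two, nsmul_eq_mul, Nat.cast_add]
  ring

lemma rateLB_eq {C : Fin 2 → ℝ} (hσ : 0 < σ) :
    rateLB M N σ C = (Real.log 2 * ∫ G, logDetCov σ (fun k => quantNoise M (N k) σ (C k)) G
      ∂(channelLaw M N) - M * ∑ k, Real.log (outputVar M (N k) σ (quantNoise M (N k) σ (C k)))) /
        Real.log 2 := by
  have hlog : Real.log 2 ≠ 0 := (Real.log_pos one_lt_two).ne'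
  have h : ∀ k, Real.logb 2 (matG M (N k) σ (quantNoise M (N k) σ (C k))).det.re =
      M * Real.log (outputVar M (N k) σ (quantNoise M (N k) σ (C k))) / Real.log 2 := fun k => by
    -- `matG` is the scalar matrix of `outputVar`, so its determinant is the `M`-th power.
    rw [matG_eq hσ, ← mul_pow, det_smul, det_one, mul_one, Fintype.card_fin, ← Complex.ofReal_pow,
      Complex.ofReal_re, Real.logb, Real.log_pow]
    rfl
  rw [rateLB, sub_div, mul_div_cancel_left₀ _ hlog, Finset.mul_sum, Finset.sum_div]
  simp only [h]

lemma rateLB_le_mutualInfo [IsProbabilityMeasure μ] {C : Fin 2 → ℝ}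
    (hlaw : HasLaw (fun ω => (x ω, (fun k => H k ω), (fun k => n k ω), (fun k => q k ω)))
      (systemLaw M N σ D) μ) (hσ : 0 < σ) (hM : 0 < M) (hN : ∀ k, 0 < N k) (hC : ∀ k, 0 < C k)
    (hD : ∀ k, D k = quantNoise M (N k) σ (C k)) :
    ((rateLB M N σ C : ℝ) : EReal) ≤ ((mutualInfo x
      (fun ω k => relayOut σ (H k ω) (x ω) (n k ω) (q k ω)) μ : ℝ≥0∞) : EReal) := by
  have hlog : 0 < Real.log 2 := Real.log_pos one_lt_two
  have hDpos : ∀ k, 0 < D k := fun k => hD k ▸ quantNoise_pos hσ hM (hN k) (hC k)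
  have hx : AEMeasurable x μ := hlaw.aemeasurable.fst
  have hZ : AEMeasurable (fun ω k => relayOut σ (H k ω) (x ω) (n k ω) (q k ω)) μ := by
    have h := aemeasurable_channel_pairOut hlaw hσ
    refine aemeasurable_pi_lambda _ fun k => aemeasurable_pi_lambda _ fun i => ?_
    fin_cases k
    · exact (measurable_pi_apply (Sum.inl i)).comp_aemeasurable h
    · exact (measurable_pi_apply (Sum.inr i)).comp_aemeasurable h
  let g : (Fin 2 → Fin M → ℂ) → (Fin M ⊕ Fin M → ℂ) := fun z => Sum.elim (z 0) (z 1)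
  have hg : Measurable g := measurable_pi_lambda _ fun s => by
    rcases s with i | i
    · exact (measurable_pi_apply i).comp (measurable_pi_apply 0)
    · exact (measurable_pi_apply i).comp (measurable_pi_apply 1)
  have := Measure.isProbabilityMeasure_map hx
  have := Measure.isProbabilityMeasure_map hZ
  have := Measure.isProbabilityMeasure_map (hx.prodMk hZ)
  -- Data processing carries the bound from the stacked vector back to the family indexed by relays.
  have hle := InformationTheory.klDiv_map_le
    (μ.map fun ω => (x ω, fun k => relayOut σ (H k ω) (x ω) (n k ω) (q k ω)))
    ((μ.map x).prod (μ.map fun ω k => relayOut σ (H k ω) (x ω) (n k ω) (q k ω)))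
    (measurable_id.prodMap hg)
  rw [← Measure.map_prod_map _ _ measurable_id hg, Measure.map_id,
    AEMeasurable.map_map_of_aemeasurable (measurable_id.prodMap hg).aemeasurable (hx.prodMk hZ),
    AEMeasurable.map_map_of_aemeasurable hg.aemeasurable hZ] at hle
  have h := (ofReal_rate_le_klDiv hlaw hσ hM hN hDpos).trans hle
  have h2 : ENNReal.ofReal (rateLB M N σ C) ≤ mutualInfo x
      (fun ω k => relayOut σ (H k ω) (x ω) (n k ω) (q k ω)) μ := by
    rw [rateLB_eq hσ, ← funext hD, ENNReal.ofReal_div_of_pos hlog, mutualInfo]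
    refine ENNReal.div_le_div_right (le_trans (le_of_eq ?_) h) _
    simp only [hD]
  refine le_trans ?_ (EReal.coe_ennreal_le_coe_ennreal_iff.2 h2)
  -- `ENNReal.ofReal` truncates at zero, which only increases the left side.
  rw [EReal.coe_ennreal_ofReal]
  exact EReal.coe_le_coe_iff.2 (le_max_left _ _)

end RateBound

/-! ### Measurability of observations and estimates -/

section Observations

variable {M : ℕ} {N : Fin 2 → ℕ} {σ : ℝ}

lemma measurable_mulVec {α : Type*} [MeasurableSpace α] {m n : Type*} [Fintype n]
    {A : α → Matrix m n ℂ} (hA : ∀ i j, Measurable fun a => A a i j) {v : α → n → ℂ}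
    (hv : Measurable v) : Measurable fun a => A a *ᵥ v a := by
  refine measurable_pi_lambda _ fun i => ?_
  simp only [Matrix.mulVec, dotProduct]
  fun_prop

lemma measurable_entry {α : Type*} [MeasurableSpace α] {m n : ℕ}
    {A : α → Matrix (Fin m) (Fin n) ℂ} (hA : Measurable A) (i : Fin m) (j : Fin n) :
    Measurable fun a => A a i j :=
  (measurable_pi_apply j).comp ((measurable_pi_apply i).comp hA)

lemma measurable_mmseF_entry (hσ : 0 < σ) {α : Type*} [MeasurableSpace α] {n : ℕ}
    {A : α → Matrix (Fin n) (Fin M) ℂ} (hA : Measurable A) (i : Fin M) (j : Fin n) :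
    Measurable fun a => (mmseF σ (A a))ᴴ i j :=
  Complex.continuous_conj.measurable.comp (measurable_entry ((continuous_mmseF hσ).measurable.comp hA) j i)

lemma measurable_received (k : Fin 2) :
    Measurable fun p : (Fin M → ℂ) × ((k : Fin 2) → Matrix (Fin (N k)) (Fin M) ℂ) ×
      ((k : Fin 2) → Fin (N k) → ℂ) => p.2.1 k *ᵥ p.1 + p.2.2 k := by
  have h : Measurable fun p : (Fin M → ℂ) × ((k : Fin 2) → Matrix (Fin (N k)) (Fin M) ℂ) ×
      ((k : Fin 2) → Fin (N k) → ℂ) => p.2.1 k := by fun_prop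
  have h1 := measurable_mulVec (measurable_entry h) measurable_fst
  exact h1.add (by fun_prop)

lemma measurable_observation (T : Finset (Fin 2)) :
    Measurable fun (p : (Fin M → ℂ) × ((k : Fin 2) → Matrix (Fin (N k)) (Fin M) ℂ) ×
      ((k : Fin 2) → Fin (N k) → ℂ)) (k : T) => (p.2.1 k *ᵥ p.1 + p.2.2 k, p.2.1 k) := by
  refine measurable_pi_lambda _ fun k => (measurable_received (k : Fin 2)).prodMk ?_
  fun_prop

lemma measurable_estimate_of_observation (hσ : 0 < σ) (T : Finset (Fin 2)) :
    Measurable fun (a : (k : T) → (Fin (N k) → ℂ) × Matrix (Fin (N k)) (Fin M) ℂ) (k : T) =>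
      (mmseF σ (a k).2)ᴴ *ᵥ (a k).1 := by
  refine measurable_pi_lambda _ fun k => ?_
  have h : Measurable fun a : (k : T) → (Fin (N k) → ℂ) × Matrix (Fin (N k)) (Fin M) ℂ =>
    (a k).2 := by fun_prop
  exact measurable_mulVec (measurable_mmseF_entry hσ h) (by fun_prop)

lemma measurable_estimate (hσ : 0 < σ) (T : Finset (Fin 2)) :
    Measurable fun (p : (Fin M → ℂ) × ((k : Fin 2) → Matrix (Fin (N k)) (Fin M) ℂ) ×
      ((k : Fin 2) → Fin (N k) → ℂ)) (k : T) =>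
        (mmseF σ (p.2.1 k))ᴴ *ᵥ (p.2.1 k *ᵥ p.1 + p.2.2 k) := by
  refine measurable_pi_lambda _ fun k => ?_
  have h : Measurable fun p : (Fin M → ℂ) × ((k : Fin 2) → Matrix (Fin (N k)) (Fin M) ℂ) ×
      ((k : Fin 2) → Fin (N k) → ℂ) => p.2.1 (k : Fin 2) := by fun_prop
  exact measurable_mulVec (measurable_mmseF_entry hσ h) (measurable_received (k : Fin 2))

end Observations

end Diamond

end

/-! ### Constraints and rate for the relay scheme -/

theorem mainTheorem3 {Ω : Type*} [MeasurableSpace Ω] (μ : Measure Ω) [IsProbabilityMeasure μ]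
    {M : ℕ} (hM : 0 < M) {N : Fin 2 → ℕ} (hN : ∀ k, 0 < N k)
    {σ : ℝ} (hσ : 0 < σ) {C : Fin 2 → ℝ} (hC : ∀ k, 0 < C k)
    (D : Fin 2 → ℝ) (hD : ∀ k, D k = Diamond.quantNoise M (N k) σ (C k))
    (x : Ω → Fin M → ℂ) (H : (k : Fin 2) → Ω → Matrix (Fin (N k)) (Fin M) ℂ)
    (n : (k : Fin 2) → Ω → Fin (N k) → ℂ) (q : Fin 2 → Ω → Fin M → ℂ)
    (hlaw : HasLaw (fun ω => (x ω, (fun k => H k ω), (fun k => n k ω), (fun k => q k ω)))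
      (Diamond.systemLaw M N σ D) μ)
    (y : (k : Fin 2) → Ω → Fin (N k) → ℂ) (hy : ∀ k ω, y k ω = H k ω *ᵥ x ω + n k ω)
    (xbar : Fin 2 → Ω → Fin M → ℂ)
    (hxbar : ∀ k ω, xbar k ω = (Diamond.mmseF σ (H k ω))ᴴ *ᵥ y k ω)
    (z : Fin 2 → Ω → Fin M → ℂ) (hz : ∀ k ω, z k ω = xbar k ω + q k ω) :
    -- the bottleneck constraints hold, for `(y, H)` and for the estimates as observations
    (∀ T : Finset (Fin 2),
      Diamond.condMutualInfo (fun ω (k : T) => (y k ω, H k ω)) (fun ω (k : T) => z k ω)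
        (fun ω (k : (Tᶜ : Finset (Fin 2))) => z k ω) μ ≤ ENNReal.ofReal (∑ k ∈ T, C k)) ∧
    (∀ T : Finset (Fin 2),
      Diamond.condMutualInfo (fun ω (k : T) => xbar k ω) (fun ω (k : T) => z k ω)
        (fun ω (k : (Tᶜ : Finset (Fin 2))) => z k ω) μ ≤ ENNReal.ofReal (∑ k ∈ T, C k)) ∧
    -- the expectations that enter the bound exist
    (∀ k, Integrable (Diamond.eigenAverage (M := M) (N := N k) σ)
      (Diamond.rayleighLaw (N k) M)) ∧
    Integrable (Diamond.logDetCov (M := M) (N := N) σ D) (Diamond.channelLaw M N) ∧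
    -- `Gₖ` is the stated multiple of the identity
    (∀ k, 0 < D k ∧ 0 < ((min (N k) M : ℕ) : ℝ) / (M : ℝ) * Diamond.eigenMean M (N k) σ
          - (((min (N k) M : ℕ) : ℝ) / (M : ℝ)) ^ 2 * Diamond.eigenMean M (N k) σ ^ 2 + D k ∧
      Diamond.matG M (N k) σ (D k) =
        ((((min (N k) M : ℕ) : ℝ) / (M : ℝ) * Diamond.eigenMean M (N k) σ
          - (((min (N k) M : ℕ) : ℝ) / (M : ℝ)) ^ 2 * Diamond.eigenMean M (N k) σ ^ 2
          + D k : ℝ) : ℂ) • (1 : Matrix (Fin M) (Fin M) ℂ)) ∧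
    -- the bottleneck rate is at least the lower bound
    ((Diamond.rateLB M N σ C : ℝ) : EReal) ≤
      ((Diamond.mutualInfo x (fun ω k => z k ω) μ : ℝ≥0∞) : EReal) := by
  have hDpos : ∀ k, 0 < D k := fun k =>
    hD k ▸ Diamond.quantNoise_pos hσ hM (hN k) (hC k)
  obtain rfl : y = fun k ω => H k ω *ᵥ x ω + n k ω := funext fun k => funext fun ω => hy k ω
  obtain rfl : xbar = fun k ω => (Diamond.mmseF σ (H k ω))ᴴ *ᵥ (H k ω *ᵥ x ω + n k ω) :=
    funext fun k => funext fun ω => hxbar k ω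
  obtain rfl : z = fun k ω => Diamond.relayOut σ (H k ω) (x ω) (n k ω) (q k ω) :=
    funext fun k => funext fun ω => hz k ω
  refine ⟨fun T => ?_, fun T => ?_, fun k => Diamond.integrable_eigenAverage hσ hM (hN k),
    Diamond.integrable_logDetCov hσ hDpos, fun k => ⟨hDpos k, ?_, Diamond.matG_eq hσ (D k)⟩,
    Diamond.rateLB_le_mutualInfo hlaw hσ hM hN hC hD⟩
  -- Both constraints are instances of one bound: the estimate is recovered from `(y, H)` by
  -- applying `Fᴴ`, and from itself by the identity.
  · exact Diamond.condMutualInfo_output_le hlaw hσ hM hN hC hD T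
      (Diamond.measurable_observation T) (Diamond.measurable_estimate_of_observation hσ T)
      fun p k => rfl
  · exact Diamond.condMutualInfo_output_le hlaw hσ hM hN hC hD T
      (Diamond.measurable_estimate hσ T) measurable_id fun p k => rfl
  · have h := Diamond.outputVar_pos hσ hM (hN k) (hDpos k)
    rwa [Diamond.outputVar, Diamond.mmseGain, mul_pow] at h
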